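/- **Theorem 2.** *Model.* In the plane $\mathbb R^2$ a UAV (the corresponding UAV) is at the origin, and the other UAVs form a homogeneous Poisson point process $\Phi$ of density $\lambda>0$. Every UAV is the centre of a cluster of users. The positions of users relative to their cluster centre are i.i.d., either (Thomas, TCP) with density $\frac1{2\pi\sigma^2}e^{-\|u\|^2/(2\sigma^2)}$, $\sigma>0$, or (Matérn, MCP) with density $\frac1{\pi R^2}\mathbf U(R-\|u\|)$, $R>0$, where $\mathbf U$ is the unit step function ($\mathbf U(x)=1$ for $x\ge0$, $0$ for $x<0$). In the *fixed case* every cluster has $\bar N\ge1$ users; in the *random case* the clusters of the other UAVs have independent Poisson numbers of users with mean $\bar n\ge 1$, and the cluster of the corresponding UAV has $1+M$ users with $M$ Poisson of mean $\bar n-1$. The transmitting user $u_0$ is selected uniformly at random in the cluster of the corresponding UAV; all other users interfere. Users have altitude $h_u$, UAVs altitude $h_v\ne h_u$; $\Delta h=|h_u-h_v|$. A link at horizontal distance $r$ from the origin is in the blockage cell $\gamma=\lfloor r\sqrt{\beta_a\beta_b}\rfloor$ ($\beta_a,\beta_b>0$) and is LOS ($\kappa=L$) with probability $$p_L(\gamma)=\prod_{n=0}^{\gamma}\Bigl(1-\exp\Bigl(-\frac{(\gamma\max(h_u,h_v)-(n+\frac12)\Delta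 h)^2}{2\varepsilon^2\gamma^2}\Bigr)\Bigr),\qquad p_L(0)=1,$$ $\varepsilon>0$, and NLOS ($\kappa=N$) with probability $p_N=1-p_L$. Its channel gain is $C_\kappa(r^2+\Delta h^2)^{-\alpha_\kappa/2}\,G\,|\hat h|^2$, where $C_\kappa,\alpha_\kappa>0$, $|\hat h|^2$ is a gamma variable with shape and rate $\mathcal N_\kappa\in\{1,2,\dots\}$, and $G=o_1$ for the desired link, while for an interfering link $G=o_i$ with probability $p_i$, $i=1,\dots,4$: with main beam gains $M_t,M_r>0$, side lobe gains $m_t,m_r\ge0$, beamwidths $\theta^a_c\in[0,2\pi]$, $\theta^e_c\in[0,\pi]$ and $b_c=\frac{\theta_c^a}{2\pi}\frac{\theta_c^e}{\pi}$ for $c\in\{t,r\}$, $$(o_i)=(M_tM_r,\;m_tM_r,\;M_tm_r,\;m_tm_r),\qquad (p_i)=(b_tb_r,\;(1-b_t)b_r,\;b_t(1-b_r),\;(1-b_t)(1-b_r)).$$ The counts, the selection, the positions, the link states (given the positions), the gains and the fadings are independent. Let $I_{intra}$ be the sum of the channel gains of the interfering users of the corresponding UAV's own cluster, $I_{inter}$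 that of the users of all other clusters, $n_0^2>0$ the noise power and $P_u>0$ the transmit power of a user. With $S$ the channel gain of the desired link, the SINR is $\Upsilon_{up}=S/(I_{intra}+I_{inter}+n_0^2/P_u)$, and $P_{up}(\Upsilon)=\mathbb P[\Upsilon_{up}>\Upsilon]$. *Notation.* $f_n(w)=\frac{w}{\sigma^2}e^{-w^2/(2\sigma^2)}$ for TCP and $f_n(w)=\frac{2w}{R^2}\mathbf U(R-w)$ for MCP; $f_Q(g|q)=\frac g{\sigma^2}e^{-(g^2+q^2)/(2\sigma^2)}I_0(\frac{gq}{\sigma^2})$ for TCP, with $I_0$ the modified Bessel function of the first kind of order zero, and $$f_Q(g|q)=\tfrac{2g}{\pi R^2}\arccos\tfrac{g^2+q^2-R^2}{2gq}\,\mathbf U(g-|R-q|)\,\mathbf U(R+q-g)+\tfrac{2g}{R^2}\mathbf U(R-q-g)$$ for MCP. With $c_\gamma=\gamma/\sqrt{\beta_a\beta_b}$, $$\Lambda^\kappa_\gamma(w,s)=p_\kappa(\gamma)\sum_{i=1}^4p_i\Bigl(1+\frac{sC_\kappa o_i}{\mathcal N_\kappa(w^2+\Delta h^2)^{\alpha_\kappa/2}}\Bigr)^{-\mathcal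 N_\kappa},$$ $$O_a(s)=\sum_{\gamma\ge0}\int_{c_\gamma}^{c_{\gamma+1}}(\Lambda^L_\gamma+\Lambda^N_\gamma)(w,s)f_n(w)\,dw,\qquad O_e(s,q)=\sum_{\gamma\ge0}\int_{c_\gamma}^{c_{\gamma+1}}(\Lambda^L_\gamma+\Lambda^N_\gamma)(g,s)f_Q(g|q)\,dg,$$ and, in the fixed case, $$\mathcal L_a(s)=O_a(s)^{\bar N-1},\qquad \mathcal L_e(s)=\exp\Bigl(-2\pi\lambda\int_0^\infty(1-O_e(s,q)^{\bar N})\,q\,dq\Bigr),$$ in the random case $$\mathcal L_a(s)=e^{-(\bar n-1)(1-O_a(s))},\qquad \mathcal L_e(s)=\exp\Bigl(-2\pi\lambda\int_0^\infty(1-e^{-\bar n(1-O_e(s,q))})\,q\,dq\Bigr),$$ where $\exp(-\infty)=0$. Finally $\eta_\kappa=\mathcal N_\kappa(\mathcal N_\kappa!)^{-1/\mathcal N_\kappa}$, $a_\kappa(w)=o_1C_\kappa(w^2+\Delta h^2)^{-\alpha_\kappa/2}$ and $$\Psi^\kappa(w)=\sum_{n=1}^{\mathcal N_\kappa}(-1)^{n+1}\binom{\mathcal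 N_\kappa}{n}\exp\Bigl(-\frac{n\eta_\kappa\Upsilon n_0^2}{P_u\,a_\kappa(w)}\Bigr)\mathcal L_a\Bigl(\frac{n\eta_\kappa\Upsilon}{a_\kappa(w)}\Bigr)\mathcal L_e\Bigl(\frac{n\eta_\kappa\Upsilon}{a_\kappa(w)}\Bigr)f_n(w).$$ *Claim.* For all $s\ge0$, $\mathbb E[e^{-sI_{intra}}]=\mathcal L_a(s)$ and $\mathbb E[e^{-sI_{inter}}]=\mathcal L_e(s)$. For every threshold $\Upsilon>0$ the expression $$A(\Upsilon)=\sum_{\gamma\ge0}\int_{c_\gamma}^{c_{\gamma+1}}\bigl(p_L(\gamma)\Psi^L(w)+p_N(\gamma)\Psi^N(w)\bigr)\,dw$$ is well defined (the integrals exist and the series converges absolutely), and $P_{up}(\Upsilon)\approx A(\Upsilon)$ in the following sense. 1. $A(\Upsilon)$ is exactly the coverage probability with the conditional probability $\mathbb P[|\hat h|^2>x]$ for the fading power of the desired link in state $\kappa$ replaced by $1-(1-e^{-\eta_\kappa x})^{\mathcal N_\kappa}$, that is, $A(\Upsilon)=\mathbb E\bigl[1-(1-e^{-\eta_{\kappa_0}X})^{\mathcal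 N_{\kappa_0}}\bigr]$ with $X=\Upsilon\,(I_{intra}+I_{inter}+n_0^2/P_u)/a_{\kappa_0}(\|u_0\|)$ and $\kappa_0$ the state of the desired link. 2. $P_{up}(\Upsilon)\le A(\Upsilon)$. 3. $|P_{up}(\Upsilon)-A(\Upsilon)|\le\max_{\kappa}\sup_{x\ge0}\bigl|\mathbb P[\Gamma_\kappa>x]-\bigl(1-(1-e^{-\eta_\kappa x})^{\mathcal N_\kappa}\bigr)\bigr|$, where $\Gamma_\kappa$ is a gamma variable with shape and rate $\mathcal N_\kappa$. 4. If $\mathcal N_L=\mathcal N_N=1$, then $P_{up}(\Upsilon)=A(\Upsilon)$. -/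

import Mathlib

open MeasureTheory ProbabilityTheory
open scoped ENNReal NNReal

noncomputable section

namespace UAVUplink

/-- The horizontal plane, with the Euclidean norm. -/
abbrev Plane := EuclideanSpace ℝ (Fin 2)

/-- The two propagation states of a link: line of sight and non line of sight. -/
inductive Link where
  | los : Link
  | nlos : Link
deriving DecidableEq

instance : Fintype Link where
  elems := {Link.los, Link.nlos}
  complete := fun κ => by cases κ <;> simp

/-- The shape of a cluster: isotropic normal with standard deviation `σ` (Thomas), or uniform on a
disc of radius `R` (Matérn). -/
inductive ClusterShape where
  | thomas (σ : ℝ) (hσ : 0 < σ) : ClusterShape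
  | matern (R : ℝ) (hR : 0 < R) : ClusterShape

/-- The number of users in a cluster: a constant (fixed case) or Poisson with a given mean
(random case). -/
inductive UserNumber where
  | fixed (N : ℕ) (hN : 1 ≤ N) : UserNumber
  | random (n : ℝ) (hn : 1 ≤ n) : UserNumber

/-- The deterministic parameters of the uplink phase. In the antenna parameters, `t` stands for the
transmitters (users) and `r` for the receivers (UAVs). -/
structure Setting where
  /-- density of the UAVs -/
  lam : ℝ
  lam_pos : 0 < lam
  shape : ClusterShape
  number : UserNumber
  /-- altitude of the users -/
  hu : ℝ
  /-- altitude of the UAVs -/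
  hv : ℝ
  heights_ne : hu ≠ hv
  /-- ratio of the obstacle area to the total area -/
  betaA : ℝ
  betaA_pos : 0 < betaA
  /-- density of the obstacles -/
  betaB : ℝ
  betaB_pos : 0 < betaB
  /-- Rayleigh scale of the obstacle heights -/
  eps : ℝ
  eps_pos : 0 < eps
  /-- intercepts of the path loss -/
  C : Link → ℝ
  C_pos : ∀ κ, 0 < C κ
  /-- path loss exponents -/
  alpha : Link → ℝ
  alpha_pos : ∀ κ, 0 < alpha κ
  /-- Nakagami parameters -/
  Nak : Link → ℕ
  Nak_pos : ∀ κ, 1 ≤ Nak κ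
  /-- main beam gains -/
  Mt : ℝ
  Mt_pos : 0 < Mt
  Mr : ℝ
  Mr_pos : 0 < Mr
  /-- side lobe gains -/
  mt : ℝ
  mt_nonneg : 0 ≤ mt
  mr : ℝ
  mr_nonneg : 0 ≤ mr
  /-- half-power beamwidths in the azimuth plane -/
  thetaTa : ℝ
  thetaTa_mem : thetaTa ∈ Set.Icc 0 (2 * Real.pi)
  thetaRa : ℝ
  thetaRa_mem : thetaRa ∈ Set.Icc 0 (2 * Real.pi)
  /-- half-power beamwidths in the elevation plane -/
  thetaTe : ℝ
  thetaTe_mem : thetaTe ∈ Set.Icc 0 Real.pi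
  thetaRe : ℝ
  thetaRe_mem : thetaRe ∈ Set.Icc 0 Real.pi
  /-- transmit power of a user -/
  Pu : ℝ
  Pu_pos : 0 < Pu
  /-- power `n₀²` of the thermal noise -/
  noise : ℝ
  noise_pos : 0 < noise

/-- `exp (-x)` for `x ∈ [0, ∞]`, with `exp (-∞) = 0`. -/
def expNeg (x : ℝ≥0∞) : ℝ := if x = ∞ then 0 else Real.exp (-x.toReal)

/-- The unit step function. -/
def unitStep (x : ℝ) : ℝ := if 0 ≤ x then 1 else 0

/-- The modified Bessel function of the first kind of order zero. -/
def besselI0 (x : ℝ) : ℝ :=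
  (1 / Real.pi) * ∫ θ in (0 : ℝ)..Real.pi, Real.exp (x * Real.cos θ)

/-! ### Distributions of the users -/

/-- Density of the position of a user relative to its cluster centre. -/
def ClusterShape.density : ClusterShape → Plane → ℝ
  | .thomas σ _, u => 1 / (2 * Real.pi * σ ^ 2) * Real.exp (-(‖u‖ ^ 2 / (2 * σ ^ 2)))
  | .matern R _, u => 1 / (Real.pi * R ^ 2) * unitStep (R - ‖u‖)

/-- Law of the position of a user relative to its cluster centre. -/
def ClusterShape.law (c : ClusterShape) : Measure Plane :=
  volume.withDensity fun u => ENNReal.ofReal (c.density u)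

/-- Density `f_n` of the distance of a user to the centre of its own cluster. -/
def ClusterShape.pdfIntra : ClusterShape → ℝ → ℝ
  | .thomas σ _, w => w / σ ^ 2 * Real.exp (-(w ^ 2 / (2 * σ ^ 2)))
  | .matern R _, w => 2 * w / R ^ 2 * unitStep (R - w)

/-- Density `f_Q(g | q)` of the distance `g` to the origin of a user whose cluster centre is at
distance `q` from the origin. -/
def ClusterShape.pdfInter : ClusterShape → ℝ → ℝ → ℝ
  | .thomas σ _, g, q =>
      g / σ ^ 2 * Real.exp (-((g ^ 2 + q ^ 2) / (2 * σ ^ 2))) * besselI0 (g * q / σ ^ 2)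
  | .matern R _, g, q =>
      2 * g / (Real.pi * R ^ 2) * Real.arccos ((g ^ 2 + q ^ 2 - R ^ 2) / (2 * g * q)) *
          unitStep (g - |R - q|) * unitStep (R + q - g) +
        2 * g / R ^ 2 * unitStep (R - q - g)

/-- Law of the number of users in a cluster other than the corresponding one. -/
def UserNumber.law : UserNumber → Measure ℕ
  | .fixed N _ => Measure.dirac N
  | .random n _ => poissonMeasure n.toNNReal

/-- Law of the number of users in the corresponding cluster: `N`, or, in the random case, one
transmitting user and a Poisson number of interferers, with `n` users on average. -/
def UserNumber.typicalLaw : UserNumber → Measure ℕ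
  | .fixed N _ => Measure.dirac N
  | .random n _ => (poissonMeasure (n - 1).toNNReal).map (fun k => k + 1)

namespace Setting

variable (S : Setting)

/-! ### Blockage, path loss and antennas -/

/-- `√(βₐ β_b)`; the blockage cell `γ` is the interval of distances `[γ/√(βₐβ_b), (γ+1)/√(βₐβ_b))`. -/
def rootBeta : ℝ := Real.sqrt (S.betaA * S.betaB)

/-- The difference of the altitudes of users and UAVs. -/
def dh : ℝ := |S.hu - S.hv|

/-- The probability that a link in the blockage cell `γ` is LOS. For `γ = 0` the exponent of the only
factor of the product is `-∞`, so that the product is one. -/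
def losProb (γ : ℕ) : ℝ :=
  if γ = 0 then 1 else
    ∏ n ∈ Finset.range (γ + 1), (1 - Real.exp
      (-(((γ : ℝ) * max S.hu S.hv - ((n : ℝ) + 1 / 2) * |S.hu - S.hv|) ^ 2 /
        (2 * S.eps ^ 2 * (γ : ℝ) ^ 2))))

/-- The probability `p_κ(γ)` of the state `κ` for a link in the blockage cell `γ`. -/
def linkProb : Link → ℕ → ℝ
  | .los, γ => S.losProb γ
  | .nlos, γ => 1 - S.losProb γ

/-- The path loss of a link in state `κ` at horizontal distance `r`. -/
def pathLoss (κ : Link) (r : ℝ) : ℝ :=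
  S.C κ / Real.sqrt ((r ^ 2 + S.dh ^ 2) ^ S.alpha κ)

/-- Probability of the main beam, at the transmitter and at the receiver. -/
def beamT : ℝ := S.thetaTa / (2 * Real.pi) * (S.thetaTe / Real.pi)

def beamR : ℝ := S.thetaRa / (2 * Real.pi) * (S.thetaRe / Real.pi)

/-- The four values of the directivity gain of an interfering link; the first is the gain of the
desired link. -/
def gainValue : Fin 4 → ℝ :=
  ![S.Mt * S.Mr, S.mt * S.Mr, S.Mt * S.mr, S.mt * S.mr]

/-- The probabilities of the four values. -/
def gainProb : Fin 4 → ℝ :=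
  ![S.beamT * S.beamR, (1 - S.beamT) * S.beamR, S.beamT * (1 - S.beamR),
    (1 - S.beamT) * (1 - S.beamR)]

/-- Law of the directivity gain of an interfering link. -/
def gainLaw : Measure ℝ :=
  ∑ i : Fin 4, ENNReal.ofReal (S.gainProb i) • Measure.dirac (S.gainValue i)

/-- Law of the pair of fading powers `|ĥ|²` for the two link states: normalized gamma variables with
the Nakagami parameters. -/
def fadingLaw : Measure (Link → ℝ) :=
  Measure.pi fun κ => gammaMeasure (S.Nak κ) (S.Nak κ)

end Setting

/-! ### The random network -/

/-- The randomness attached to a user: its position relative to the cluster centre, a uniform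
variable that decides the blockage, the directivity gain of the link to the corresponding UAV if the
user is an interferer, and the fading power in each of the two link states. -/
structure Mark where
  offset : Plane
  unif : ℝ
  gain : ℝ
  fading : Link → ℝ

/-- A mark as a tuple. -/
def Mark.toProd (m : Mark) : Plane × ℝ × ℝ × (Link → ℝ) := (m.offset, m.unif, m.gain, m.fading)

instance : MeasurableSpace Mark := MeasurableSpace.comap Mark.toProd inferInstance

/-- The law of a mark: independent components. -/
def Setting.markLaw (S : Setting) : Measure (Plane × ℝ × ℝ × (Link → ℝ)) :=
  S.shape.law.prod ((volume.restrict (Set.Icc (0 : ℝ) 1)).prod (S.gainLaw.prod S.fadingLaw))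

/-- The number of points of a random sequence in a set. -/
def countIn {Ω : Type*} (V : ℕ → Ω → Plane) (A : Set Plane) (ω : Ω) : ℝ≥0∞ :=
  ∑' i, A.indicator (fun _ => (1 : ℝ≥0∞)) (V i ω)

/-- The random points `V 0, V 1, …` are an enumeration of a homogeneous Poisson point process of
density `lam` on the plane: the numbers of points in sets of finite area are Poisson with mean
`lam` times the area, and independent for disjoint sets. -/
structure IsPoissonProcess {Ω : Type*} [MeasurableSpace Ω] (μ : Measure Ω) (lam : ℝ)
    (V : ℕ → Ω → Plane) : Prop where
  measurable : ∀ i, Measurable (V i)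
  count_law : ∀ A : Set Plane, MeasurableSet A → volume A ≠ ∞ →
    μ.map (countIn V A) =
      (poissonMeasure (lam.toNNReal * (volume A).toNNReal)).map (fun k : ℕ => (k : ℝ≥0∞))
  count_indep : ∀ (m : ℕ) (A : Fin m → Set Plane), (∀ l, MeasurableSet (A l)) →
    (∀ l, volume (A l) ≠ ∞) → Pairwise (fun l l' => Disjoint (A l) (A l')) →
    iIndepFun (fun l => countIn V (A l)) μ

/-- The uplink network seen from the corresponding UAV, which is at the origin. The other UAVs are
a Poisson process, clusters and users are independent. Cluster `none` is the corresponding one,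
cluster `some i` is centred at the `i`-th other UAV; the users of a cluster are numbered from `0`. -/
structure Network (S : Setting) {Ω : Type*} [MeasurableSpace Ω] (μ : Measure Ω) where
  /-- positions of the other UAVs -/
  uav : ℕ → Ω → Plane
  /-- numbers of users in the clusters of the other UAVs -/
  count : ℕ → Ω → ℕ
  /-- number of users in the corresponding cluster -/
  count₀ : Ω → ℕ
  /-- number of the transmitting user in the corresponding cluster -/
  selected : Ω → ℕ
  /-- marks of the users -/
  mark : Option ℕ × ℕ → Ω → Mark
  uav_poisson : IsPoissonProcess μ S.lam uav
  count_measurable : ∀ i, Measurable (count i)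
  count_law : ∀ i, μ.map (count i) = S.number.law
  count₀_measurable : Measurable count₀
  selected_measurable : Measurable selected
  /-- the transmitting user is uniformly distributed among the users of the cluster -/
  selection_law : ∀ m k : ℕ, μ {ω | count₀ ω = m ∧ selected ω = k} =
    if k < m then S.number.typicalLaw {m} / (m : ℝ≥0∞) else 0
  mark_measurable : ∀ l, Measurable (mark l)
  mark_law : ∀ l, μ.map (fun ω => (mark l ω).toProd) = S.markLaw
  count_indep : iIndepFun count μ
  mark_indep : iIndepFun mark μ
  uav_indep : IndepFun (fun ω i => uav i ω)
    (fun ω => ((count₀ ω, selected ω), (fun i => count i ω), fun l => mark l ω)) μ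
  selection_indep : IndepFun (fun ω => (count₀ ω, selected ω))
    (fun ω => ((fun i => count i ω), fun l => mark l ω)) μ
  count_mark_indep : IndepFun (fun ω i => count i ω) (fun ω l => mark l ω) μ

namespace Setting

variable (S : Setting)

/-- The state of the link to the origin of a user at distance `r`: LOS with the probability of the
blockage cell of `r`. -/
def linkState (r : ℝ) (m : Mark) : Link :=
  if m.unif ≤ S.linkProb .los ⌊r * S.rootBeta⌋₊ then .los else .nlos

/-- The channel gain `H_g` between an interfering user at `u` and the origin. -/
def channelGain (u : Plane) (m : Mark) : ℝ :=
  S.pathLoss (S.linkState ‖u‖ m) ‖u‖ * m.gain * m.fading (S.linkState ‖u‖ m)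

/-- The channel gain `H_g⁰` of the desired link, with the maximal antenna gain. -/
def desiredGain (u : Plane) (m : Mark) : ℝ :=
  S.pathLoss (S.linkState ‖u‖ m) ‖u‖ * S.gainValue 0 * m.fading (S.linkState ‖u‖ m)

end Setting

namespace Network

variable {S : Setting} {Ω : Type*} [MeasurableSpace Ω] {μ : Measure Ω} (net : Network S μ)

/-- The mark of the transmitting user. -/
def mark₀ (ω : Ω) : Mark := net.mark (none, net.selected ω) ω

/-- Intra-cluster interference. -/
def intra (ω : Ω) : ℝ≥0∞ :=
  ∑ j ∈ (Finset.range (net.count₀ ω)).erase (net.selected ω),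
    ENNReal.ofReal (S.channelGain (net.mark (none, j) ω).offset (net.mark (none, j) ω))

/-- Inter-cluster interference. -/
def inter (ω : Ω) : ℝ≥0∞ :=
  ∑' i, ∑ j ∈ Finset.range (net.count i ω),
    ENNReal.ofReal (S.channelGain (net.uav i ω + (net.mark (some i, j) ω).offset)
      (net.mark (some i, j) ω))

/-- Interference plus noise, in units of the transmit power. -/
def disturbance (ω : Ω) : ℝ≥0∞ :=
  net.intra ω + net.inter ω + ENNReal.ofReal (S.noise / S.Pu)

/-- The signal to interference plus noise ratio at the corresponding UAV. -/
def sinr (ω : Ω) : ℝ≥0∞ :=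
  ENNReal.ofReal (S.desiredGain (net.mark₀ ω).offset (net.mark₀ ω)) / net.disturbance ω

/-- The uplink coverage probability for the threshold `T`. -/
def coverage (T : ℝ) : ℝ := μ.real {ω | ENNReal.ofReal T < net.sinr ω}

/-- The state of the desired link. -/
def state₀ (ω : Ω) : Link := S.linkState ‖(net.mark₀ ω).offset‖ (net.mark₀ ω)

/-- The fading level that the desired link has to exceed for the threshold `T` to be exceeded. -/
def level (T : ℝ) (ω : Ω) : ℝ≥0∞ :=
  ENNReal.ofReal (T / (S.gainValue 0 * S.pathLoss (net.state₀ ω) ‖(net.mark₀ ω).offset‖)) *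
    net.disturbance ω

end Network

/-! ### The analytical expression -/

namespace Setting

variable (S : Setting)

/-- `Λ^κ(w, s)` in the blockage cell `γ`. -/
def Lam (κ : Link) (γ : ℕ) (w s : ℝ) : ℝ :=
  S.linkProb κ γ * ∑ i : Fin 4, S.gainProb i *
    ((1 + s * S.C κ * S.gainValue i /
      ((S.Nak κ : ℝ) * Real.sqrt ((w ^ 2 + S.dh ^ 2) ^ S.alpha κ))) ^ S.Nak κ)⁻¹

/-- The end points of the blockage cells. -/
def cell (γ : ℕ) : ℝ := (γ : ℝ) / S.rootBeta

/-- `O_a(s)`. -/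
def Oa (s : ℝ) : ℝ :=
  ∑' γ : ℕ, ∫ w in S.cell γ..S.cell (γ + 1),
    (S.Lam .los γ w s + S.Lam .nlos γ w s) * S.shape.pdfIntra w

/-- `O_e(s, q)`. -/
def Oe (s q : ℝ) : ℝ :=
  ∑' γ : ℕ, ∫ g in S.cell γ..S.cell (γ + 1),
    (S.Lam .los γ g s + S.Lam .nlos γ g s) * S.shape.pdfInter g q

/-- The probability generating functional factor of one interfering cluster. -/
def clusterFactor : UserNumber → ℝ → ℝ
  | .fixed N _, x => x ^ N
  | .random n _, x => Real.exp (-(n * (1 - x)))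

/-- The expression for the Laplace transform of the intra-cluster interference. -/
def La (s : ℝ) : ℝ :=
  match S.number with
  | .fixed N _ => S.Oa s ^ (N - 1)
  | .random n _ => Real.exp (-((n - 1) * (1 - S.Oa s)))

/-- The expression for the Laplace transform of the inter-cluster interference. The integral over
`q` is a Lebesgue integral of a nonnegative function and may be infinite. -/
def Le (s : ℝ) : ℝ :=
  expNeg (ENNReal.ofReal (2 * Real.pi * S.lam) *
    ∫⁻ q in Set.Ioi (0 : ℝ), ENNReal.ofReal ((1 - clusterFactor S.number (S.Oe s q)) * q))

/-- `η_κ = N_κ (N_κ!)^(-1/N_κ)`. -/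
def eta (κ : Link) : ℝ :=
  (S.Nak κ : ℝ) * ((S.Nak κ).factorial : ℝ) ^ (-(1 : ℝ) / (S.Nak κ : ℝ))

/-- `1 - (1 - e^(-η_κ x))^(N_κ)`, which stands for the probability that the fading power in the
state `κ` exceeds `x`. -/
def approxTail (κ : Link) (x : ℝ≥0∞) : ℝ :=
  1 - (1 - expNeg (ENNReal.ofReal (S.eta κ) * x)) ^ S.Nak κ

/-- `o₁ C_κ (w² + Δh²)^(-α_κ/2)`. -/
def signalScale (κ : Link) (w : ℝ) : ℝ :=
  S.gainValue 0 * S.C κ * (w ^ 2 + S.dh ^ 2) ^ (-(S.alpha κ / 2))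

/-- `Ψ^κ(w)` for the threshold `T`. -/
def Psi (T : ℝ) (κ : Link) (w : ℝ) : ℝ :=
  ∑ n ∈ Finset.Icc 1 (S.Nak κ), (-1) ^ (n + 1) * ((S.Nak κ).choose n : ℝ) *
    Real.exp (-((n : ℝ) * S.eta κ * T * S.noise / (S.Pu * S.signalScale κ w))) *
    S.La ((n : ℝ) * S.eta κ * T / S.signalScale κ w) *
    S.Le ((n : ℝ) * S.eta κ * T / S.signalScale κ w) * S.shape.pdfIntra w

/-- The integrand in the blockage cell `γ`. -/
def integrand (T : ℝ) (γ : ℕ) (w : ℝ) : ℝ :=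
  S.linkProb .los γ * S.Psi T .los w + S.linkProb .nlos γ * S.Psi T .nlos w

/-- The analytical expression for the coverage probability. -/
def coverageFormula (T : ℝ) : ℝ :=
  ∑' γ : ℕ, ∫ w in S.cell γ..S.cell (γ + 1), S.integrand T γ w

end Setting

end UAVUplink

end

/-! The event that the SINR exceeds the threshold says that the fading power of the desired link
exceeds a random level: the threshold times interference plus noise, divided by the deterministic
part of the received signal. The fading of the transmitting user is independent of its position, its
link state and the interference. The coverage probability is therefore the mean of the gamma tail at
that level (`measure_lt_sinr`, `coverage_eq`), and the formula is the same mean with `approxTail` as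
tail.

For the formula, `1 - (1 - e^(-η x))^N` is expanded binomially. At the random level every term is an
exponential of noise plus interference, so its mean is an explicit noise factor times the joint
Laplace transform of the interference (`meanTail_mul_pdfIntra`). Averaging over the distance and the
state of the desired link, and cutting the half-line into blockage cells, yields `coverageFormula`
(`integral_approxTail_level`).

The joint Laplace transform is `lintegral_lexp_interference`. One interferer contributes an average
over position, link state, gain and gamma fading; its distance law, found in polar coordinates,
turns this average into `Oa` or `Oe`. A cluster contributes the generating function of its number of
users at that value. The other clusters are multiplied together by the generating functional of the
Poisson process (`lintegral_lexp_tsum`), proved from the law and independence of the counts in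
disjoint sets. The interference may be infinite, so everything is done on `[0, ∞]` with `exp (-∞) =
0`; exponentials bounded by one make dominated convergence available throughout.

The upper bound is Alzer's inequality (`gammaMeasure_real_Ioi_le`): the gamma tail lies below the
tail of the maximum of `N` exponential variables of rate `η`. The value of `η` makes the two
densities agree to leading order at zero, and log-convexity of a Laplace transform shows that their
difference changes sign at most once; since both have mass one, the tails are ordered. The error
bound and the exactness for `N = 1` compare the two tails pointwise inside the mean. -/

noncomputable section

namespace UAVUplink

/-! ### The exponential `exp (-x)` on `[0, ∞]` -/

/-- `exp (-x)` for `x ∈ [0, ∞]`, as an extended nonnegative number. -/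
def lexp (x : ℝ≥0∞) : ℝ≥0∞ := ENNReal.ofReal (expNeg x)

theorem expNeg_nonneg (x : ℝ≥0∞) : 0 ≤ expNeg x := by
  unfold expNeg; split_ifs <;> positivity

theorem expNeg_le_one (x : ℝ≥0∞) : expNeg x ≤ 1 := by
  unfold expNeg; split_ifs
  · exact zero_le_one
  · simp

theorem expNeg_top : expNeg ∞ = 0 := by simp [expNeg]

theorem expNeg_zero : expNeg 0 = 1 := by simp [expNeg]

theorem expNeg_ofReal {x : ℝ} (hx : 0 ≤ x) : expNeg (ENNReal.ofReal x) = Real.exp (-x) := by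
  simp [expNeg, ENNReal.toReal_ofReal hx]

theorem expNeg_add (x y : ℝ≥0∞) : expNeg (x + y) = expNeg x * expNeg y := by
  by_cases hx : x = ∞
  · simp [expNeg, hx]
  by_cases hy : y = ∞
  · simp [expNeg, hy]
  simp only [expNeg, hx, hy, ENNReal.add_eq_top, or_self, if_false]
  rw [ENNReal.toReal_add hx hy, neg_add, Real.exp_add]

theorem expNeg_antitone : Antitone expNeg := by
  intro x y h
  obtain ⟨z, rfl⟩ := exists_add_of_le h
  rw [expNeg_add]
  exact mul_le_of_le_one_right (expNeg_nonneg x) (expNeg_le_one z)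

theorem expNeg_pow (x : ℝ≥0∞) (n : ℕ) : expNeg x ^ n = expNeg (n * x) := by
  induction n with
  | zero => simp [expNeg_zero]
  | succ n ih => rw [pow_succ, ih, ← expNeg_add]; congr 1; push_cast; ring

@[fun_prop]
theorem measurable_expNeg : Measurable expNeg := expNeg_antitone.measurable

/-- `EReal.exp` is continuous on the whole extended line, which gives continuity of `lexp` at `∞`
without a separate limit argument. -/
theorem lexp_eq_exp (x : ℝ≥0∞) : lexp x = EReal.exp (-(x : EReal)) := by
  unfold lexp expNeg
  split_ifs with h
  · simp [h]
  · lift x to ℝ≥0 using h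
    have : -((x : ℝ≥0∞) : EReal) = ((-(x : ℝ) : ℝ) : EReal) := by
      rw [EReal.coe_neg]; rfl
    rw [this, EReal.exp_coe]; simp

theorem continuous_lexp : Continuous lexp := by
  have : lexp = fun x : ℝ≥0∞ => EReal.exp (-(x : EReal)) := funext lexp_eq_exp
  rw [this]
  exact ENNReal.continuous_exp.comp (continuous_neg.comp continuous_coe_ennreal_ereal)

@[fun_prop]
theorem measurable_lexp : Measurable lexp := continuous_lexp.measurable

theorem lexp_antitone : Antitone lexp := fun _ _ h => ENNReal.ofReal_le_ofReal (expNeg_antitone h)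

theorem lexp_zero : lexp 0 = 1 := by simp [lexp, expNeg_zero]

theorem lexp_le_one (x : ℝ≥0∞) : lexp x ≤ 1 := lexp_zero ▸ lexp_antitone zero_le

theorem lexp_add (x y : ℝ≥0∞) : lexp (x + y) = lexp x * lexp y := by
  rw [lexp, expNeg_add, ENNReal.ofReal_mul (expNeg_nonneg x)]; rfl

theorem lexp_sum {ι : Type*} (s : Finset ι) (f : ι → ℝ≥0∞) :
    lexp (∑ i ∈ s, f i) = ∏ i ∈ s, lexp (f i) := by
  classical
  induction s using Finset.induction_on with
  | empty => simp [lexp_zero]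
  | insert a s ha ih => rw [Finset.sum_insert ha, Finset.prod_insert ha, lexp_add, ih]

theorem lexp_ofReal {x : ℝ} (hx : 0 ≤ x) :
    lexp (ENNReal.ofReal x) = ENNReal.ofReal (Real.exp (-x)) := by
  rw [lexp, expNeg_ofReal hx]

theorem lexp_nat_mul (n : ℕ) (x : ℝ≥0∞) : lexp (n * x) = lexp x ^ n := by
  rw [lexp, ← expNeg_pow, ENNReal.ofReal_pow (expNeg_nonneg x)]; rfl

theorem lexp_pos {x : ℝ≥0∞} (hx : x ≠ ∞) : 0 < lexp x := by
  simp [lexp, expNeg, hx, Real.exp_pos]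

theorem integral_expNeg {Ω : Type*} [MeasurableSpace Ω] {μ : Measure Ω} {f : Ω → ℝ≥0∞}
    (hf : AEMeasurable f μ) : ∫ ω, expNeg (f ω) ∂μ = (∫⁻ ω, lexp (f ω) ∂μ).toReal :=
  integral_eq_lintegral_of_nonneg_ae (Filter.Eventually.of_forall fun _ => expNeg_nonneg _)
    (measurable_expNeg.comp_aemeasurable hf).aestronglyMeasurable

/-! ### The probability generating functional of a Poisson process -/

theorem lintegral_pow_poissonMeasure (r : ℝ≥0) {x : ℝ} (hx : 0 ≤ x) :
    ∫⁻ k, ENNReal.ofReal x ^ k ∂(poissonMeasure r) =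
      ENNReal.ofReal (Real.exp (-(r * (1 - x)))) := by
  rw [lintegral_countable']
  have h1 : ∀ k : ℕ, ENNReal.ofReal x ^ k * poissonMeasure r {k} =
      ENNReal.ofReal (Real.exp (-r) * ((r * x) ^ k / k.factorial)) := by
    intro k
    rw [poissonMeasure_singleton, ← ENNReal.ofReal_pow hx, ← ENNReal.ofReal_mul (by positivity)]
    congr 1; rw [mul_pow]; ring
  simp_rw [h1]
  have h2 : HasSum (fun k : ℕ => Real.exp (-r) * ((r * x) ^ k / k.factorial))
      (Real.exp (-r) * Real.exp (r * x)) := by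
    have := NormedSpace.expSeries_div_hasSum_exp (𝔸 := ℝ) ((r : ℝ) * x)
    rw [← Real.exp_eq_exp_ℝ] at this
    exact this.mul_left _
  rw [← ENNReal.ofReal_tsum_of_nonneg (fun k => by positivity) h2.summable, h2.tsum_eq,
    ← Real.exp_add]
  congr 2; ring

/-- This is the Poisson generating function at `e^(-y)`. The value `y = ∞` is allowed and gives the
void probability. -/
theorem lintegral_lexp_countIn {Ω : Type*} [MeasurableSpace Ω] {μ : Measure Ω} {lam : ℝ}
    {V : ℕ → Ω → Plane} (hV : IsPoissonProcess μ lam V) {A : Set Plane} (hA : MeasurableSet A)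
    (hA' : volume A ≠ ∞) {y : ℝ≥0∞} (hmeas : Measurable (countIn V A)) :
    ∫⁻ ω, lexp (y * countIn V A ω) ∂μ =
      lexp (ENNReal.ofReal lam * (volume A * (1 - lexp y))) := by
  have h1 : ∫⁻ ω, lexp (y * countIn V A ω) ∂μ =
      ∫⁻ z, lexp (y * z) ∂(μ.map (countIn V A)) := by
    rw [lintegral_map (by fun_prop) hmeas]
  rw [h1, hV.count_law A hA hA', lintegral_map (by fun_prop)
    (measurable_of_countable _)]
  have h2 : ∀ k : ℕ, lexp (y * k) = ENNReal.ofReal (expNeg y) ^ k := by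
    intro k; rw [mul_comm, lexp_nat_mul]; rfl
  simp_rw [h2]
  rw [lintegral_pow_poissonMeasure _ (expNeg_nonneg y)]
  have h3 : (1 : ℝ≥0∞) - lexp y = ENNReal.ofReal (1 - expNeg y) := by
    rw [lexp, ← ENNReal.ofReal_one, ENNReal.ofReal_sub _ (expNeg_nonneg y)]
  have h4 : ENNReal.ofReal lam * (volume A * (1 - lexp y)) = ENNReal.ofReal
      ((lam.toNNReal * (volume A).toNNReal : ℝ≥0) * (1 - expNeg y)) := by
    rw [h3, ENNReal.ofReal_mul (by positivity), ENNReal.ofReal_coe_nnreal, ENNReal.coe_mul,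
      ENNReal.coe_toNNReal hA', mul_assoc]; rfl
  rw [h4, lexp_ofReal]
  exact mul_nonneg (by positivity) (sub_nonneg.2 (expNeg_le_one y))

theorem measurable_countIn {Ω : Type*} [MeasurableSpace Ω] {V : ℕ → Ω → Plane}
    (hV : ∀ i, Measurable (V i)) {A : Set Plane} (hA : MeasurableSet A) :
    Measurable (countIn V A) :=
  Measurable.tsum fun i => (measurable_const.indicator hA).comp (hV i)

theorem lintegral_lexp_sum_countIn {Ω : Type*} [MeasurableSpace Ω] {μ : Measure Ω}
    {lam : ℝ} {V : ℕ → Ω → Plane} (hV : IsPoissonProcess μ lam V) {m : ℕ}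
    (A : Fin m → Set Plane) (hAm : ∀ l, MeasurableSet (A l)) (hAf : ∀ l, volume (A l) ≠ ∞)
    (hAd : Pairwise fun l l' => Disjoint (A l) (A l')) (y : Fin m → ℝ≥0∞) :
    ∫⁻ ω, lexp (∑ l, y l * countIn V (A l) ω) ∂μ =
      lexp (ENNReal.ofReal lam * ∑ l, volume (A l) * (1 - lexp (y l))) := by
  have hind : iIndepFun (fun l ω => lexp (y l * countIn V (A l) ω)) μ :=
    (hV.count_indep _ A hAm hAf hAd).comp (fun l z => lexp (y l * z)) fun l => by fun_prop
  have hmeas : ∀ l, Measurable (countIn V (A l)) := fun l =>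
    measurable_countIn hV.measurable (hAm l)
  simp_rw [lexp_sum]
  rw [lintegral_prod_eq_prod_lintegral_of_indepFun Finset.univ _ hind
    fun l => measurable_lexp.comp ((hmeas l).const_mul _), Finset.mul_sum, lexp_sum]
  exact Finset.prod_congr rfl fun l _ => lintegral_lexp_countIn hV (hAm l) (hAf l) (hmeas l)

/-- The sum of a simple function over the points is a linear combination of the counts in its
fibres, which are disjoint and hence carry independent Poisson counts. -/
theorem lintegral_lexp_tsum_simpleFunc {Ω : Type*} [MeasurableSpace Ω] {μ : Measure Ω}
    {lam : ℝ} {V : ℕ → Ω → Plane} (hV : IsPoissonProcess μ lam V)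
    (f : SimpleFunc Plane ℝ≥0∞) (hf : ∀ y, y ≠ 0 → volume (f ⁻¹' {y}) ≠ ∞) :
    ∫⁻ ω, lexp (∑' i, f (V i ω)) ∂μ =
      lexp (ENNReal.ofReal lam * ∫⁻ v, (1 - lexp (f v))) := by
  classical
  obtain ⟨m, y, hinj, hy0, hcov⟩ : ∃ (m : ℕ) (y : Fin m → ℝ≥0∞), Function.Injective y ∧
      (∀ l, y l ≠ 0) ∧ ∀ v, f v ≠ 0 → ∃ l, y l = f v := by
    refine ⟨_, fun l => ((f.range.filter (· ≠ 0)).equivFin.symm l : ℝ≥0∞),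
      Subtype.val_injective.comp (Equiv.injective _), fun l => ?_, fun v hv => ?_⟩
    · exact (Finset.mem_filter.1 ((f.range.filter (· ≠ 0)).equivFin.symm l).2).2
    · exact ⟨(f.range.filter (· ≠ 0)).equivFin
        ⟨f v, Finset.mem_filter.2 ⟨f.mem_range_self v, hv⟩⟩, by simp⟩
  have hAm : ∀ l, MeasurableSet (f ⁻¹' {y l}) := fun l => f.measurableSet_fiber _
  -- Used for `G = id` on the points and for `G z = 1 - lexp z` under the integral. Both vanish at
  -- zero, so the zero fibre, which may have infinite area, never enters.
  have hsum : ∀ G : ℝ≥0∞ → ℝ≥0∞, G 0 = 0 → ∀ v,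
      G (f v) = ∑ l, G (y l) * (f ⁻¹' {y l}).indicator (fun _ => 1) v := by
    intro G hG v
    by_cases hv : f v = 0
    · rw [hv, hG]
      refine (Finset.sum_eq_zero fun l _ => ?_).symm
      have : v ∉ f ⁻¹' {y l} := fun h => hy0 l (by rw [← h, hv])
      simp [this]
    · obtain ⟨l, hl⟩ := hcov v hv
      rw [Finset.sum_eq_single l]
      · simp [hl]
      · intro l' _ hl'
        have : v ∉ f ⁻¹' {y l'} := fun h => hl' (hinj (by rw [hl]; exact Eq.symm h))
        simp [this]
      · simp
  have h1 : ∀ ω, ∑' i, f (V i ω) = ∑ l, y l * countIn V (f ⁻¹' {y l}) ω := by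
    intro ω
    have h := hsum id rfl
    simp only [id] at h
    rw [tsum_congr fun i => h (V i ω), Summable.tsum_finsetSum fun _ _ => ENNReal.summable]
    exact Finset.sum_congr rfl fun l _ => ENNReal.tsum_mul_left
  simp_rw [h1]
  rw [lintegral_lexp_sum_countIn hV _ hAm (fun l => hf _ (hy0 l))
    fun l l' hll => Disjoint.preimage _ (Set.disjoint_singleton.2 fun h => hll (hinj h))]
  congr 2
  rw [lintegral_congr (hsum (fun z => 1 - lexp z) (by simp [lexp_zero])),
    lintegral_finsetSum _ fun l _ => (measurable_const.indicator (hAm l)).const_mul _]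
  refine Finset.sum_congr rfl fun l _ => ?_
  rw [lintegral_const_mul _ (measurable_const.indicator (hAm l)), lintegral_indicator (hAm l)]
  simp [mul_comm]

/-- The probability generating functional of a Poisson process. -/
theorem lintegral_lexp_tsum {Ω : Type*} [MeasurableSpace Ω] {μ : Measure Ω}
    [IsProbabilityMeasure μ] {lam : ℝ} {V : ℕ → Ω → Plane} (hV : IsPoissonProcess μ lam V)
    {f : Plane → ℝ≥0∞} (hf : Measurable f) :
    ∫⁻ ω, lexp (∑' i, f (V i ω)) ∂μ = lexp (ENNReal.ofReal lam * ∫⁻ v, (1 - lexp (f v))) := by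
  -- The restriction to balls gives the nonzero fibres finite area; the sequence still increases to
  -- `f`.
  set g : ℕ → SimpleFunc Plane ℝ≥0∞ := fun n =>
    (SimpleFunc.eapprox f n).restrict (Metric.ball 0 n) with hg
  have hgv : ∀ n v, g n v = (Metric.ball (0 : Plane) n).indicator (SimpleFunc.eapprox f n) v :=
    fun n v => SimpleFunc.restrict_apply _ Metric.isOpen_ball.measurableSet v
  have hgmono : ∀ v, Monotone fun n => g n v := by
    intro v n m hnm
    simp only [hgv]
    refine (Set.indicator_le_indicator (SimpleFunc.monotone_eapprox f hnm v)).trans ?_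
    exact Set.indicator_le_indicator_of_subset
      (Metric.ball_subset_ball (by exact_mod_cast hnm)) (fun _ => zero_le) v
  have hglim : ∀ v, Filter.Tendsto (fun n => g n v) Filter.atTop (nhds (f v)) := by
    intro v
    have h1 : Filter.Tendsto (fun n => SimpleFunc.eapprox f n v) Filter.atTop (nhds (f v)) := by
      rw [← SimpleFunc.iSup_eapprox_apply hf v]
      exact tendsto_atTop_iSup fun n m h => SimpleFunc.monotone_eapprox f h v
    refine h1.congr' ?_
    obtain ⟨N, hN⟩ := exists_nat_gt ‖v‖
    filter_upwards [Filter.eventually_ge_atTop N] with n hn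
    have : v ∈ Metric.ball (0 : Plane) n := by
      rw [mem_ball_zero_iff]; exact hN.trans_le (by exact_mod_cast hn)
    rw [hgv, Set.indicator_of_mem this]
  have hgf : ∀ n y, y ≠ 0 → volume (g n ⁻¹' {y}) ≠ ∞ := by
    intro n y hy
    refine ne_top_of_le_ne_top (Metric.isBounded_ball (x := (0 : Plane)) (r := n)).measure_lt_top.ne
      (measure_mono fun v hv => ?_)
    by_contra h
    apply hy
    have : g n v = y := hv
    rw [← this, hgv, Set.indicator_of_notMem h]
  have hleft : Filter.Tendsto (fun n => ∫⁻ ω, lexp (∑' i, g n (V i ω)) ∂μ) Filter.atTop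
      (nhds (∫⁻ ω, lexp (∑' i, f (V i ω)) ∂μ)) := by
    refine tendsto_lintegral_of_dominated_convergence (fun _ => 1) (fun n => ?_)
      (fun n => Filter.Eventually.of_forall fun ω => lexp_le_one _) (by simp)
      (Filter.Eventually.of_forall fun ω => ?_)
    · exact measurable_lexp.comp
        (Measurable.tsum fun i => (g n).measurable.comp (hV.measurable i))
    · refine (continuous_lexp.tendsto _).comp ?_
      -- The sum over the points is an integral for counting measure, so monotone convergence
      -- applies for each outcome.
      have := lintegral_tendsto_of_tendsto_of_monotone (μ := Measure.count)
        (f := fun n i => g n (V i ω)) (F := fun i => f (V i ω))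
        (fun n => (measurable_of_countable _).aemeasurable)
        (Filter.Eventually.of_forall fun i => hgmono _)
        (Filter.Eventually.of_forall fun i => hglim _)
      simpa only [lintegral_count] using this
  have hright : Filter.Tendsto
      (fun n => lexp (ENNReal.ofReal lam * ∫⁻ v, (1 - lexp (g n v)))) Filter.atTop
      (nhds (lexp (ENNReal.ofReal lam * ∫⁻ v, (1 - lexp (f v))))) := by
    refine (continuous_lexp.tendsto _).comp
      (ENNReal.Tendsto.const_mul ?_ (Or.inr ENNReal.ofReal_ne_top))
    refine lintegral_tendsto_of_tendsto_of_monotone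
      (fun n => (measurable_const.sub (measurable_lexp.comp (g n).measurable)).aemeasurable)
      (Filter.Eventually.of_forall fun v n m h => ?_)
      (Filter.Eventually.of_forall fun v => ?_)
    · exact tsub_le_tsub_left (lexp_antitone (hgmono v h)) 1
    · exact ENNReal.Tendsto.sub tendsto_const_nhds ((continuous_lexp.tendsto _).comp (hglim v))
        (Or.inl ENNReal.one_ne_top)
  refine tendsto_nhds_unique hleft (hright.congr fun n => ?_)
  exact (lintegral_lexp_tsum_simpleFunc hV (g n) (hgf n)).symm

/-! ### Gamma variables -/

/-- Exponential tilting: multiplying the gamma density of rate `r` by `e^(-c x)` gives a multiple of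
the gamma density of rate `r + c`, which has mass one. -/
theorem lintegral_exp_gammaMeasure {a r c : ℝ} (ha : 0 < a) (hr : 0 < r) (hc : 0 ≤ c) :
    ∫⁻ x, ENNReal.ofReal (Real.exp (-(c * x))) ∂(gammaMeasure a r) =
      ENNReal.ofReal (((1 + c / r) ^ a)⁻¹) := by
  have hm : Measurable fun x : ℝ => ENNReal.ofReal (Real.exp (-(c * x))) := by fun_prop
  have hg : Measurable (gammaPDF a r) := (measurable_gammaPDFReal a r).ennreal_ofReal
  rw [gammaMeasure, lintegral_withDensity_eq_lintegral_mul _ hg hm]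
  have h : ∀ x, (gammaPDF a r * fun x => ENNReal.ofReal (Real.exp (-(c * x)))) x =
      ENNReal.ofReal (((1 + c / r) ^ a)⁻¹) * gammaPDF a (r + c) x := by
    intro x
    simp only [Pi.mul_apply, gammaPDF, gammaPDFReal]
    rw [← ENNReal.ofReal_mul (by split_ifs <;> positivity), ← ENNReal.ofReal_mul (by positivity)]
    congr 1
    split_ifs with hx
    · have h1 : (r + c) ^ a = r ^ a * (1 + c / r) ^ a := by
        rw [← Real.mul_rpow hr.le (by positivity)]; congr 1; field_simp
      have h2 : Real.exp (-((r + c) * x)) = Real.exp (-(r * x)) * Real.exp (-(c * x)) := by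
        rw [← Real.exp_add]; congr 1; ring
      have h3 : (1 + c / r) ^ a ≠ 0 := by positivity
      rw [h1, h2]
      field_simp
    · simp
  simp_rw [h]
  have hg' : Measurable (gammaPDF a (r + c)) := (measurable_gammaPDFReal a (r + c)).ennreal_ofReal
  rw [lintegral_const_mul _ hg',
    lintegral_gammaPDF_eq_one ha (by positivity), mul_one]

theorem ae_nonneg_gammaMeasure (a r : ℝ) : ∀ᵐ x ∂(gammaMeasure a r), 0 ≤ x := by
  rw [ae_iff, gammaMeasure]
  have : {x : ℝ | ¬ 0 ≤ x} = Set.Iio 0 := by ext; simp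
  rw [this, withDensity_apply _ measurableSet_Iio]
  exact lintegral_gammaPDF_of_nonpos le_rfl

theorem integrable_gammaPDFReal {a r : ℝ} (ha : 0 < a) (hr : 0 < r) :
    Integrable (gammaPDFReal a r) := by
  refine ⟨(measurable_gammaPDFReal a r).aestronglyMeasurable, ?_⟩
  rw [hasFiniteIntegral_iff_ofReal
    (Filter.Eventually.of_forall fun x => gammaPDFReal_nonneg ha hr x)]
  exact (lintegral_gammaPDF_eq_one ha hr).trans_lt ENNReal.one_lt_top

theorem gammaMeasure_real_Ioi {a r : ℝ} (ha : 0 < a) (hr : 0 < r) (x : ℝ) :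
    (gammaMeasure a r).real (Set.Ioi x) = ∫ t in Set.Ioi x, gammaPDFReal a r t := by
  rw [measureReal_def, gammaMeasure, withDensity_apply _ measurableSet_Ioi,
    integral_eq_lintegral_of_nonneg_ae
      (Filter.Eventually.of_forall fun t => gammaPDFReal_nonneg ha hr t)
      (measurable_gammaPDFReal a r).aestronglyMeasurable]
  rfl

/-! ### Alzer's inequality for the gamma tail. -/

theorem integral_exp_neg_mul_Icc {s : ℝ} (hs : 0 < s) :
    ∫ u in Set.Icc (0 : ℝ) 1, Real.exp (-(s * u)) = (1 - Real.exp (-s)) / s := by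
  rw [integral_Icc_eq_integral_Ioc, ← intervalIntegral.integral_of_le zero_le_one]
  have h : ∀ u ∈ Set.uIcc (0 : ℝ) 1,
      HasDerivAt (fun u => -(Real.exp (-(s * u)) / s)) (Real.exp (-(s * u))) u := by
    intro u _
    have h1 : HasDerivAt (fun u : ℝ => -(s * u)) (-(s * 1)) u :=
      ((hasDerivAt_id u).const_mul s).neg
    exact (h1.exp.div_const s).neg.congr_deriv (by field_simp)
  rw [intervalIntegral.integral_eq_sub_of_hasDerivAt h
    (Continuous.intervalIntegrable (by fun_prop) _ _)]
  simp; ring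

/-- The Laplace transform of a uniform variable is log-convex. -/
theorem one_sub_exp_div_le_rpow {s θ : ℝ} (hs : 0 < s) (hθ : 0 < θ) (hθ1 : θ ≤ 1) :
    (1 - Real.exp (-(θ * s))) / (θ * s) ≤ ((1 - Real.exp (-s)) / s) ^ θ := by
  rw [← integral_exp_neg_mul_Icc hs, ← integral_exp_neg_mul_Icc (mul_pos hθ hs)]
  have : IsProbabilityMeasure (volume.restrict (Set.Icc (0 : ℝ) 1)) := ⟨by simp⟩
  have hint : ∀ c : ℝ, Integrable (fun u : ℝ => Real.exp (-(c * u)))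
      (volume.restrict (Set.Icc (0 : ℝ) 1)) := fun c =>
    (Continuous.continuousOn (by fun_prop)).integrableOn_compact isCompact_Icc
  have hpow : (fun u : ℝ => Real.exp (-(s * u)) ^ θ) = fun u => Real.exp (-(θ * s * u)) := by
    ext u; rw [← Real.exp_mul]; congr 1; ring
  -- Jensen's inequality for the concave power `x ^ θ` and the variable `e^(-s U)`, with `U` uniform
  -- on the unit interval.
  have := (Real.concaveOn_rpow hθ.le hθ1).le_map_integral
    (Real.continuous_rpow_const hθ.le).continuousOn isClosed_Ici
    (Filter.Eventually.of_forall fun u => (Real.exp_pos (-(s * u))).le) (hint s)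
    (by
      change Integrable (fun u : ℝ => Real.exp (-(s * u)) ^ θ) _
      rw [hpow]; exact hint _)
  simpa only [hpow] using this

/-- The rate of the exponential variables in the approximation of a gamma variable with shape and
rate `N` by a maximum of `N` independent exponential variables. -/
def tailRate (N : ℕ) : ℝ := (N : ℝ) * (N.factorial : ℝ) ^ (-(1 : ℝ) / (N : ℝ))

theorem tailRate_pos {N : ℕ} (hN : 1 ≤ N) : 0 < tailRate N := by
  unfold tailRate; positivity

theorem tailRate_pow {N : ℕ} (hN : 1 ≤ N) : tailRate N ^ N = (N : ℝ) ^ N / N.factorial := by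
  have : (N : ℝ) ≠ 0 := by positivity
  rw [tailRate, mul_pow, ← Real.rpow_natCast ((N.factorial : ℝ) ^ (-(1 : ℝ) / (N : ℝ))),
    ← Real.rpow_mul (by positivity), div_mul_cancel₀ _ this, Real.rpow_neg_one, div_eq_mul_inv]

/-- The normalizing constant `N^N / (N-1)!` equals `N η^N` because `η^N = N^N / N!`. This is also
the leading coefficient of `maxExpDensity` at zero, so it cancels in the comparison of the
densities. -/
theorem gammaPDFReal_nat {N : ℕ} (hN : 1 ≤ N) {t : ℝ} (ht : 0 < t) :
    gammaPDFReal N N t = N * tailRate N ^ N * t ^ (N - 1) * Real.exp (-(N * t)) := by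
  obtain ⟨n, rfl⟩ := Nat.exists_eq_add_of_le' hN
  rw [gammaPDFReal, if_pos ht.le, tailRate_pow hN, Real.rpow_natCast]
  have h1 : Real.Gamma ((n + 1 : ℕ) : ℝ) = n.factorial := by
    push_cast; exact Real.Gamma_nat_eq_factorial n
  have h2 : t ^ (((n + 1 : ℕ) : ℝ) - 1) = t ^ n := by
    rw [← Real.rpow_natCast]; congr 1; push_cast; ring
  rw [h1, h2, Nat.add_sub_cancel, Nat.factorial_succ]
  push_cast
  field_simp

/-- Density of the maximum of `N` exponential variables of rate `tailRate N`. -/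
def maxExpDensity (N : ℕ) (t : ℝ) : ℝ :=
  N * tailRate N * Real.exp (-(tailRate N * t)) * (1 - Real.exp (-(tailRate N * t))) ^ (N - 1)

theorem gammaPDFReal_sub_maxExpDensity {N : ℕ} (hN : 1 ≤ N) {t : ℝ} (ht : 0 < t) :
    gammaPDFReal N N t - maxExpDensity N t =
      N * tailRate N ^ N * t ^ (N - 1) * Real.exp (-(tailRate N * t)) *
        (Real.exp (-((N - tailRate N) * t)) -
          ((1 - Real.exp (-(tailRate N * t))) / (tailRate N * t)) ^ (N - 1)) := by
  have hη := tailRate_pos hN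
  have h2 : Real.exp (-(N * t)) =
      Real.exp (-(tailRate N * t)) * Real.exp (-((N - tailRate N) * t)) := by
    rw [← Real.exp_add]; congr 1; ring
  rw [gammaPDFReal_nat hN ht, maxExpDensity, h2, div_pow, mul_pow]
  obtain ⟨n, rfl⟩ := Nat.exists_eq_add_of_le' hN
  simp only [Nat.add_sub_cancel, pow_succ (tailRate (n + 1)) n]
  field_simp

theorem maxExpDensity_le_gammaPDFReal_iff {N : ℕ} (hN : 1 ≤ N) {t : ℝ} (ht : 0 < t) :
    maxExpDensity N t ≤ gammaPDFReal N N t ↔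
      ((1 - Real.exp (-(tailRate N * t))) / (tailRate N * t)) ^ (N - 1) ≤
        Real.exp (-((N - tailRate N) * t)) := by
  have hη := tailRate_pos hN
  rw [← sub_nonneg, gammaPDFReal_sub_maxExpDensity hN ht,
    mul_nonneg_iff_of_pos_left (by positivity), sub_nonneg]

/-- Single crossing: the set of positive points where the gamma density dominates is an initial
interval. In the criterion of `maxExpDensity_le_gammaPDFReal_iff`, the left side at `a` is at most
its value at `b` to the power `a / b`, by log-convexity, while the right side is an exponential of a
linear function and obeys the same relation with equality. -/
theorem maxExpDensity_le_gammaPDFReal_of_le {N : ℕ} (hN : 1 ≤ N) {a b : ℝ} (ha : 0 < a)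
    (hab : a ≤ b) (hb : maxExpDensity N b ≤ gammaPDFReal N N b) :
    maxExpDensity N a ≤ gammaPDFReal N N a := by
  have hη := tailRate_pos hN
  have hb0 : 0 < b := ha.trans_le hab
  rw [maxExpDensity_le_gammaPDFReal_iff hN ha]
  rw [maxExpDensity_le_gammaPDFReal_iff hN hb0] at hb
  have hpos : ∀ {t : ℝ}, 0 < t → 0 ≤ (1 - Real.exp (-(tailRate N * t))) / (tailRate N * t) := by
    intro t ht
    have : Real.exp (-(tailRate N * t)) ≤ 1 := Real.exp_le_one_iff.2 (by
      have := mul_pos hη ht; linarith)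
    exact div_nonneg (by linarith) (by positivity)
  have hab' : tailRate N * a = a / b * (tailRate N * b) := by field_simp
  have h1 := one_sub_exp_div_le_rpow (mul_pos hη hb0) (div_pos ha hb0) ((div_le_one hb0).2 hab)
  rw [← hab'] at h1
  calc ((1 - Real.exp (-(tailRate N * a))) / (tailRate N * a)) ^ (N - 1)
      ≤ (((1 - Real.exp (-(tailRate N * b))) / (tailRate N * b)) ^ (a / b)) ^ (N - 1) :=
        pow_le_pow_left₀ (hpos ha) h1 _
    _ = (((1 - Real.exp (-(tailRate N * b))) / (tailRate N * b)) ^ (N - 1)) ^ (a / b) := by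
        rw [← Real.rpow_natCast, ← Real.rpow_natCast, ← Real.rpow_mul (hpos hb0),
          ← Real.rpow_mul (hpos hb0), mul_comm (a / b)]
    _ ≤ Real.exp (-((N - tailRate N) * b)) ^ (a / b) :=
        Real.rpow_le_rpow (pow_nonneg (hpos hb0) _) hb (by positivity)
    _ = Real.exp (-((N - tailRate N) * a)) := by
        rw [← Real.exp_mul]; congr 1; field_simp

theorem maxExpDensity_nonneg (N : ℕ) {t : ℝ} (ht : 0 ≤ t) : 0 ≤ maxExpDensity N t := by
  have hη : 0 ≤ tailRate N := by unfold tailRate; positivity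
  have : Real.exp (-(tailRate N * t)) ≤ 1 := Real.exp_le_one_iff.2 (by
    have := mul_nonneg hη ht; linarith)
  have h2 : 0 ≤ 1 - Real.exp (-(tailRate N * t)) := by linarith
  unfold maxExpDensity; positivity

/-- `(1 - e^(-η t))^N` is an antiderivative tending to one. Nonnegativity of the derivative gives
integrability along with the value. -/
theorem maxExpDensity_integral_Ioi {N : ℕ} (hN : 1 ≤ N) {x : ℝ} (hx : 0 ≤ x) :
    IntegrableOn (maxExpDensity N) (Set.Ioi x) ∧
      ∫ t in Set.Ioi x, maxExpDensity N t = 1 - (1 - Real.exp (-(tailRate N * x))) ^ N := by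
  have hη := tailRate_pos hN
  have hd : ∀ t : ℝ, HasDerivAt (fun t => (1 - Real.exp (-(tailRate N * t))) ^ N)
      (maxExpDensity N t) t := by
    intro t
    have h1 : HasDerivAt (fun t : ℝ => -(tailRate N * t)) (-(tailRate N * 1)) t :=
      ((hasDerivAt_id t).const_mul _).neg
    exact ((h1.exp.const_sub 1).pow N).congr_deriv (by unfold maxExpDensity; ring)
  have hlim : Filter.Tendsto (fun t : ℝ => (1 - Real.exp (-(tailRate N * t))) ^ N) Filter.atTop
      (nhds 1) := by
    have h1 : Filter.Tendsto (fun t : ℝ => Real.exp (-(tailRate N * t))) Filter.atTop (nhds 0) :=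
      Real.tendsto_exp_neg_atTop_nhds_zero.comp (Filter.tendsto_id.const_mul_atTop hη)
    simpa using (h1.const_sub 1).pow N
  have hn : ∀ t ∈ Set.Ioi x, 0 ≤ maxExpDensity N t := fun t ht =>
    maxExpDensity_nonneg N (hx.trans (le_of_lt ht))
  exact ⟨integrableOn_Ioi_deriv_of_nonneg' (fun t _ => hd t) hn hlim,
    integral_Ioi_of_hasDerivAt_of_nonneg' (fun t _ => hd t) hn hlim⟩

/-- Alzer's inequality. -/
theorem gammaMeasure_real_Ioi_le {N : ℕ} (hN : 1 ≤ N) {x : ℝ} (hx : 0 ≤ x) :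
    (gammaMeasure N N).real (Set.Ioi x) ≤ 1 - (1 - Real.exp (-(tailRate N * x))) ^ N := by
  have hN0 : (0 : ℝ) < N := by positivity
  have hp := integrable_gammaPDFReal hN0 hN0
  have hq := maxExpDensity_integral_Ioi hN hx
  have hq0 := maxExpDensity_integral_Ioi hN le_rfl
  rw [gammaMeasure_real_Ioi hN0 hN0, ← hq.2]
  -- If the gamma density dominates somewhere beyond `x`, it dominates on all of `(0, x]`, and
  -- equality of the total masses reverses the inequality for the tails. Otherwise it is the smaller
  -- density on the whole tail.
  by_cases h : ∃ t, x < t ∧ maxExpDensity N t ≤ gammaPDFReal N N t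
  · obtain ⟨t, hxt, ht⟩ := h
    have hsplit : Set.Ioi (0 : ℝ) = Set.Ioc 0 x ∪ Set.Ioi x := (Set.Ioc_union_Ioi_eq_Ioi hx).symm
    have hdis : Disjoint (Set.Ioc 0 x) (Set.Ioi x) := Set.Ioc_disjoint_Ioi le_rfl
    have hqc : IntegrableOn (maxExpDensity N) (Set.Ioc 0 x) :=
      hq0.1.mono_set Set.Ioc_subset_Ioi_self
    have e1 := setIntegral_union hdis measurableSet_Ioi hp.integrableOn
      (hp.integrableOn (s := Set.Ioi x))
    have e2 := setIntegral_union hdis measurableSet_Ioi hqc hq.1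
    rw [← hsplit] at e1 e2
    have e3 : ∫ t in Set.Ioi 0, gammaPDFReal N N t = 1 := by
      rw [← gammaMeasure_real_Ioi hN0 hN0]
      have := isProbabilityMeasure_gammaMeasure hN0 hN0
      have h0 : (gammaMeasure N N) (Set.Ioi (0 : ℝ)) = 1 := by
        rw [prob_compl_eq_zero_iff measurableSet_Ioi |>.symm, Set.compl_Ioi, gammaMeasure,
          withDensity_apply _ measurableSet_Iic, setLIntegral_congr Iio_ae_eq_Iic.symm]
        exact lintegral_gammaPDF_of_nonpos le_rfl
      simp [measureReal_def, h0]
    have e4 : ∫ t in Set.Ioi 0, maxExpDensity N t = 1 := by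
      rw [hq0.2]; simp; omega
    have e5 : ∫ t in Set.Ioc 0 x, maxExpDensity N t ≤ ∫ t in Set.Ioc 0 x, gammaPDFReal N N t :=
      setIntegral_mono_on hqc hp.integrableOn measurableSet_Ioc fun a ha =>
        maxExpDensity_le_gammaPDFReal_of_le hN ha.1 (ha.2.trans hxt.le) ht
    linarith
  · push Not at h
    exact setIntegral_mono_on hp.integrableOn hq.1 measurableSet_Ioi fun t ht => (h t ht).le

theorem gammaMeasure_one_real_Ioi {x : ℝ} (hx : 0 ≤ x) :
    (gammaMeasure 1 1).real (Set.Ioi x) = Real.exp (-x) := by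
  have hη : tailRate 1 = 1 := by simp [tailRate]
  rw [gammaMeasure_real_Ioi one_pos one_pos]
  have h := (maxExpDensity_integral_Ioi (N := 1) le_rfl hx).2
  rw [hη] at h
  simp only [one_mul, pow_one, sub_sub_cancel] at h
  rw [← h]
  refine setIntegral_congr_fun measurableSet_Ioi fun t ht => ?_
  have := gammaPDFReal_nat (N := 1) le_rfl (hx.trans_lt ht)
  simpa [maxExpDensity, hη] using this

/-! ### Polar coordinates in the plane -/

/-- Identify the plane with `ℂ` and rotate by the argument of `v`; polar coordinates then have their
axis through `v`. -/
theorem exists_isometry_complex (v : Plane) :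
    ∃ e : ℂ ≃ₗᵢ[ℝ] Plane, e (‖v‖ : ℂ) = v := by
  set w := Complex.orthonormalBasisOneI.repr.symm v with hw
  refine ⟨(rotation (Circle.exp w.arg)).trans Complex.orthonormalBasisOneI.repr, ?_⟩
  have h1 : ‖v‖ = ‖w‖ := by rw [hw, LinearIsometryEquiv.norm_map]
  rw [LinearIsometryEquiv.trans_apply, rotation_apply, Circle.coe_exp, h1, mul_comm,
    Complex.norm_mul_exp_arg_mul_I, hw, LinearIsometryEquiv.apply_symm_apply]

/-- An integral over the plane of a function of the distances to the origin and to a point `v`, in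
polar coordinates with the axis through `v`. -/
theorem lintegral_norm_mul_norm_sub {h ρ : ℝ → ℝ≥0∞} (hh : Measurable h) (hρ : Measurable ρ)
    (v : Plane) :
    ∫⁻ x : Plane, h ‖x‖ * ρ ‖x - v‖ = ∫⁻ g in Set.Ioi (0 : ℝ), ENNReal.ofReal g * h g *
      ∫⁻ θ in Set.Ioo (-Real.pi) Real.pi,
        ρ (Real.sqrt (g ^ 2 + ‖v‖ ^ 2 - 2 * g * ‖v‖ * Real.cos θ)) := by
  obtain ⟨e, he⟩ := exists_isometry_complex v
  have h1 : ∫⁻ x : Plane, h ‖x‖ * ρ ‖x - v‖ = ∫⁻ z : ℂ, h ‖z‖ * ρ ‖z - (‖v‖ : ℂ)‖ := by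
    rw [← e.measurePreserving.lintegral_comp (by fun_prop)]
    refine lintegral_congr fun z => ?_
    rw [LinearIsometryEquiv.norm_map]
    conv_lhs => rw [← he, ← map_sub, LinearIsometryEquiv.norm_map]
  rw [h1, ← Complex.lintegral_comp_polarCoord_symm]
  change ∫⁻ p in Set.Ioi (0 : ℝ) ×ˢ Set.Ioo (-Real.pi) Real.pi, _ = _
  have h2 : ∀ p ∈ Set.Ioi (0 : ℝ) ×ˢ Set.Ioo (-Real.pi) Real.pi,
      ENNReal.ofReal p.1 • (h ‖Complex.polarCoord.symm p‖ *
        ρ ‖Complex.polarCoord.symm p - (‖v‖ : ℂ)‖) = (ENNReal.ofReal p.1 * h p.1) *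
        ρ (Real.sqrt (p.1 ^ 2 + ‖v‖ ^ 2 - 2 * p.1 * ‖v‖ * Real.cos p.2)) := by
    rintro ⟨g, θ⟩ ⟨hg, _⟩
    -- The law of cosines.
    have hn : ‖Complex.polarCoord.symm (g, θ) - (‖v‖ : ℂ)‖ =
        Real.sqrt (g ^ 2 + ‖v‖ ^ 2 - 2 * g * ‖v‖ * Real.cos θ) := by
      rw [Complex.norm_def, Complex.normSq_apply]
      congr 1
      simp only [Complex.polarCoord_symm_apply, Complex.sub_re, Complex.sub_im, Complex.mul_re,
        Complex.mul_im, Complex.add_re, Complex.add_im, Complex.ofReal_re, Complex.ofReal_im,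
        Complex.I_re, Complex.I_im]
      have := Real.sin_sq_add_cos_sq θ
      linear_combination g ^ 2 * this
    rw [hn, Complex.norm_polarCoord_symm, abs_of_pos hg, smul_eq_mul]
    exact (mul_assoc _ _ _).symm
  rw [setLIntegral_congr_fun (measurableSet_Ioi.prod measurableSet_Ioo) h2,
    Measure.volume_eq_prod, ← Measure.prod_restrict]
  refine (lintegral_prod _ ?_).trans ?_
  · exact Measurable.aemeasurable (by fun_prop)
  refine lintegral_congr fun g => ?_
  rw [← lintegral_const_mul _ (by fun_prop)]

theorem lintegral_norm {h : ℝ → ℝ≥0∞} (hh : Measurable h) :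
    ∫⁻ x : Plane, h ‖x‖ =
      ∫⁻ g in Set.Ioi (0 : ℝ), ENNReal.ofReal (2 * Real.pi * g) * h g := by
  have := lintegral_norm_mul_norm_sub hh (ρ := fun _ => 1) measurable_const 0
  simp only [mul_one] at this
  rw [this]
  refine setLIntegral_congr_fun measurableSet_Ioi fun g hg => ?_
  have h2 : Real.pi - -Real.pi = 2 * Real.pi := by ring
  simp only [lintegral_const, one_mul, Measure.restrict_apply_univ, Real.volume_Ioo, h2]
  rw [ENNReal.ofReal_mul (by positivity : 0 ≤ 2 * Real.pi)]
  ring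

/-! ### Distances of users -/

/-- The density of the position of a user, as a function of the distance to the cluster centre. -/
def ClusterShape.radial : ClusterShape → ℝ → ℝ
  | .thomas σ _, r => 1 / (2 * Real.pi * σ ^ 2) * Real.exp (-(r ^ 2 / (2 * σ ^ 2)))
  | .matern R _, r => 1 / (Real.pi * R ^ 2) * unitStep (R - r)

theorem unitStep_nonneg (x : ℝ) : 0 ≤ unitStep x := by
  unfold unitStep; split_ifs <;> norm_num

@[fun_prop]
theorem measurable_unitStep : Measurable unitStep :=
  Measurable.ite measurableSet_Ici measurable_const measurable_const

theorem ClusterShape.density_eq (c : ClusterShape) (u : Plane) : c.density u = c.radial ‖u‖ := by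
  cases c <;> rfl

theorem ClusterShape.radial_nonneg (c : ClusterShape) (r : ℝ) : 0 ≤ c.radial r := by
  cases c with
  | thomas σ hσ => unfold radial; positivity
  | matern R hR => exact mul_nonneg (by positivity) (unitStep_nonneg _)

@[fun_prop]
theorem ClusterShape.measurable_radial (c : ClusterShape) : Measurable c.radial := by
  cases c with
  | thomas σ hσ => unfold radial; fun_prop
  | matern R hR => unfold radial; fun_prop

instance (c : ClusterShape) : IsProbabilityMeasure c.law := by
  constructor
  rw [ClusterShape.law, withDensity_apply _ MeasurableSet.univ, setLIntegral_univ]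
  cases c with
  | thomas σ hσ =>
    have hb : 0 < 1 / (2 * σ ^ 2) := by positivity
    have h1 := GaussianFourier.integral_rexp_neg_mul_sq_norm (V := Plane) hb
    -- The Bochner integral of a non-integrable function is zero, so the positive value in `h1`
    -- forces integrability.
    have h2 : Integrable fun v : Plane => Real.exp (-(1 / (2 * σ ^ 2)) * ‖v‖ ^ 2) := by
      by_contra h
      rw [integral_undef h] at h1
      exact (by positivity : (0 : ℝ) < (Real.pi / (1 / (2 * σ ^ 2))) ^
        (Module.finrank ℝ Plane / 2 : ℝ)).ne h1
    have h3 : ∀ u : Plane, (ClusterShape.thomas σ hσ).density u =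
        1 / (2 * Real.pi * σ ^ 2) * Real.exp (-(1 / (2 * σ ^ 2)) * ‖u‖ ^ 2) := by
      intro u; simp only [ClusterShape.density]; congr 2; ring
    simp_rw [h3]
    rw [← ofReal_integral_eq_lintegral_ofReal (h2.const_mul _)
      (Filter.Eventually.of_forall fun u => by positivity), integral_const_mul, h1]
    simp
    field_simp
  | matern R hR =>
    have h3 : ∀ u : Plane, ENNReal.ofReal ((ClusterShape.matern R hR).density u) =
        (Metric.closedBall (0 : Plane) R).indicator
          (fun _ => ENNReal.ofReal (1 / (Real.pi * R ^ 2))) u := by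
      intro u
      by_cases hu : ‖u‖ ≤ R
      · simp [ClusterShape.density, unitStep, hu]
      · simp [ClusterShape.density, unitStep, hu]
    simp_rw [h3]
    rw [lintegral_indicator measurableSet_closedBall, setLIntegral_const,
      EuclideanSpace.volume_closedBall_fin_two, ← ENNReal.ofReal_pow hR.le,
      ← ENNReal.ofReal_mul (by positivity), ← ENNReal.ofReal_mul (by positivity)]
    rw [← ENNReal.ofReal_one]; congr 1; field_simp

/-- After the translation `x = v + u` the integrand depends only on the distances of `x` to the
origin and to `v`. The angular integral is the density of the distance to the origin, still to be
evaluated for each cluster shape. -/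
theorem ClusterShape.lintegral_law_norm_add (c : ClusterShape) {h : ℝ → ℝ≥0∞} (hh : Measurable h)
    (v : Plane) : ∫⁻ u, h ‖v + u‖ ∂c.law = ∫⁻ g in Set.Ioi (0 : ℝ), h g * (ENNReal.ofReal g *
      ∫⁻ θ in Set.Ioo (-Real.pi) Real.pi, ENNReal.ofReal
        (c.radial (Real.sqrt (g ^ 2 + ‖v‖ ^ 2 - 2 * g * ‖v‖ * Real.cos θ)))) := by
  have hm : Measurable fun u : Plane => ENNReal.ofReal (c.radial ‖u‖) := by fun_prop
  simp_rw [ClusterShape.law, ClusterShape.density_eq]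
  rw [lintegral_withDensity_eq_lintegral_mul _ hm (by fun_prop)]
  have h1 : ∀ u : Plane, ((fun u : Plane => ENNReal.ofReal (c.radial ‖u‖)) *
      fun u => h ‖v + u‖) u =
      (fun x : Plane => h ‖x‖ * ENNReal.ofReal (c.radial ‖x - v‖)) (v + u) := by
    intro u; simp [mul_comm]
  simp_rw [h1]
  rw [lintegral_add_left_eq_self (fun x : Plane => h ‖x‖ * ENNReal.ofReal (c.radial ‖x - v‖)),
    lintegral_norm_mul_norm_sub hh (ρ := fun r => ENNReal.ofReal (c.radial r)) (by fun_prop)]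
  refine lintegral_congr fun g => ?_
  ring

theorem ClusterShape.radial_pdfIntra (c : ClusterShape) {g : ℝ} (hg : 0 < g) :
    2 * Real.pi * g * c.radial g = c.pdfIntra g := by
  cases c with
  | thomas σ hσ => simp only [radial, pdfIntra]; field_simp
  | matern R hR => simp only [radial, pdfIntra]; field_simp

theorem ClusterShape.lintegral_law_norm (c : ClusterShape) {h : ℝ → ℝ≥0∞} (hh : Measurable h) :
    ∫⁻ u, h ‖u‖ ∂c.law =
      ∫⁻ g in Set.Ioi (0 : ℝ), h g * ENNReal.ofReal (c.pdfIntra g) := by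
  have := c.lintegral_law_norm_add hh 0
  simp only [zero_add] at this
  rw [this]
  refine setLIntegral_congr_fun measurableSet_Ioi fun g (hg : 0 < g) => ?_
  have h1 : ∀ θ : ℝ, Real.sqrt (g ^ 2 + ‖(0 : Plane)‖ ^ 2 - 2 * g * ‖(0 : Plane)‖ * Real.cos θ) =
      g := by intro θ; simp [Real.sqrt_sq hg.le]
  have h2 : Real.pi - -Real.pi = 2 * Real.pi := by ring
  simp only [h1, lintegral_const, Measure.restrict_apply_univ, Real.volume_Ioo, h2]
  rw [← ENNReal.ofReal_mul (c.radial_nonneg g), ← ENNReal.ofReal_mul hg.le,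
    ← c.radial_pdfIntra hg]
  congr 2; ring

theorem continuous_besselI0 : Continuous besselI0 := by
  unfold besselI0
  refine continuous_const.mul ?_
  exact intervalIntegral.continuous_parametric_intervalIntegral_of_continuous' (by fun_prop) _ _

theorem besselI0_nonneg (x : ℝ) : 0 ≤ besselI0 x :=
  mul_nonneg (by positivity)
    (intervalIntegral.integral_nonneg Real.pi_pos.le fun θ _ => (Real.exp_pos _).le)

theorem lintegral_exp_cos (x : ℝ) :
    ∫⁻ θ in Set.Ioo (-Real.pi) Real.pi, ENNReal.ofReal (Real.exp (x * Real.cos θ)) =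
      ENNReal.ofReal (2 * Real.pi * besselI0 x) := by
  have hc : Continuous fun θ : ℝ => Real.exp (x * Real.cos θ) := by fun_prop
  have hpi := Real.pi_pos
  rw [← ofReal_integral_eq_lintegral_ofReal
    ((hc.continuousOn.integrableOn_compact isCompact_Icc).mono_set Set.Ioo_subset_Icc_self)
    (Filter.Eventually.of_forall fun θ => (Real.exp_pos _).le)]
  congr 1
  rw [← integral_Ioc_eq_integral_Ioo, ← intervalIntegral.integral_of_le (by linarith),
    ← intervalIntegral.integral_add_adjacent_intervals (b := 0) (hc.intervalIntegrable _ _)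
      (hc.intervalIntegrable _ _)]
  have h1 : ∫ θ in (-Real.pi)..0, Real.exp (x * Real.cos θ) =
      ∫ θ in (0 : ℝ)..Real.pi, Real.exp (x * Real.cos θ) := by
    have := intervalIntegral.integral_comp_neg (a := 0) (b := Real.pi)
      fun θ => Real.exp (x * Real.cos θ)
    simp only [Real.cos_neg, neg_zero] at this
    exact this.symm
  rw [h1, besselI0]
  field_simp
  ring

/-- The set lies between the open and the closed symmetric interval of half-length `arccos x`. This
covers `x ≤ -1` as well, where `Real.arccos` takes the value `π`. -/
theorem volume_cos_ge {x : ℝ} (hx : x ≤ 1) :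
    volume ({θ : ℝ | x ≤ Real.cos θ} ∩ Set.Ioo (-Real.pi) Real.pi) =
      ENNReal.ofReal (2 * Real.arccos x) := by
  have hpi := Real.pi_pos
  have h0 := Real.arccos_nonneg x
  have h1 := Real.arccos_le_pi x
  have key : ∀ θ : ℝ, |θ| ≤ Real.pi → (x ≤ Real.cos θ ↔ |θ| ≤ Real.arccos x) := by
    intro θ hθ
    rw [← Real.cos_abs]
    constructor
    · intro h
      rw [← Real.arccos_cos (abs_nonneg θ) hθ]
      exact Real.antitone_arccos h
    · intro h
      rcases le_total (-1) x with hx' | hx'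
      · rw [← Real.cos_arccos hx' hx]
        exact Real.cos_le_cos_of_nonneg_of_le_pi (abs_nonneg θ) h1 h
      · exact hx'.trans (Real.neg_one_le_cos _)
  have hle : volume ({θ : ℝ | x ≤ Real.cos θ} ∩ Set.Ioo (-Real.pi) Real.pi) ≤
      volume (Set.Icc (-Real.arccos x) (Real.arccos x)) := by
    refine measure_mono ?_
    rintro θ ⟨hθ, hθ'⟩
    exact abs_le.1 ((key θ (abs_le.2 ⟨hθ'.1.le, hθ'.2.le⟩)).1 hθ)
  have hge : volume (Set.Ioo (-Real.arccos x) (Real.arccos x)) ≤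
      volume ({θ : ℝ | x ≤ Real.cos θ} ∩ Set.Ioo (-Real.pi) Real.pi) := by
    refine measure_mono ?_
    rintro θ ⟨hθ, hθ'⟩
    have hm : θ ∈ Set.Ioo (-Real.pi) Real.pi := ⟨by linarith, by linarith⟩
    exact ⟨(key θ (abs_le.2 ⟨hm.1.le, hm.2.le⟩)).2 (abs_le.2 ⟨hθ.le, hθ'.le⟩), hm⟩
  have h2 : Real.arccos x - -Real.arccos x = 2 * Real.arccos x := by ring
  rw [Real.volume_Icc, h2] at hle
  rw [Real.volume_Ioo, h2] at hge
  exact le_antisymm hle hge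

theorem ClusterShape.pdfInter_nonneg (c : ClusterShape) {g : ℝ} (hg : 0 ≤ g) (q : ℝ) :
    0 ≤ c.pdfInter g q := by
  cases c with
  | thomas σ hσ =>
    exact mul_nonneg (by positivity) (besselI0_nonneg _)
  | matern R hR =>
    have := Real.arccos_nonneg ((g ^ 2 + q ^ 2 - R ^ 2) / (2 * g * q))
    have h1 := unitStep_nonneg (g - |R - q|)
    have h2 := unitStep_nonneg (R + q - g)
    have h3 := unitStep_nonneg (R - q - g)
    unfold pdfInter; positivity

theorem ClusterShape.measurable_pdfInter (c : ClusterShape) (q : ℝ) :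
    Measurable fun g => c.pdfInter g q := by
  cases c with
  | thomas σ hσ =>
    have := continuous_besselI0.measurable
    unfold pdfInter; fun_prop
  | matern R hR =>
    unfold pdfInter
    have := Real.continuous_arccos.measurable
    fun_prop

/-- In the Gaussian exponent only the mixed term `g q cos θ / σ²` depends on the angle; its
exponential integrates to the Bessel function, and the result is the Rice density. -/
theorem ClusterShape.radial_pdfInter_thomas {σ : ℝ} (hσ : 0 < σ) {g q : ℝ} (hg : 0 < g) :
    ENNReal.ofReal g * ∫⁻ θ in Set.Ioo (-Real.pi) Real.pi, ENNReal.ofReal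
        ((ClusterShape.thomas σ hσ).radial
          (Real.sqrt (g ^ 2 + q ^ 2 - 2 * g * q * Real.cos θ))) =
      ENNReal.ofReal ((ClusterShape.thomas σ hσ).pdfInter g q) := by
  have h1 : ∀ θ : ℝ, (ClusterShape.thomas σ hσ).radial
      (Real.sqrt (g ^ 2 + q ^ 2 - 2 * g * q * Real.cos θ)) =
      1 / (2 * Real.pi * σ ^ 2) * Real.exp (-((g ^ 2 + q ^ 2) / (2 * σ ^ 2))) *
        Real.exp (g * q / σ ^ 2 * Real.cos θ) := by
    intro θ
    have h0 : 0 ≤ g ^ 2 + q ^ 2 - 2 * g * q * Real.cos θ := by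
      have h2 : g ^ 2 + q ^ 2 - 2 * g * q * Real.cos θ =
          (g - q * Real.cos θ) ^ 2 + (q * Real.sin θ) ^ 2 := by
        have := Real.sin_sq_add_cos_sq θ
        linear_combination -q ^ 2 * this
      rw [h2]; positivity
    simp only [radial]
    rw [Real.sq_sqrt h0, mul_assoc (1 / (2 * Real.pi * σ ^ 2)), ← Real.exp_add]
    congr 2; field_simp; ring
  simp_rw [h1]
  have h3 : ∀ θ : ℝ, ENNReal.ofReal (1 / (2 * Real.pi * σ ^ 2) *
      Real.exp (-((g ^ 2 + q ^ 2) / (2 * σ ^ 2))) * Real.exp (g * q / σ ^ 2 * Real.cos θ)) =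
      ENNReal.ofReal (1 / (2 * Real.pi * σ ^ 2) *
      Real.exp (-((g ^ 2 + q ^ 2) / (2 * σ ^ 2)))) *
        ENNReal.ofReal (Real.exp (g * q / σ ^ 2 * Real.cos θ)) := fun θ =>
    ENNReal.ofReal_mul (by positivity)
  simp_rw [h3]
  rw [lintegral_const_mul _ (by fun_prop), lintegral_exp_cos, ← ENNReal.ofReal_mul (by positivity),
    ← ENNReal.ofReal_mul hg.le]
  congr 1
  simp only [pdfInter]
  field_simp

/-- The angular integral measures the arc of the circle of radius `g` about the origin that lies in
the cluster disc. The point `g = |R - q|` is left out because for `g = R - q` both terms of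
`pdfInter` are switched on and the full circle would be counted twice. -/
theorem ClusterShape.radial_pdfInter_matern {R : ℝ} (hR : 0 < R) {g q : ℝ} (hg : 0 < g)
    (hq : 0 < q) (hgR : g ≠ |R - q|) :
    ENNReal.ofReal g * ∫⁻ θ in Set.Ioo (-Real.pi) Real.pi, ENNReal.ofReal
        ((ClusterShape.matern R hR).radial
          (Real.sqrt (g ^ 2 + q ^ 2 - 2 * g * q * Real.cos θ))) =
      ENNReal.ofReal ((ClusterShape.matern R hR).pdfInter g q) := by
  set x := (g ^ 2 + q ^ 2 - R ^ 2) / (2 * g * q) with hx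
  have hgq : 0 < 2 * g * q := by positivity
  have hs : ∀ θ : ℝ, Real.sqrt (g ^ 2 + q ^ 2 - 2 * g * q * Real.cos θ) ≤ R ↔
      x ≤ Real.cos θ := by
    intro θ
    rw [Real.sqrt_le_left hR.le, hx, div_le_iff₀ hgq]
    constructor <;> intro h <;> linarith
  have h1 : ∀ θ : ℝ, ENNReal.ofReal ((ClusterShape.matern R hR).radial
      (Real.sqrt (g ^ 2 + q ^ 2 - 2 * g * q * Real.cos θ))) =
      {θ : ℝ | x ≤ Real.cos θ}.indicator (fun _ => ENNReal.ofReal (1 / (Real.pi * R ^ 2))) θ := by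
    intro θ
    by_cases hθ : x ≤ Real.cos θ
    · have := (hs θ).2 hθ
      simp [radial, unitStep, hθ, this]
    · have := mt (hs θ).1 hθ
      simp only [radial, unitStep, sub_nonneg, this, if_false, mul_zero, ENNReal.ofReal_zero]
      simp [hθ]
  have hms : MeasurableSet {θ : ℝ | x ≤ Real.cos θ} :=
    measurableSet_le measurable_const Real.measurable_cos
  have hvol : volume ({θ : ℝ | x ≤ Real.cos θ} ∩ Set.Ioo (-Real.pi) Real.pi) =
      ENNReal.ofReal (2 * Real.arccos x) := by
    rcases le_or_gt x 1 with h | h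
    · exact volume_cos_ge h
    · have : {θ : ℝ | x ≤ Real.cos θ} = ∅ := by
        ext θ; simp only [Set.mem_ofPred_eq, Set.mem_empty_iff_false, iff_false, not_le]
        exact (Real.cos_le_one θ).trans_lt h
      rw [this, Real.arccos_of_one_le h.le]; simp
  simp_rw [h1]
  rw [lintegral_indicator hms, setLIntegral_const, Measure.restrict_apply hms, hvol,
    ← ENNReal.ofReal_mul (by positivity), ← ENNReal.ofReal_mul hg.le]
  congr 1
  have hval : (ClusterShape.matern R hR).pdfInter g q =
      2 * g / (Real.pi * R ^ 2) * Real.arccos x := by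
    simp only [pdfInter, unitStep, sub_nonneg]
    -- Here the circle meets the disc at most in a tangency; in `harc2` it lies inside the disc. In
    -- both cases `Real.arccos` is constant beyond `[-1, 1]`, so one expression in `x` covers every
    -- position.
    have harc1 : (g - q) ^ 2 ≥ R ^ 2 → Real.arccos x = 0 := by
      intro h
      exact Real.arccos_of_one_le (by rw [hx, le_div_iff₀ hgq]; nlinarith)
    have harc2 : (g + q) ^ 2 ≤ R ^ 2 → Real.arccos x = Real.pi := by
      intro h
      exact Real.arccos_of_le_neg_one (by rw [hx, div_le_iff₀ hgq]; nlinarith)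
    rcases lt_or_gt_of_ne hgR with h | h
    · rw [if_neg (not_le.2 h)]
      rcases le_total R q with hRq | hRq
      · rw [abs_of_nonpos (by linarith)] at h
        rw [if_neg (not_le.2 (by linarith : R - q < g)), harc1 (by nlinarith)]
        simp
      · rw [abs_of_nonneg (by linarith)] at h
        rw [if_pos h.le, harc2 (by nlinarith)]
        field_simp; ring
    · have h5 : R - q < g := (le_abs_self _).trans_lt h
      rw [if_pos h.le, if_neg (not_le.2 h5)]
      by_cases h6 : g ≤ R + q
      · rw [if_pos h6]; simp [hx]
      · rw [if_neg h6, harc1 (by nlinarith)]; simp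
  rw [hval]; ring

theorem ClusterShape.lintegral_law_norm_add_eq_pdfInter (c : ClusterShape) {h : ℝ → ℝ≥0∞}
    (hh : Measurable h) {v : Plane} (hv : v ≠ 0) :
    ∫⁻ u, h ‖v + u‖ ∂c.law =
      ∫⁻ g in Set.Ioi (0 : ℝ), h g * ENNReal.ofReal (c.pdfInter g ‖v‖) := by
  have hq : 0 < ‖v‖ := norm_pos_iff.2 hv
  rw [c.lintegral_law_norm_add hh v]
  cases c with
  | thomas σ hσ =>
    refine setLIntegral_congr_fun measurableSet_Ioi fun g hg => ?_
    rw [ClusterShape.radial_pdfInter_thomas hσ hg]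
  | matern R hR =>
    refine lintegral_congr_ae ?_
    have hne : ∀ᵐ g ∂(volume.restrict (Set.Ioi (0 : ℝ))), g ≠ |R - ‖v‖| :=
      ae_restrict_of_ae (Measure.ae_ne volume _)
    filter_upwards [hne, ae_restrict_mem measurableSet_Ioi] with g hg hg0
    rw [ClusterShape.radial_pdfInter_matern hR hg0 hq hg]

theorem ClusterShape.pdfIntra_nonneg (c : ClusterShape) {g : ℝ} (hg : 0 ≤ g) :
    0 ≤ c.pdfIntra g := by
  cases c with
  | thomas σ hσ => unfold pdfIntra; positivity
  | matern R hR => exact mul_nonneg (by positivity) (unitStep_nonneg _)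

theorem ClusterShape.measurable_pdfIntra (c : ClusterShape) : Measurable c.pdfIntra := by
  cases c with
  | thomas σ hσ => unfold pdfIntra; fun_prop
  | matern R hR => unfold pdfIntra; fun_prop

theorem ClusterShape.integrableOn_pdfIntra (c : ClusterShape) :
    IntegrableOn c.pdfIntra (Set.Ioi 0) := by
  refine ⟨c.measurable_pdfIntra.aestronglyMeasurable, ?_⟩
  rw [hasFiniteIntegral_iff_ofReal]
  · have := c.lintegral_law_norm (h := fun _ => 1) measurable_const
    simp only [lintegral_const, measure_univ, one_mul] at this
    rw [← this]; exact ENNReal.one_lt_top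
  · filter_upwards [ae_restrict_mem measurableSet_Ioi] with g (hg : 0 < g)
    exact c.pdfIntra_nonneg hg.le

theorem ClusterShape.integrableOn_pdfInter (c : ClusterShape) {v : Plane} (hv : v ≠ 0) :
    IntegrableOn (fun g => c.pdfInter g ‖v‖) (Set.Ioi 0) := by
  refine ⟨(c.measurable_pdfInter _).aestronglyMeasurable, ?_⟩
  rw [hasFiniteIntegral_iff_ofReal]
  · have := c.lintegral_law_norm_add_eq_pdfInter (h := fun _ => 1) measurable_const hv
    simp only [lintegral_const, measure_univ, one_mul] at this
    rw [← this]; exact ENNReal.one_lt_top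
  · filter_upwards [ae_restrict_mem measurableSet_Ioi] with g (hg : 0 < g)
    exact c.pdfInter_nonneg hg.le _

/-! ### Marks -/

theorem sum_link {M : Type*} [AddCommMonoid M] (f : Link → M) :
    ∑ κ, f κ = f .los + f .nlos :=
  Finset.sum_pair (by decide)

/-- The mark with given components. -/
def Mark.ofProd (p : Plane × ℝ × ℝ × (Link → ℝ)) : Mark := ⟨p.1, p.2.1, p.2.2.1, p.2.2.2⟩

theorem Mark.measurable_toProd : Measurable Mark.toProd := comap_measurable _

theorem Mark.measurable_ofProd : Measurable Mark.ofProd := by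
  rw [measurable_comap_iff]
  exact measurable_id

@[fun_prop]
theorem Mark.measurable_offset : Measurable Mark.offset :=
  measurable_fst.comp Mark.measurable_toProd

@[fun_prop]
theorem Mark.measurable_unif : Measurable Mark.unif :=
  (measurable_fst.comp measurable_snd).comp Mark.measurable_toProd

@[fun_prop]
theorem Mark.measurable_gain : Measurable Mark.gain :=
  (measurable_fst.comp (measurable_snd.comp measurable_snd)).comp Mark.measurable_toProd

@[fun_prop]
theorem Mark.measurable_fading : Measurable Mark.fading :=
  (measurable_snd.comp (measurable_snd.comp measurable_snd)).comp Mark.measurable_toProd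

namespace Setting

variable (S : Setting)

/-- The law of a mark. -/
def markDist : Measure Mark := S.markLaw.map Mark.ofProd

theorem beamT_mem : S.beamT ∈ Set.Icc (0 : ℝ) 1 := by
  have hpi := Real.pi_pos
  obtain ⟨h1, h2⟩ := S.thetaTa_mem
  obtain ⟨h3, h4⟩ := S.thetaTe_mem
  exact ⟨by unfold beamT; positivity, mul_le_one₀ ((div_le_one (by positivity)).2 h2)
    (by positivity) ((div_le_one hpi).2 h4)⟩

theorem beamR_mem : S.beamR ∈ Set.Icc (0 : ℝ) 1 := by
  have hpi := Real.pi_pos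
  obtain ⟨h1, h2⟩ := S.thetaRa_mem
  obtain ⟨h3, h4⟩ := S.thetaRe_mem
  exact ⟨by unfold beamR; positivity, mul_le_one₀ ((div_le_one (by positivity)).2 h2)
    (by positivity) ((div_le_one hpi).2 h4)⟩

theorem gainProb_nonneg (i : Fin 4) : 0 ≤ S.gainProb i := by
  obtain ⟨h1, h2⟩ := S.beamT_mem
  obtain ⟨h3, h4⟩ := S.beamR_mem
  have h5 : 0 ≤ 1 - S.beamT := by linarith
  have h6 : 0 ≤ 1 - S.beamR := by linarith
  fin_cases i <;> simp [gainProb] <;> positivity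

theorem sum_gainProb : ∑ i, S.gainProb i = 1 := by
  simp [gainProb, Fin.sum_univ_four]; ring

theorem gainValue_nonneg (i : Fin 4) : 0 ≤ S.gainValue i := by
  have h1 := S.Mt_pos.le
  have h2 := S.Mr_pos.le
  have h3 := S.mt_nonneg
  have h4 := S.mr_nonneg
  fin_cases i <;> simp [gainValue] <;> positivity

theorem gainValue_zero_pos : 0 < S.gainValue 0 := by
  simpa [gainValue] using mul_pos S.Mt_pos S.Mr_pos

theorem lintegral_gainLaw (f : ℝ → ℝ≥0∞) :
    ∫⁻ a, f a ∂S.gainLaw = ∑ i, ENNReal.ofReal (S.gainProb i) * f (S.gainValue i) := by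
  rw [gainLaw, lintegral_finsetSum_measure]
  refine Finset.sum_congr rfl fun i _ => ?_
  rw [lintegral_smul_measure, lintegral_dirac, smul_eq_mul]

instance : IsProbabilityMeasure S.gainLaw := by
  constructor
  have := S.lintegral_gainLaw fun _ => 1
  simp only [lintegral_one, mul_one] at this
  rw [this, ← ENNReal.ofReal_sum_of_nonneg fun i _ => S.gainProb_nonneg i, S.sum_gainProb,
    ENNReal.ofReal_one]

theorem Nak_cast_pos (κ : Link) : (0 : ℝ) < S.Nak κ := by
  have := S.Nak_pos κ; positivity

instance (κ : Link) : IsProbabilityMeasure (gammaMeasure (S.Nak κ) (S.Nak κ)) :=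
  isProbabilityMeasure_gammaMeasure (S.Nak_cast_pos κ) (S.Nak_cast_pos κ)

instance : IsProbabilityMeasure S.fadingLaw := by
  unfold fadingLaw; infer_instance

theorem lintegral_fadingLaw (κ : Link) {f : ℝ → ℝ≥0∞} (hf : Measurable f) :
    ∫⁻ b, f (b κ) ∂S.fadingLaw = ∫⁻ x, f x ∂(gammaMeasure (S.Nak κ) (S.Nak κ)) :=
  (measurePreserving_eval (fun κ => gammaMeasure (S.Nak κ) (S.Nak κ)) κ).lintegral_comp hf

instance : IsProbabilityMeasure (volume.restrict (Set.Icc (0 : ℝ) 1)) := ⟨by simp⟩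

instance : IsProbabilityMeasure S.markLaw := by
  unfold markLaw; infer_instance

instance : IsProbabilityMeasure S.markDist :=
  Measure.isProbabilityMeasure_map Mark.measurable_ofProd.aemeasurable

theorem losProb_mem (γ : ℕ) : S.losProb γ ∈ Set.Icc (0 : ℝ) 1 := by
  unfold losProb
  split_ifs
  · simp
  · have h : ∀ x : ℝ, 0 ≤ x → 0 ≤ 1 - Real.exp (-x) ∧ 1 - Real.exp (-x) ≤ 1 := by
      intro x hx
      have h1 : Real.exp (-x) ≤ 1 := Real.exp_le_one_iff.2 (by linarith)
      have h2 := Real.exp_pos (-x)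
      constructor <;> linarith
    exact ⟨Finset.prod_nonneg fun n _ => (h _ (by positivity)).1,
      Finset.prod_le_one (fun n _ => (h _ (by positivity)).1) fun n _ => (h _ (by positivity)).2⟩

theorem linkProb_nonneg (κ : Link) (γ : ℕ) : 0 ≤ S.linkProb κ γ := by
  have := S.losProb_mem γ
  cases κ
  · exact this.1
  · exact sub_nonneg.2 this.2

theorem linkProb_add (γ : ℕ) : S.linkProb .los γ + S.linkProb .nlos γ = 1 :=
  add_sub_cancel _ _

/-- The blockage cell of the distance `r`. -/
def cellIndex (r : ℝ) : ℕ := ⌊r * S.rootBeta⌋₊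

@[fun_prop]
theorem measurable_cellIndex : Measurable S.cellIndex := by
  unfold cellIndex; fun_prop

@[fun_prop]
theorem measurable_linkProb_cellIndex (κ : Link) :
    Measurable fun r => S.linkProb κ (S.cellIndex r) :=
  (measurable_of_countable (S.linkProb κ)).comp S.measurable_cellIndex

theorem dh_pos : 0 < S.dh := abs_pos.2 (sub_ne_zero.2 S.heights_ne)

theorem pathLoss_pos (κ : Link) (r : ℝ) : 0 < S.pathLoss κ r := by
  have := S.dh_pos
  exact div_pos (S.C_pos κ) (Real.sqrt_pos.2 (Real.rpow_pos_of_pos (by positivity) _))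

@[fun_prop]
theorem measurable_pathLoss (κ : Link) : Measurable (S.pathLoss κ) := by
  unfold pathLoss; fun_prop

/-- The state is decided by comparing the uniform variable with a measurable threshold. Splitting
into the two cases avoids putting a σ-algebra on `Link`. -/
theorem measurable_linkState_apply {α : Type*} [MeasurableSpace α]
    {β : Type*} [MeasurableSpace β] {r : α → ℝ} {m : α → Mark} {Ψ : Link → α → β}
    (hr : Measurable r) (hm : Measurable m) (hΨ : ∀ κ, Measurable (Ψ κ)) :
    Measurable fun x => Ψ (S.linkState (r x) (m x)) x := by
  have h : (fun x => Ψ (S.linkState (r x) (m x)) x) = fun x =>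
      if (m x).unif ≤ S.linkProb .los (S.cellIndex (r x)) then Ψ .los x else Ψ .nlos x := by
    ext x; unfold linkState cellIndex; split_ifs <;> rfl
  rw [h]
  refine Measurable.ite (measurableSet_le (by fun_prop) ?_) (hΨ _) (hΨ _)
  exact (S.measurable_linkProb_cellIndex .los).comp hr

theorem lintegral_ite_Icc {p : ℝ} (hp : p ∈ Set.Icc (0 : ℝ) 1) (a b : ℝ≥0∞) :
    ∫⁻ t in Set.Icc (0 : ℝ) 1, (if t ≤ p then a else b) =
      ENNReal.ofReal p * a + ENNReal.ofReal (1 - p) * b := by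
  have h1 : Set.Icc (0 : ℝ) 1 = Set.Icc 0 p ∪ Set.Ioc p 1 :=
    (Set.Icc_union_Ioc_eq_Icc hp.1 hp.2).symm
  have hd : Disjoint (Set.Icc 0 p) (Set.Ioc p 1) := by
    rw [Set.disjoint_left]; intro t ht ht'; exact absurd ht.2 (not_le.2 ht'.1)
  rw [h1, lintegral_union measurableSet_Ioc hd,
    setLIntegral_congr_fun measurableSet_Icc (g := fun _ => a) fun t ht => if_pos ht.2,
    setLIntegral_congr_fun measurableSet_Ioc (g := fun _ => b) fun t ht => if_neg (not_le.2 ht.1)]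
  simp [mul_comm]

/-- The expectation of a function of a mark and of the state of its link, for a user of a cluster
centred at `v`. -/
theorem lintegral_markDist (v : Plane) {Ψ : Link → Plane × ℝ × (Link → ℝ) → ℝ≥0∞}
    (hΨ : ∀ κ, Measurable (Ψ κ)) :
    ∫⁻ m, Ψ (S.linkState ‖v + m.offset‖ m) (m.offset, m.gain, m.fading) ∂S.markDist =
      ∫⁻ u, ∑ κ, ENNReal.ofReal (S.linkProb κ (S.cellIndex ‖v + u‖)) *
        ∫⁻ a, ∫⁻ b, Ψ κ (u, a, b) ∂S.fadingLaw ∂S.gainLaw ∂S.shape.law := by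
  have hm : Measurable fun m : Mark =>
      Ψ (S.linkState ‖v + m.offset‖ m) (m.offset, m.gain, m.fading) :=
    S.measurable_linkState_apply (Ψ := fun κ m => Ψ κ (m.offset, m.gain, m.fading)) (by fun_prop)
      measurable_id fun κ => (hΨ κ).comp (by fun_prop)
  have hm' : Measurable fun p => Ψ (S.linkState ‖v + (Mark.ofProd p).offset‖ (Mark.ofProd p))
      ((Mark.ofProd p).offset, (Mark.ofProd p).gain, (Mark.ofProd p).fading) :=
    hm.comp Mark.measurable_ofProd
  rw [markDist, lintegral_map hm Mark.measurable_ofProd, markLaw,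
    lintegral_prod _ hm'.aemeasurable]
  refine lintegral_congr fun u => ?_
  refine (lintegral_prod _ (hm'.comp measurable_prodMk_left).aemeasurable).trans ?_
  -- For a fixed position the uniform variable enters only through the state, so integrating it
  -- weights the two states by their link probabilities.
  have h1 : ∀ t : ℝ, ∫⁻ y : ℝ × (Link → ℝ), Ψ (S.linkState ‖v + u‖ (Mark.ofProd (u, t, y)))
      (u, y.1, y.2) ∂(S.gainLaw.prod S.fadingLaw) =
      if t ≤ S.linkProb .los (S.cellIndex ‖v + u‖) then
        ∫⁻ a, ∫⁻ b, Ψ .los (u, a, b) ∂S.fadingLaw ∂S.gainLaw else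
        ∫⁻ a, ∫⁻ b, Ψ .nlos (u, a, b) ∂S.fadingLaw ∂S.gainLaw := by
    intro t
    have h2 : ∀ y, S.linkState ‖v + u‖ (Mark.ofProd (u, t, y)) =
        if t ≤ S.linkProb .los (S.cellIndex ‖v + u‖) then .los else .nlos := fun y => rfl
    simp_rw [h2]
    split_ifs
    · exact lintegral_prod (fun y : ℝ × (Link → ℝ) => Ψ .los (u, y.1, y.2))
        ((hΨ _).comp measurable_prodMk_left).aemeasurable
    · exact lintegral_prod (fun y : ℝ × (Link → ℝ) => Ψ .nlos (u, y.1, y.2))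
        ((hΨ _).comp measurable_prodMk_left).aemeasurable
  refine (lintegral_congr h1).trans ?_
  rw [sum_link]
  exact lintegral_ite_Icc (S.losProb_mem _) _ _

/-! ### Sums over the blockage cells -/

theorem rootBeta_pos : 0 < S.rootBeta := Real.sqrt_pos.2 (mul_pos S.betaA_pos S.betaB_pos)

theorem cell_le_iff (γ : ℕ) (w : ℝ) : S.cell γ ≤ w ↔ (γ : ℝ) ≤ w * S.rootBeta := by
  rw [cell, div_le_iff₀ S.rootBeta_pos]

theorem cell_nonneg (γ : ℕ) : 0 ≤ S.cell γ := div_nonneg (Nat.cast_nonneg _) S.rootBeta_pos.le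

theorem cell_le_succ (γ : ℕ) : S.cell γ ≤ S.cell (γ + 1) :=
  div_le_div_of_nonneg_right (by push_cast; linarith) S.rootBeta_pos.le

theorem mem_cell_iff (γ : ℕ) {w : ℝ} (hw : 0 ≤ w) :
    w ∈ Set.Ico (S.cell γ) (S.cell (γ + 1)) ↔ S.cellIndex w = γ := by
  rw [Set.mem_Ico, cell_le_iff, ← not_le, cell_le_iff, cellIndex,
    Nat.floor_eq_iff (mul_nonneg hw S.rootBeta_pos.le), not_le]
  push_cast; rfl

/-- The half-open cells are the fibres of `cellIndex` on `[0, ∞)`, so on each of them the index is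
constant. Countable additivity over this partition gives the convergence of the series; end points
are null sets. -/
theorem hasSum_cells {F : ℕ → ℝ → ℝ}
    (hF : IntegrableOn (fun w => F (S.cellIndex w) w) (Set.Ioi 0)) :
    (∀ γ, IntervalIntegrable (F γ) volume (S.cell γ) (S.cell (γ + 1))) ∧
      HasSum (fun γ => ∫ w in S.cell γ..S.cell (γ + 1), F γ w)
        (∫ w in Set.Ioi 0, F (S.cellIndex w) w) := by
  rw [← integrableOn_Ici_iff_integrableOn_Ioi] at hF
  have hU : Set.Ici (0 : ℝ) = ⋃ γ, Set.Ico (S.cell γ) (S.cell (γ + 1)) := by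
    ext w
    simp only [Set.mem_iUnion, Set.mem_Ici]
    constructor
    · intro hw; exact ⟨_, (S.mem_cell_iff _ hw).2 rfl⟩
    · rintro ⟨γ, hγ⟩; exact (S.cell_nonneg γ).trans hγ.1
  have hpos : ∀ {γ w}, w ∈ Set.Ico (S.cell γ) (S.cell (γ + 1)) → 0 ≤ w :=
    fun {γ w} h => (S.cell_nonneg γ).trans h.1
  have heq : ∀ γ, Set.EqOn (fun w => F (S.cellIndex w) w) (F γ)
      (Set.Ico (S.cell γ) (S.cell (γ + 1))) := by
    intro γ w hw
    simp only [(S.mem_cell_iff γ (hpos hw)).1 hw]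
  have hd : Pairwise (Function.onFun Disjoint fun γ => Set.Ico (S.cell γ) (S.cell (γ + 1))) := by
    intro γ γ' h
    rw [Function.onFun, Set.disjoint_left]
    intro w hw hw'
    exact h (((S.mem_cell_iff γ (hpos hw)).1 hw).symm.trans ((S.mem_cell_iff γ' (hpos hw)).1 hw'))
  constructor
  · intro γ
    rw [intervalIntegrable_iff_integrableOn_Ico_of_le (S.cell_le_succ γ)]
    refine IntegrableOn.congr_fun (hF.mono_set ?_) (heq γ) measurableSet_Ico
    rw [hU]; exact Set.subset_iUnion (fun γ => Set.Ico (S.cell γ) (S.cell (γ + 1))) γ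
  · rw [← integral_Ici_eq_integral_Ioi, hU]
    rw [hU] at hF
    have := hasSum_integral_iUnion
      (s := fun γ => Set.Ico (S.cell γ) (S.cell (γ + 1))) (fun γ => measurableSet_Ico) hd hF
    have hγ : ∀ γ, ∫ w in S.cell γ..S.cell (γ + 1), F γ w =
        ∫ w in Set.Ico (S.cell γ) (S.cell (γ + 1)), F (S.cellIndex w) w := fun γ => by
      rw [setIntegral_congr_fun measurableSet_Ico (heq γ),
        intervalIntegral.integral_of_le (S.cell_le_succ γ), integral_Ico_eq_integral_Ioo,
        integral_Ioc_eq_integral_Ioo]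
    simp_rw [hγ]
    exact this

/-! ### The Laplace transform of the gain of one interfering link -/

/-- `Λ^L + Λ^N`. -/
def linkLaplace (γ : ℕ) (w s : ℝ) : ℝ := S.Lam .los γ w s + S.Lam .nlos γ w s

theorem lintegral_lexp_gain (κ : Link) (r : ℝ) {s : ℝ} (hs : 0 ≤ s) :
    ∫⁻ a, ∫⁻ b, lexp (ENNReal.ofReal s * ENNReal.ofReal (S.pathLoss κ r * a * b κ))
        ∂S.fadingLaw ∂S.gainLaw =
      ENNReal.ofReal (∑ i : Fin 4, S.gainProb i *
        ((1 + s * S.C κ * S.gainValue i /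
          ((S.Nak κ : ℝ) * Real.sqrt ((r ^ 2 + S.dh ^ 2) ^ S.alpha κ))) ^ S.Nak κ)⁻¹) := by
  have hN := S.Nak_cast_pos κ
  have hbase : ∀ i, 0 ≤ s * S.C κ * S.gainValue i /
      ((S.Nak κ : ℝ) * Real.sqrt ((r ^ 2 + S.dh ^ 2) ^ S.alpha κ)) := fun i => by
    have := (S.C_pos κ).le
    have := S.gainValue_nonneg i
    positivity
  rw [S.lintegral_gainLaw, ENNReal.ofReal_sum_of_nonneg fun i _ =>
    mul_nonneg (S.gainProb_nonneg i) (by have := hbase i; positivity)]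
  refine Finset.sum_congr rfl fun i _ => ?_
  rw [ENNReal.ofReal_mul (S.gainProb_nonneg i)]
  congr 1
  have hc : 0 ≤ s * (S.pathLoss κ r * S.gainValue i) :=
    mul_nonneg hs (mul_nonneg (S.pathLoss_pos κ r).le (S.gainValue_nonneg i))
  rw [S.lintegral_fadingLaw κ (f := fun x =>
    lexp (ENNReal.ofReal s * ENNReal.ofReal (S.pathLoss κ r * S.gainValue i * x))) (by fun_prop)]
  have h1 : ∫⁻ x, lexp (ENNReal.ofReal s * ENNReal.ofReal (S.pathLoss κ r * S.gainValue i * x))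
      ∂(gammaMeasure (S.Nak κ) (S.Nak κ)) =
      ∫⁻ x, ENNReal.ofReal (Real.exp (-(s * (S.pathLoss κ r * S.gainValue i) * x)))
        ∂(gammaMeasure (S.Nak κ) (S.Nak κ)) := by
    refine lintegral_congr_ae ?_
    -- Almost sure nonnegativity of the fading makes the truncation in `ENNReal.ofReal` harmless.
    filter_upwards [ae_nonneg_gammaMeasure (S.Nak κ) (S.Nak κ)] with x hx
    rw [← ENNReal.ofReal_mul hs, lexp_ofReal, ← mul_assoc]
    rw [← mul_assoc]; exact mul_nonneg hc hx
  rw [h1, lintegral_exp_gammaMeasure hN hN hc, Real.rpow_natCast]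
  congr 4
  rw [pathLoss]; ring

theorem Lam_eq (κ : Link) (γ : ℕ) (r : ℝ) {s : ℝ} (hs : 0 ≤ s) :
    ENNReal.ofReal (S.Lam κ γ r s) = ENNReal.ofReal (S.linkProb κ γ) *
      ∫⁻ a, ∫⁻ b, lexp (ENNReal.ofReal s * ENNReal.ofReal (S.pathLoss κ r * a * b κ))
        ∂S.fadingLaw ∂S.gainLaw := by
  rw [lintegral_lexp_gain S κ r hs, Lam, ENNReal.ofReal_mul (S.linkProb_nonneg κ γ)]

theorem Lam_nonneg (κ : Link) (γ : ℕ) (w : ℝ) {s : ℝ} (hs : 0 ≤ s) : 0 ≤ S.Lam κ γ w s := by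
  refine mul_nonneg (S.linkProb_nonneg κ γ) (Finset.sum_nonneg fun i _ => ?_)
  have := (S.C_pos κ).le
  have := S.gainValue_nonneg i
  have := S.gainProb_nonneg i
  positivity

theorem Lam_le (κ : Link) (γ : ℕ) (w : ℝ) {s : ℝ} (hs : 0 ≤ s) :
    S.Lam κ γ w s ≤ S.linkProb κ γ := by
  rw [← ENNReal.ofReal_le_ofReal_iff (S.linkProb_nonneg κ γ), S.Lam_eq κ γ w hs]
  refine mul_le_of_le_one_right zero_le ?_
  calc _ ≤ ∫⁻ a, ∫⁻ b, 1 ∂S.fadingLaw ∂S.gainLaw :=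
        lintegral_mono fun a => lintegral_mono fun b => lexp_le_one _
    _ = 1 := by simp

theorem linkLaplace_nonneg (γ : ℕ) (w : ℝ) {s : ℝ} (hs : 0 ≤ s) : 0 ≤ S.linkLaplace γ w s :=
  add_nonneg (S.Lam_nonneg _ γ w hs) (S.Lam_nonneg _ γ w hs)

theorem linkLaplace_le_one (γ : ℕ) (w : ℝ) {s : ℝ} (hs : 0 ≤ s) : S.linkLaplace γ w s ≤ 1 :=
  (add_le_add (S.Lam_le _ γ w hs) (S.Lam_le _ γ w hs)).trans_eq (S.linkProb_add γ)

theorem measurable_linkLaplace (s : ℝ) : Measurable fun w => S.linkLaplace (S.cellIndex w) w s := by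
  unfold linkLaplace Lam
  fun_prop

/-- The Laplace transform of the interference of a user whose cluster is centred at `v`. -/
def userLaplace (s : ℝ) (v : Plane) : ℝ≥0∞ :=
  ∫⁻ m, lexp (ENNReal.ofReal s * ENNReal.ofReal (S.channelGain (v + m.offset) m)) ∂S.markDist

theorem userLaplace_eq_lintegral_law {s : ℝ} (hs : 0 ≤ s) (v : Plane) :
    S.userLaplace s v = ∫⁻ u, ENNReal.ofReal
      (S.linkLaplace (S.cellIndex ‖v + u‖) ‖v + u‖ s) ∂S.shape.law := by
  have h := S.lintegral_markDist v (Ψ := fun κ p => lexp (ENNReal.ofReal s *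
    ENNReal.ofReal (S.pathLoss κ ‖v + p.1‖ * p.2.1 * p.2.2 κ))) fun κ => by fun_prop
  refine Eq.trans h (lintegral_congr fun u => ?_)
  rw [sum_link, linkLaplace, ENNReal.ofReal_add (S.Lam_nonneg _ _ _ hs) (S.Lam_nonneg _ _ _ hs),
    S.Lam_eq _ _ _ hs, S.Lam_eq _ _ _ hs]

theorem ofReal_tsum_cells {s : ℝ} (hs : 0 ≤ s) {f : ℝ → ℝ} (hf : IntegrableOn f (Set.Ioi 0))
    (hf0 : ∀ g, 0 < g → 0 ≤ f g) :
    ENNReal.ofReal (∑' γ : ℕ, ∫ w in S.cell γ..S.cell (γ + 1),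
      (S.Lam .los γ w s + S.Lam .nlos γ w s) * f w) =
      ∫⁻ g in Set.Ioi (0 : ℝ), ENNReal.ofReal (S.linkLaplace (S.cellIndex g) g s) *
        ENNReal.ofReal (f g) := by
  have hint : IntegrableOn (fun w => S.linkLaplace (S.cellIndex w) w s * f w) (Set.Ioi 0) := by
    refine Integrable.bdd_mul (c := 1) hf (S.measurable_linkLaplace s).aestronglyMeasurable
      (Filter.Eventually.of_forall fun w => ?_)
    rw [Real.norm_of_nonneg (S.linkLaplace_nonneg _ _ hs)]
    exact S.linkLaplace_le_one _ _ hs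
  have h := (S.hasSum_cells (F := fun γ w => S.linkLaplace γ w s * f w) hint).2
  have h' := h.tsum_eq
  unfold linkLaplace at h'
  rw [h', ofReal_integral_eq_lintegral_ofReal]
  · refine lintegral_congr fun g => ?_
    exact ENNReal.ofReal_mul (S.linkLaplace_nonneg _ _ hs)
  · exact hint
  · filter_upwards [ae_restrict_mem measurableSet_Ioi] with g hg
    exact mul_nonneg (S.linkLaplace_nonneg _ _ hs) (hf0 g hg)

theorem userLaplace_zero {s : ℝ} (hs : 0 ≤ s) : S.userLaplace s 0 = ENNReal.ofReal (S.Oa s) := by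
  rw [S.userLaplace_eq_lintegral_law hs, Oa, S.ofReal_tsum_cells hs S.shape.integrableOn_pdfIntra
    fun g hg => S.shape.pdfIntra_nonneg hg.le]
  simp only [zero_add]
  exact S.shape.lintegral_law_norm
    (h := fun g => ENNReal.ofReal (S.linkLaplace (S.cellIndex g) g s))
    (S.measurable_linkLaplace s).ennreal_ofReal

theorem userLaplace_of_ne_zero {s : ℝ} (hs : 0 ≤ s) {v : Plane} (hv : v ≠ 0) :
    S.userLaplace s v = ENNReal.ofReal (S.Oe s ‖v‖) := by
  rw [S.userLaplace_eq_lintegral_law hs, Oe,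
    S.ofReal_tsum_cells hs (S.shape.integrableOn_pdfInter hv)
      fun g hg => S.shape.pdfInter_nonneg hg.le _]
  exact S.shape.lintegral_law_norm_add_eq_pdfInter
    (h := fun g => ENNReal.ofReal (S.linkLaplace (S.cellIndex g) g s))
    (S.measurable_linkLaplace s).ennreal_ofReal hv

end Setting

/-! ### Generating functions of the numbers of users -/

instance (n : UserNumber) : IsProbabilityMeasure n.law := by
  cases n <;> unfold UserNumber.law <;> infer_instance

theorem UserNumber.lintegral_pow_law (n : UserNumber) {x : ℝ} (hx : 0 ≤ x) :
    ∫⁻ k, ENNReal.ofReal x ^ k ∂n.law = ENNReal.ofReal (Setting.clusterFactor n x) := by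
  cases n with
  | fixed N hN =>
    rw [UserNumber.law, lintegral_dirac, Setting.clusterFactor, ENNReal.ofReal_pow hx]
  | random n hn =>
    rw [UserNumber.law, lintegral_pow_poissonMeasure _ hx, Setting.clusterFactor,
      Real.coe_toNNReal n (by linarith)]

theorem clusterFactor_pos (n : UserNumber) {x : ℝ} (hx : 0 < x) :
    0 < Setting.clusterFactor n x := by
  cases n with
  | fixed N hN => exact pow_pos hx N
  | random n hn => exact Real.exp_pos _

theorem clusterFactor_le_one (n : UserNumber) {x : ℝ} (hx : 0 ≤ x) (hx1 : x ≤ 1) :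
    Setting.clusterFactor n x ≤ 1 := by
  cases n with
  | fixed N hN => exact pow_le_one₀ hx hx1
  | random n hn =>
    refine Real.exp_le_one_iff.2 (neg_nonpos.2 (mul_nonneg (by linarith) (by linarith)))

theorem UserNumber.typicalLaw_zero (n : UserNumber) : n.typicalLaw {0} = 0 := by
  cases n with
  | fixed N hN =>
    rw [UserNumber.typicalLaw, Measure.dirac_apply, Set.indicator_of_notMem]
    exact (Nat.one_le_iff_ne_zero.1 hN)
  | random n hn =>
    rw [UserNumber.typicalLaw, Measure.map_apply (measurable_of_countable _)
      (measurableSet_singleton 0)]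
    have : (fun k : ℕ => k + 1) ⁻¹' {0} = ∅ := by ext k; simp
    rw [this, measure_empty]

/-- The generating function of the number of interferers in the corresponding cluster. -/
def intraFactor : UserNumber → ℝ → ℝ
  | .fixed N _, x => x ^ (N - 1)
  | .random n _, x => Real.exp (-((n - 1) * (1 - x)))

theorem Setting.La_eq (S : Setting) (s : ℝ) : S.La s = intraFactor S.number (S.Oa s) := by
  unfold Setting.La intraFactor
  cases S.number <;> rfl

theorem UserNumber.lintegral_pow_typicalLaw (n : UserNumber) {x : ℝ} (hx : 0 ≤ x) :
    ∫⁻ m, ENNReal.ofReal x ^ (m - 1) ∂n.typicalLaw = ENNReal.ofReal (intraFactor n x) := by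
  cases n with
  | fixed N hN =>
    rw [UserNumber.typicalLaw, lintegral_dirac, intraFactor, ENNReal.ofReal_pow hx]
  | random n hn =>
    rw [UserNumber.typicalLaw, lintegral_map (measurable_of_countable _)
      (measurable_of_countable _)]
    simp only [Nat.add_sub_cancel]
    rw [lintegral_pow_poissonMeasure _ hx, intraFactor, Real.coe_toNNReal _ (by linarith)]

/-! ### Interference as a function of the components of the network -/

namespace Setting

variable (S : Setting)

theorem measurable_channelGain : Measurable fun p : Plane × Mark => S.channelGain p.1 p.2 := by
  unfold channelGain
  exact S.measurable_linkState_apply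
    (Ψ := fun κ (p : Plane × Mark) => S.pathLoss κ ‖p.1‖ * p.2.gain * p.2.fading κ)
    (by fun_prop) (by fun_prop) fun κ => by fun_prop

/-- The received power from a user with mark `m` in a cluster centred at `v`. -/
def userPower (v : Plane) (m : Mark) : ℝ≥0∞ := ENNReal.ofReal (S.channelGain (v + m.offset) m)

theorem measurable_userPower : Measurable fun p : Plane × Mark => S.userPower p.1 p.2 := by
  unfold userPower
  exact (S.measurable_channelGain.comp (f := fun p : Plane × Mark => (p.1 + p.2.offset, p.2))
    (by fun_prop)).ennreal_ofReal

/-- Intra-cluster interference for `p.1` users, of which user `p.2` transmits. -/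
def intraSum (p : ℕ × ℕ) (x : Option ℕ × ℕ → Mark) : ℝ≥0∞ :=
  ∑ j ∈ (Finset.range p.1).erase p.2, S.userPower 0 (x (none, j))

/-- Interference from the `i`-th cluster. -/
def clusterSum (i : ℕ) (v : ℕ → Plane) (c : ℕ → ℕ) (x : Option ℕ × ℕ → Mark) : ℝ≥0∞ :=
  ∑ j ∈ Finset.range (c i), S.userPower (v i) (x (some i, j))

theorem sum_eq_tsum_ite (s : Finset ℕ) (f : ℕ → ℝ≥0∞) :
    ∑ j ∈ s, f j = ∑' j, if j ∈ s then f j else 0 := by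
  rw [tsum_eq_sum (s := s) fun j hj => if_neg hj]
  exact Finset.sum_congr rfl fun j hj => (if_pos hj).symm

theorem measurable_intraSum :
    Measurable fun z : (ℕ × ℕ) × (Option ℕ × ℕ → Mark) => S.intraSum z.1 z.2 := by
  unfold intraSum
  simp_rw [sum_eq_tsum_ite]
  refine Measurable.tsum fun j => Measurable.ite ?_ ?_ measurable_const
  · exact measurable_fst
      (MeasurableSet.of_discrete (s := {p : ℕ × ℕ | j ∈ (Finset.range p.1).erase p.2}))
  · exact S.measurable_userPower.comp (f := fun z : (ℕ × ℕ) × (Option ℕ × ℕ → Mark) =>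
      ((0 : Plane), z.2 (none, j))) (by fun_prop)

theorem measurable_clusterSum (i : ℕ) :
    Measurable fun z : (ℕ → Plane) × (ℕ → ℕ) × (Option ℕ × ℕ → Mark) =>
      S.clusterSum i z.1 z.2.1 z.2.2 := by
  unfold clusterSum
  simp_rw [sum_eq_tsum_ite]
  refine Measurable.tsum fun j => Measurable.ite ?_ ?_ measurable_const
  · have : Measurable fun z : (ℕ → Plane) × (ℕ → ℕ) × (Option ℕ × ℕ → Mark) => z.2.1 i := by
      fun_prop
    exact this (MeasurableSet.of_discrete (s := {c : ℕ | j ∈ Finset.range c}))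
  · exact S.measurable_userPower.comp
      (f := fun z : (ℕ → Plane) × (ℕ → ℕ) × (Option ℕ × ℕ → Mark) =>
        (z.1 i, z.2.2 (some i, j))) (by fun_prop)

/-- The interference ignores the mark of the transmitting user. With `clusterSum_update` this makes
the desired link independent of the interference. -/
theorem intraSum_update (p : ℕ × ℕ) (x : Option ℕ × ℕ → Mark) (m : Mark) :
    S.intraSum p (Function.update x (none, p.2) m) = S.intraSum p x := by
  refine Finset.sum_congr rfl fun j hj => ?_
  rw [Function.update_of_ne]
  simpa using Finset.ne_of_mem_erase hj

theorem clusterSum_update (i k : ℕ) (v : ℕ → Plane) (c : ℕ → ℕ) (x : Option ℕ × ℕ → Mark)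
    (m : Mark) :
    S.clusterSum i v c (Function.update x (none, k) m) = S.clusterSum i v c x := by
  refine Finset.sum_congr rfl fun j hj => ?_
  rw [Function.update_of_ne]
  simp

theorem measurable_userLaplace (s : ℝ) : Measurable (S.userLaplace s) := by
  have : Measurable fun p : Plane × Mark => lexp (ENNReal.ofReal s * S.userPower p.1 p.2) :=
    measurable_lexp.comp (S.measurable_userPower.const_mul _)
  exact this.lintegral_prod_right'

theorem userLaplace_le_one (s : ℝ) (v : Plane) : S.userLaplace s v ≤ 1 :=
  (lintegral_mono fun _ => lexp_le_one _).trans_eq (by simp)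

/-- The power received from a single user is finite. Positivity passes to `clusterLaplace` and
allows its logarithm to be taken. -/
theorem userLaplace_pos (s : ℝ) (v : Plane) : 0 < S.userLaplace s v := by
  have hm : Measurable fun m : Mark => lexp (ENNReal.ofReal s * S.userPower v m) :=
    measurable_lexp.comp ((S.measurable_userPower.comp measurable_prodMk_left).const_mul _)
  refine (lintegral_pos_iff_support hm).2 ?_
  have : Function.support (fun m : Mark => lexp (ENNReal.ofReal s * S.userPower v m)) =
      Set.univ := by
    ext m
    simp only [Function.mem_support, Set.mem_univ, iff_true]
    exact (lexp_pos (ENNReal.mul_ne_top ENNReal.ofReal_ne_top ENNReal.ofReal_ne_top)).ne'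
  rw [this, measure_univ]
  exact one_pos

/-- The Laplace transform of the interference of a cluster centred at `v`. -/
def clusterLaplace (t : ℝ) (v : Plane) : ℝ :=
  clusterFactor S.number (S.userLaplace t v).toReal

theorem userLaplace_toReal_pos (s : ℝ) (v : Plane) : 0 < (S.userLaplace s v).toReal :=
  ENNReal.toReal_pos (S.userLaplace_pos s v).ne'
    (ne_top_of_le_ne_top ENNReal.one_ne_top (S.userLaplace_le_one s v))

theorem userLaplace_toReal_le_one (s : ℝ) (v : Plane) : (S.userLaplace s v).toReal ≤ 1 :=
  ENNReal.toReal_le_of_le_ofReal zero_le_one (by simpa using S.userLaplace_le_one s v)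

theorem clusterLaplace_pos (t : ℝ) (v : Plane) : 0 < S.clusterLaplace t v :=
  clusterFactor_pos _ (S.userLaplace_toReal_pos t v)

theorem clusterLaplace_le_one (t : ℝ) (v : Plane) : S.clusterLaplace t v ≤ 1 :=
  clusterFactor_le_one _ (S.userLaplace_toReal_pos t v).le (S.userLaplace_toReal_le_one t v)

theorem measurable_clusterLaplace (t : ℝ) : Measurable (S.clusterLaplace t) := by
  have h : Measurable (clusterFactor S.number) := by
    cases S.number <;> unfold clusterFactor <;> fun_prop
  exact h.comp (S.measurable_userLaplace t).ennreal_toReal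

theorem lintegral_pow_userLaplace (t : ℝ) (v : Plane) :
    ∫⁻ k, S.userLaplace t v ^ k ∂S.number.law = ENNReal.ofReal (S.clusterLaplace t v) := by
  rw [clusterLaplace, ← UserNumber.lintegral_pow_law _ (S.userLaplace_toReal_pos t v).le,
    ENNReal.ofReal_toReal (ne_top_of_le_ne_top ENNReal.one_ne_top (S.userLaplace_le_one t v))]

theorem Oa_pos {s : ℝ} (hs : 0 ≤ s) : 0 < S.Oa s := by
  have := S.userLaplace_pos s 0
  rwa [S.userLaplace_zero hs, ENNReal.ofReal_pos] at this

theorem Oe_pos {s : ℝ} (hs : 0 ≤ s) {v : Plane} (hv : v ≠ 0) : 0 < S.Oe s ‖v‖ := by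
  have := S.userLaplace_pos s v
  rwa [S.userLaplace_of_ne_zero hs hv, ENNReal.ofReal_pos] at this

theorem clusterLaplace_of_ne_zero {t : ℝ} (ht : 0 ≤ t) {v : Plane} (hv : v ≠ 0) :
    S.clusterLaplace t v = clusterFactor S.number (S.Oe t ‖v‖) := by
  rw [clusterLaplace, S.userLaplace_of_ne_zero ht hv, ENNReal.toReal_ofReal (S.Oe_pos ht hv).le]

theorem Le_eq {t : ℝ} (ht : 0 ≤ t) :
    ENNReal.ofReal (S.Le t) = lexp (ENNReal.ofReal S.lam *
      ∫⁻ v : Plane, ENNReal.ofReal (1 - S.clusterLaplace t v)) := by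
  -- Evaluating `clusterLaplace` along a fixed ray gives a function of the distance whose
  -- measurability is inherited, so that none has to be shown for `Oe` in its second argument.
  set e : Plane := EuclideanSpace.single 0 1
  have he : ‖e‖ = 1 := by simp [e]
  have hq : ∀ q : ℝ, 0 < q → q • e ≠ 0 ∧ ‖q • e‖ = q := by
    intro q hq
    have h1 : ‖q • e‖ = q := by rw [norm_smul, he, mul_one, Real.norm_of_nonneg hq.le]
    exact ⟨norm_pos_iff.1 (by rw [h1]; exact hq), h1⟩
  have h1 : ∫⁻ v : Plane, ENNReal.ofReal (1 - S.clusterLaplace t v) =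
      ∫⁻ v : Plane, ENNReal.ofReal (1 - S.clusterLaplace t (‖v‖ • e)) := by
    refine lintegral_congr_ae ?_
    filter_upwards [Measure.ae_ne volume (0 : Plane)] with v hv
    have := hq _ (norm_pos_iff.2 hv)
    rw [S.clusterLaplace_of_ne_zero ht hv, S.clusterLaplace_of_ne_zero ht this.1, this.2]
  have hm : Measurable fun q : ℝ => ENNReal.ofReal (1 - S.clusterLaplace t (q • e)) :=
    (measurable_const.sub ((S.measurable_clusterLaplace t).comp
      (measurable_id.smul_const e))).ennreal_ofReal
  rw [h1, lintegral_norm hm, Le]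
  change lexp _ = _
  congr 1
  have h2 : ∫⁻ g in Set.Ioi (0 : ℝ), ENNReal.ofReal (2 * Real.pi * g) *
      ENNReal.ofReal (1 - S.clusterLaplace t (g • e)) =
      ∫⁻ g in Set.Ioi (0 : ℝ), ENNReal.ofReal (2 * Real.pi) *
        ENNReal.ofReal ((1 - clusterFactor S.number (S.Oe t g)) * g) := by
    refine setLIntegral_congr_fun measurableSet_Ioi fun g (hg : 0 < g) => ?_
    obtain ⟨h3, h4⟩ := hq g hg
    have h5 := S.clusterLaplace_le_one t (g • e)
    rw [S.clusterLaplace_of_ne_zero ht h3, h4] at h5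
    rw [S.clusterLaplace_of_ne_zero ht h3, h4, ← ENNReal.ofReal_mul (by positivity),
      ← ENNReal.ofReal_mul (by positivity)]
    congr 1; ring
  rw [h2, lintegral_const_mul', ENNReal.ofReal_mul (by positivity : 0 ≤ 2 * Real.pi)]
  · ring
  · exact ENNReal.ofReal_ne_top

end Setting

namespace Network

variable {S : Setting} {Ω : Type*} [MeasurableSpace Ω] {μ : Measure Ω} (net : Network S μ)

/-! ### Independence of the components -/

/-- The positions of the other UAVs. -/
def uavs (ω : Ω) (i : ℕ) : Plane := net.uav i ω

/-- The numbers of users of the other clusters. -/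
def counts (ω : Ω) (i : ℕ) : ℕ := net.count i ω

/-- The number of users and the transmitting user of the corresponding cluster. -/
def selection (ω : Ω) : ℕ × ℕ := (net.count₀ ω, net.selected ω)

/-- The marks of all users. -/
def marks (ω : Ω) (l : Option ℕ × ℕ) : Mark := net.mark l ω

theorem measurable_uavs : Measurable net.uavs := measurable_pi_lambda _ net.uav_poisson.measurable

theorem measurable_counts : Measurable net.counts := measurable_pi_lambda _ net.count_measurable

theorem measurable_selection : Measurable net.selection :=
  net.count₀_measurable.prodMk net.selected_measurable

theorem measurable_marks : Measurable net.marks := measurable_pi_lambda _ net.mark_measurable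

theorem map_mark (l : Option ℕ × ℕ) : μ.map (net.mark l) = S.markDist := by
  rw [Setting.markDist, ← net.mark_law l]
  exact (Measure.map_map Mark.measurable_ofProd
    (Mark.measurable_toProd.comp (net.mark_measurable l))).symm

/-- The three nested independence assumptions make the joint law of positions, selection, counts and
marks a product measure. -/
theorem lintegral_eq_iterated [IsProbabilityMeasure μ]
    {G : (ℕ → Plane) × (ℕ × ℕ) × (ℕ → ℕ) × (Option ℕ × ℕ → Mark) → ℝ≥0∞} (hG : Measurable G) :
    ∫⁻ ω, G (net.uavs ω, net.selection ω, net.counts ω, net.marks ω) ∂μ =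
      ∫⁻ v, ∫⁻ p, ∫⁻ c, ∫⁻ x, G (v, p, c, x) ∂(μ.map net.marks) ∂(μ.map net.counts)
        ∂(μ.map net.selection) ∂(μ.map net.uavs) := by
  have hu := net.measurable_uavs
  have hc := net.measurable_counts
  have hs := net.measurable_selection
  have hx := net.measurable_marks
  have := Measure.isProbabilityMeasure_map hu.aemeasurable (μ := μ)
  have := Measure.isProbabilityMeasure_map hc.aemeasurable (μ := μ)
  have := Measure.isProbabilityMeasure_map hs.aemeasurable (μ := μ)
  have := Measure.isProbabilityMeasure_map hx.aemeasurable (μ := μ)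
  have hcx := hc.prodMk hx
  have hscx := hs.prodMk hcx
  have e1 := (indepFun_iff_map_prod_eq_prod_map_map hu.aemeasurable hscx.aemeasurable).1
    net.uav_indep
  have e2 := (indepFun_iff_map_prod_eq_prod_map_map hs.aemeasurable hcx.aemeasurable).1
    net.selection_indep
  have e3 := (indepFun_iff_map_prod_eq_prod_map_map hc.aemeasurable hx.aemeasurable).1
    net.count_mark_indep
  rw [← lintegral_map hG (hu.prodMk hscx), e1, e2, e3, lintegral_prod _ hG.aemeasurable]
  refine lintegral_congr fun v => ?_
  rw [lintegral_prod _ (by fun_prop)]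
  refine lintegral_congr fun p => ?_
  rw [lintegral_prod _ (by fun_prop)]

theorem lintegral_marks_prod (F : Finset (Option ℕ × ℕ)) {f : Option ℕ × ℕ → Mark → ℝ≥0∞}
    (hf : ∀ l, Measurable (f l)) :
    ∫⁻ x, ∏ l ∈ F, f l (x l) ∂(μ.map net.marks) = ∏ l ∈ F, ∫⁻ m, f l m ∂S.markDist := by
  rw [lintegral_map (by fun_prop) net.measurable_marks]
  refine (lintegral_prod_eq_prod_lintegral_of_indepFun F (fun l ω => f l (net.mark l ω))
    (net.mark_indep.comp f hf) fun l => (hf l).comp (net.mark_measurable l)).trans ?_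
  refine Finset.prod_congr rfl fun l _ => ?_
  rw [← net.map_mark l, lintegral_map (hf l) (net.mark_measurable l)]

theorem lintegral_counts_prod (n : ℕ) (f : ℕ → ℕ → ℝ≥0∞) :
    ∫⁻ c, ∏ i ∈ Finset.range n, f i (c i) ∂(μ.map net.counts) =
      ∏ i ∈ Finset.range n, ∫⁻ k, f i k ∂S.number.law := by
  have hf : ∀ i, Measurable (f i) := fun i => measurable_of_countable _
  rw [lintegral_map (by fun_prop) net.measurable_counts]
  refine (lintegral_prod_eq_prod_lintegral_of_indepFun _ (fun l ω => f l (net.count l ω))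
    (net.count_indep.comp f hf) fun l => (hf l).comp (net.count_measurable l)).trans ?_
  refine Finset.prod_congr rfl fun l _ => ?_
  rw [← net.count_law l, lintegral_map (hf l) (net.count_measurable l)]

theorem indepFun_mark_update (l : Option ℕ × ℕ) (m₀ : Mark) :
    IndepFun (net.mark l) (fun ω => Function.update (net.marks ω) l m₀) μ := by
  have h := indep_iSup_of_disjoint (fun l => (net.mark_measurable l).comap_le) net.mark_indep
    (S := {l}) (T := {l}ᶜ) disjoint_compl_right
  refine indep_of_indep_of_le_left (indep_of_indep_of_le_right h ?_) ?_
  · rw [← measurable_iff_comap_le]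
    refine @measurable_pi_lambda _ _ _ (_) _ _ fun l' => ?_
    by_cases hl : l' = l
    · subst hl; simp
    · simp only [Function.update_of_ne hl]
      refine Measurable.mono (comap_measurable (net.mark l')) ?_ le_rfl
      exact le_iSup₂_of_le l' hl le_rfl
  · exact le_iSup₂_of_le l rfl le_rfl

/-- Overwriting coordinate `l` by a constant leaves a function of the other marks alone, hence
independent of the mark at `l`, which can be integrated out separately. -/
theorem lintegral_marks_update [IsProbabilityMeasure μ] (l : Option ℕ × ℕ) (m₀ : Mark)
    {G : Mark × (Option ℕ × ℕ → Mark) → ℝ≥0∞} (hG : Measurable G) :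
    ∫⁻ x, G (x l, Function.update x l m₀) ∂(μ.map net.marks) =
      ∫⁻ x, ∫⁻ m, G (m, Function.update x l m₀) ∂S.markDist ∂(μ.map net.marks) := by
  have hup : Measurable fun x : Option ℕ × ℕ → Mark => Function.update x l m₀ :=
    measurable_update_left
  have hY : Measurable fun ω => Function.update (net.marks ω) l m₀ := hup.comp net.measurable_marks
  have := Measure.isProbabilityMeasure_map hY.aemeasurable (μ := μ)
  have e := (indepFun_iff_map_prod_eq_prod_map_map (net.mark_measurable l).aemeasurable
    hY.aemeasurable).1 (net.indepFun_mark_update l m₀)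
  rw [net.map_mark l] at e
  have h1 : ∫⁻ x, G (x l, Function.update x l m₀) ∂(μ.map net.marks) =
      ∫⁻ z, G z ∂(μ.map fun ω => (net.mark l ω, Function.update (net.marks ω) l m₀)) := by
    rw [lintegral_map (by fun_prop) net.measurable_marks,
      lintegral_map hG ((net.mark_measurable l).prodMk hY)]
    rfl
  have hG' : Measurable fun y => ∫⁻ m, G (m, y) ∂S.markDist := hG.lintegral_prod_left'
  rw [h1, e, lintegral_prod_symm' _ hG, lintegral_map hG' hY]
  exact (lintegral_map (hG'.comp hup) net.measurable_marks).symm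

/-! ### The law of the selection -/

theorem map_selection_singleton (p : ℕ × ℕ) : μ.map net.selection {p} =
    if p.2 < p.1 then S.number.typicalLaw {p.1} / (p.1 : ℝ≥0∞) else 0 := by
  rw [Measure.map_apply net.measurable_selection (measurableSet_singleton p),
    ← net.selection_law p.1 p.2]
  congr 1
  ext ω
  simp [selection, Prod.ext_iff]

/-- For each cluster size `m` the `m` possible selections have equal weight and leave `m - 1`
interferers, so their sum restores the weight of `m`. Size zero admits no selection, consistently
with `typicalLaw_zero`. -/
theorem lintegral_pow_selection {x : ℝ} (hx : 0 ≤ x) :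
    ∫⁻ p, ENNReal.ofReal x ^ ((Finset.range p.1).erase p.2).card ∂(μ.map net.selection) =
      ENNReal.ofReal (intraFactor S.number x) := by
  rw [lintegral_countable', ENNReal.tsum_prod', ← S.number.lintegral_pow_typicalLaw hx,
    lintegral_countable']
  refine tsum_congr fun m => ?_
  rw [tsum_eq_sum (s := Finset.range m)]
  · have h : ∀ k ∈ Finset.range m, ENNReal.ofReal x ^ ((Finset.range m).erase k).card *
        μ.map net.selection {(m, k)} =
        ENNReal.ofReal x ^ (m - 1) * (S.number.typicalLaw {m} / (m : ℝ≥0∞)) := by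
      intro k hk
      rw [map_selection_singleton, if_pos (Finset.mem_range.1 hk), Finset.card_erase_of_mem hk,
        Finset.card_range]
    rw [Finset.sum_congr rfl h, Finset.sum_const, Finset.card_range, nsmul_eq_mul]
    rcases Nat.eq_zero_or_pos m with rfl | hm
    · simp [S.number.typicalLaw_zero]
    · rw [mul_left_comm, ENNReal.mul_div_cancel (by exact_mod_cast hm.ne') (by simp)]
  · intro k hk
    rw [map_selection_singleton, if_neg (by simpa using hk), mul_zero]

end Network

namespace Network

variable {S : Setting} {Ω : Type*} [MeasurableSpace Ω] {μ : Measure Ω} (net : Network S μ)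

/-! ### Laplace transforms of the interference -/

theorem intra_eq (ω : Ω) : net.intra ω = S.intraSum (net.selection ω) (net.marks ω) := by
  simp only [intra, Setting.intraSum, Setting.userPower, zero_add]
  rfl

theorem inter_eq (ω : Ω) :
    net.inter ω = ∑' i, S.clusterSum i (net.uavs ω) (net.counts ω) (net.marks ω) := rfl

theorem measurable_intra : Measurable net.intra := by
  have h : Measurable fun ω => (net.selection ω, net.marks ω) :=
    net.measurable_selection.prodMk net.measurable_marks
  have h' := S.measurable_intraSum.comp h
  rw [funext net.intra_eq]
  exact h'

theorem measurable_clusterSum (i : ℕ) :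
    Measurable fun ω => S.clusterSum i (net.uavs ω) (net.counts ω) (net.marks ω) := by
  have h : Measurable fun ω => (net.uavs ω, net.counts ω, net.marks ω) :=
    net.measurable_uavs.prodMk (net.measurable_counts.prodMk net.measurable_marks)
  have h' := (S.measurable_clusterSum i).comp h
  exact h'

theorem measurable_inter : Measurable net.inter := by
  have h : Measurable fun ω =>
      ∑' i, S.clusterSum i (net.uavs ω) (net.counts ω) (net.marks ω) :=
    Measurable.tsum net.measurable_clusterSum
  rw [funext net.inter_eq]
  exact h

/-- With positions, selection and counts frozen, the exponential is a product over finitely many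
distinct users of functions of their independent marks: `A` indexes the own cluster, `B` the first
`n` others. -/
theorem lintegral_marks_lexp (s t : ℝ) (n : ℕ) (v : ℕ → Plane) (p : ℕ × ℕ) (c : ℕ → ℕ) :
    ∫⁻ x, lexp (ENNReal.ofReal s * S.intraSum p x +
        ENNReal.ofReal t * ∑ i ∈ Finset.range n, S.clusterSum i v c x) ∂(μ.map net.marks) =
      S.userLaplace s 0 ^ ((Finset.range p.1).erase p.2).card *
        ∏ i ∈ Finset.range n, S.userLaplace t (v i) ^ c i := by
  set f : Option ℕ × ℕ → Mark → ℝ≥0∞ := fun l m =>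
    match l.1 with
    | none => lexp (ENNReal.ofReal s * S.userPower 0 m)
    | some i => lexp (ENNReal.ofReal t * S.userPower (v i) m) with hf
  have hpow : ∀ (r : ℝ) (u : Plane), Measurable fun m : Mark =>
      lexp (ENNReal.ofReal r * S.userPower u m) := fun r u =>
    measurable_lexp.comp ((S.measurable_userPower.comp measurable_prodMk_left).const_mul _)
  have hfm : ∀ l, Measurable (f l) := by
    rintro ⟨_ | i, j⟩
    · exact hpow s 0
    · exact hpow t (v i)
  set A : Finset (Option ℕ × ℕ) := ((Finset.range p.1).erase p.2).map
    ⟨fun j => (none, j), fun _ _ h => (Prod.ext_iff.1 h).2⟩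
  set B : Finset (Option ℕ × ℕ) := ((Finset.range n).sigma fun i => Finset.range (c i)).map
    ⟨fun q => (some q.1, q.2), by
      rintro ⟨i, j⟩ ⟨i', j'⟩ h
      simp only [Prod.mk.injEq, Option.some.injEq] at h
      obtain ⟨rfl, rfl⟩ := h
      rfl⟩
  have hAB : Disjoint A B := by
    rw [Finset.disjoint_left]
    intro l hA hB
    obtain ⟨j, _, rfl⟩ := Finset.mem_map.1 hA
    obtain ⟨q, _, hq⟩ := Finset.mem_map.1 hB
    exact Option.some_ne_none _ (Prod.ext_iff.1 hq).1
  have h1 : ∀ x : Option ℕ × ℕ → Mark, lexp (ENNReal.ofReal s * S.intraSum p x +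
      ENNReal.ofReal t * ∑ i ∈ Finset.range n, S.clusterSum i v c x) =
      ∏ l ∈ A ∪ B, f l (x l) := by
    intro x
    rw [Finset.prod_union hAB, lexp_add, Finset.prod_map, Finset.prod_map, Finset.prod_sigma,
      Setting.intraSum, Finset.mul_sum, Finset.mul_sum, lexp_sum, lexp_sum]
    congr 1
    refine Finset.prod_congr rfl fun i _ => ?_
    rw [Setting.clusterSum, Finset.mul_sum, lexp_sum]
    rfl
  simp_rw [h1]
  rw [net.lintegral_marks_prod _ hfm, Finset.prod_union hAB, Finset.prod_map, Finset.prod_map,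
    Finset.prod_sigma]
  congr 1
  · exact Finset.prod_eq_pow_card fun j _ => rfl
  · refine Finset.prod_congr rfl fun i _ => ?_
    refine (Finset.prod_eq_pow_card (b := S.userLaplace t (v i)) fun j _ => rfl).trans ?_
    rw [Finset.card_range]

/-- Truncation to `n` clusters keeps all products finite, so marks, counts and selection can be
integrated out in turn. Only the positions of the UAVs remain. -/
theorem lintegral_lexp_truncated [IsProbabilityMeasure μ] {s : ℝ} (hs : 0 ≤ s) (t : ℝ) (n : ℕ) :
    ∫⁻ ω, lexp (ENNReal.ofReal s * net.intra ω + ENNReal.ofReal t *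
        ∑ i ∈ Finset.range n, S.clusterSum i (net.uavs ω) (net.counts ω) (net.marks ω)) ∂μ =
      ENNReal.ofReal (S.La s) *
        ∫⁻ ω, ∏ i ∈ Finset.range n, ENNReal.ofReal (S.clusterLaplace t (net.uav i ω)) ∂μ := by
  have hG : Measurable fun z : (ℕ → Plane) × (ℕ × ℕ) × (ℕ → ℕ) × (Option ℕ × ℕ → Mark) =>
      lexp (ENNReal.ofReal s * S.intraSum z.2.1 z.2.2.2 + ENNReal.ofReal t *
        ∑ i ∈ Finset.range n, S.clusterSum i z.1 z.2.2.1 z.2.2.2) := by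
    have h1 := S.measurable_intraSum.comp
      (f := fun z : (ℕ → Plane) × (ℕ × ℕ) × (ℕ → ℕ) × (Option ℕ × ℕ → Mark) => (z.2.1, z.2.2.2))
      (by fun_prop)
    have h2 := fun i => (S.measurable_clusterSum i).comp
      (f := fun z : (ℕ → Plane) × (ℕ × ℕ) × (ℕ → ℕ) × (Option ℕ × ℕ → Mark) =>
        (z.1, z.2.2.1, z.2.2.2)) (by fun_prop)
    exact measurable_lexp.comp ((h1.const_mul _).add
      ((Finset.measurable_fun_sum _ fun i _ => h2 i).const_mul _))
  have hL := S.measurable_clusterLaplace t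
  simp_rw [net.intra_eq]
  rw [net.lintegral_eq_iterated hG]
  simp_rw [lintegral_marks_lexp]
  have h1 : ∀ (v : ℕ → Plane) (p : ℕ × ℕ), ∫⁻ c, S.userLaplace s 0 ^
      ((Finset.range p.1).erase p.2).card * ∏ i ∈ Finset.range n, S.userLaplace t (v i) ^ c i
      ∂(μ.map net.counts) = S.userLaplace s 0 ^ ((Finset.range p.1).erase p.2).card *
        ∏ i ∈ Finset.range n, ENNReal.ofReal (S.clusterLaplace t (v i)) := by
    intro v p
    rw [lintegral_const_mul' _ _ (ENNReal.pow_ne_top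
      (ne_top_of_le_ne_top ENNReal.one_ne_top (S.userLaplace_le_one s 0))),
      net.lintegral_counts_prod n fun i k => S.userLaplace t (v i) ^ k]
    simp_rw [S.lintegral_pow_userLaplace]
  simp_rw [h1]
  have h2 : ∀ v : ℕ → Plane, ∫⁻ p, S.userLaplace s 0 ^
      ((Finset.range p.1).erase p.2).card *
        ∏ i ∈ Finset.range n, ENNReal.ofReal (S.clusterLaplace t (v i)) ∂(μ.map net.selection) =
      ENNReal.ofReal (S.La s) *
        ∏ i ∈ Finset.range n, ENNReal.ofReal (S.clusterLaplace t (v i)) := by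
    intro v
    rw [lintegral_mul_const _ (measurable_of_countable _), S.userLaplace_zero hs,
      net.lintegral_pow_selection (S.Oa_pos hs).le, S.La_eq]
  simp_rw [h2]
  rw [lintegral_const_mul' _ _ ENNReal.ofReal_ne_top, lintegral_map (by fun_prop)
    net.measurable_uavs]
  rfl

theorem lintegral_lexp_interference [IsProbabilityMeasure μ] {s t : ℝ} (hs : 0 ≤ s)
    (ht : 0 ≤ t) :
    ∫⁻ ω, lexp (ENNReal.ofReal s * net.intra ω + ENNReal.ofReal t * net.inter ω) ∂μ =
      ENNReal.ofReal (S.La s) * ENNReal.ofReal (S.Le t) := by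
  have hL := S.measurable_clusterLaplace t
  -- With this `f` the product of cluster factors is `lexp` of a sum over the points, which is the
  -- form required by `lintegral_lexp_tsum`.
  set f : Plane → ℝ≥0∞ := fun v => ENNReal.ofReal (-Real.log (S.clusterLaplace t v)) with hfdef
  have hfm : Measurable f := by fun_prop
  have hf : ∀ v, ENNReal.ofReal (S.clusterLaplace t v) = lexp (f v) := by
    intro v
    rw [hfdef, lexp_ofReal (neg_nonneg.2 (Real.log_nonpos (S.clusterLaplace_pos t v).le
      (S.clusterLaplace_le_one t v))), neg_neg, Real.exp_log (S.clusterLaplace_pos t v)]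
  have hleft : Filter.Tendsto (fun n => ∫⁻ ω, lexp (ENNReal.ofReal s * net.intra ω +
      ENNReal.ofReal t * ∑ i ∈ Finset.range n,
        S.clusterSum i (net.uavs ω) (net.counts ω) (net.marks ω)) ∂μ) Filter.atTop
      (nhds (∫⁻ ω, lexp (ENNReal.ofReal s * net.intra ω + ENNReal.ofReal t * net.inter ω) ∂μ)) := by
    refine tendsto_lintegral_of_dominated_convergence (fun _ => 1) (fun n => ?_)
      (fun n => Filter.Eventually.of_forall fun ω => lexp_le_one _) (by simp)
      (Filter.Eventually.of_forall fun ω => ?_)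
    · exact measurable_lexp.comp ((net.measurable_intra.const_mul _).add
        ((Finset.measurable_fun_sum _ fun i _ => net.measurable_clusterSum i).const_mul _))
    · refine (continuous_lexp.tendsto _).comp (tendsto_const_nhds.add
        (ENNReal.Tendsto.const_mul ?_ (Or.inr ENNReal.ofReal_ne_top)))
      exact ENNReal.summable.hasSum.tendsto_sum_nat
  have hright : Filter.Tendsto (fun n => ENNReal.ofReal (S.La s) *
      ∫⁻ ω, ∏ i ∈ Finset.range n, ENNReal.ofReal (S.clusterLaplace t (net.uav i ω)) ∂μ)
      Filter.atTop (nhds (ENNReal.ofReal (S.La s) * ENNReal.ofReal (S.Le t))) := by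
    refine ENNReal.Tendsto.const_mul ?_ (Or.inr ENNReal.ofReal_ne_top)
    have h1 : ENNReal.ofReal (S.Le t) = ∫⁻ ω, lexp (∑' i, f (net.uav i ω)) ∂μ := by
      rw [lintegral_lexp_tsum net.uav_poisson hfm, S.Le_eq ht]
      simp_rw [← hf]
      congr 2
      refine lintegral_congr fun v => ?_
      rw [ENNReal.ofReal_sub _ (S.clusterLaplace_pos t v).le, ENNReal.ofReal_one]
    rw [h1]
    simp_rw [hf, ← lexp_sum]
    refine tendsto_lintegral_of_dominated_convergence (fun _ => 1) (fun n => ?_)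
      (fun n => Filter.Eventually.of_forall fun ω => lexp_le_one _) (by simp)
      (Filter.Eventually.of_forall fun ω => ?_)
    · exact measurable_lexp.comp (Finset.measurable_fun_sum _ fun i _ =>
        hfm.comp (net.uav_poisson.measurable i))
    · exact (continuous_lexp.tendsto _).comp ENNReal.summable.hasSum.tendsto_sum_nat
  refine tendsto_nhds_unique hleft (hright.congr fun n => ?_)
  exact (net.lintegral_lexp_truncated hs t n).symm

/-! ### Independence of the desired link from the interference -/

theorem lintegral_mark₀_interference [IsProbabilityMeasure μ] {G : Mark × ℝ≥0∞ → ℝ≥0∞}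
    (hG : Measurable G) :
    ∫⁻ ω, G (net.mark₀ ω, net.intra ω + net.inter ω) ∂μ =
      ∫⁻ ω, ∫⁻ m, G (m, net.intra ω + net.inter ω) ∂S.markDist ∂μ := by
  set I : (ℕ → Plane) × (ℕ × ℕ) × (ℕ → ℕ) × (Option ℕ × ℕ → Mark) → ℝ≥0∞ := fun z =>
    S.intraSum z.2.1 z.2.2.2 + ∑' i, S.clusterSum i z.1 z.2.2.1 z.2.2.2 with hI
  have hIm : Measurable I :=
    (S.measurable_intraSum.comp
      (f := fun z : (ℕ → Plane) × (ℕ × ℕ) × (ℕ → ℕ) × (Option ℕ × ℕ → Mark) => (z.2.1, z.2.2.2))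
      (by fun_prop)).add (Measurable.tsum fun i => (S.measurable_clusterSum i).comp
      (f := fun z : (ℕ → Plane) × (ℕ × ℕ) × (ℕ → ℕ) × (Option ℕ × ℕ → Mark) =>
        (z.1, z.2.2.1, z.2.2.2)) (by fun_prop))
  have hIω : ∀ ω, net.intra ω + net.inter ω =
      I (net.uavs ω, net.selection ω, net.counts ω, net.marks ω) := by
    intro ω; rw [net.intra_eq, net.inter_eq]
  have hIup : ∀ (v : ℕ → Plane) (p : ℕ × ℕ) (c : ℕ → ℕ) (x : Option ℕ × ℕ → Mark) (m : Mark),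
      I (v, p, c, Function.update x (none, p.2) m) = I (v, p, c, x) := by
    intro v p c x m
    simp only [hI, S.intraSum_update, S.clusterSum_update]
  have hG' : Measurable fun y => ∫⁻ m, G (m, y) ∂S.markDist := hG.lintegral_prod_left'
  have hsel : Measurable fun z : (ℕ → Plane) × (ℕ × ℕ) × (ℕ → ℕ) × (Option ℕ × ℕ → Mark) =>
      z.2.2.2 (none, z.2.1.2) := by
    have h : Measurable fun z : (Option ℕ × ℕ → Mark) × ℕ => z.1 (none, z.2) :=
      measurable_from_prod_countable_left fun k => by
        simp only
        fun_prop
    exact h.comp (f := fun z : (ℕ → Plane) × (ℕ × ℕ) × (ℕ → ℕ) × (Option ℕ × ℕ → Mark) =>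
      (z.2.2.2, z.2.1.2)) (by fun_prop)
  simp_rw [hIω]
  rw [net.lintegral_eq_iterated (G := fun z => ∫⁻ m, G (m, I z) ∂S.markDist) (hG'.comp hIm)]
  refine (net.lintegral_eq_iterated (G := fun z => G (z.2.2.2 (none, z.2.1.2), I z))
    (hG.comp (hsel.prodMk hIm))).trans ?_
  refine lintegral_congr fun v => lintegral_congr fun p => lintegral_congr fun c => ?_
  -- Once the selection is frozen, the desired mark has a deterministic index. The value
  -- `Mark.ofProd 0` is an arbitrary filler, irrelevant by `hIup`.
  have h := net.lintegral_marks_update (none, p.2) (Mark.ofProd 0)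
    (G := fun z => G (z.1, I (v, p, c, z.2))) (hG.comp (by fun_prop))
  simpa only [hIup] using h

end Network

namespace Setting

variable (S : Setting)

/-! ### The tail of the desired fading power and its approximation -/

theorem La_nonneg {s : ℝ} (hs : 0 ≤ s) : 0 ≤ S.La s := by
  rw [S.La_eq]
  have := (S.Oa_pos hs).le
  cases S.number <;> unfold intraFactor <;> positivity

theorem La_le_one {s : ℝ} (hs : 0 ≤ s) : S.La s ≤ 1 := by
  have h0 := (S.Oa_pos hs).le
  have h1 : S.Oa s ≤ 1 := by
    have := S.userLaplace_le_one s 0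
    rwa [S.userLaplace_zero hs, ← ENNReal.ofReal_one,
      ENNReal.ofReal_le_ofReal_iff zero_le_one] at this
  rw [S.La_eq]
  cases S.number with
  | fixed N hN => exact pow_le_one₀ h0 h1
  | random n hn =>
    exact Real.exp_le_one_iff.2 (neg_nonpos.2 (mul_nonneg (by linarith) (by linarith)))

theorem Le_nonneg (s : ℝ) : 0 ≤ S.Le s := expNeg_nonneg _

theorem Le_le_one (s : ℝ) : S.Le s ≤ 1 := expNeg_le_one _

theorem eta_eq (κ : Link) : S.eta κ = tailRate (S.Nak κ) := rfl

theorem eta_pos (κ : Link) : 0 < S.eta κ := tailRate_pos (S.Nak_pos κ)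

theorem signalScale_eq (κ : Link) (w : ℝ) :
    S.signalScale κ w = S.gainValue 0 * S.pathLoss κ w := by
  have hd := S.dh_pos
  have h : 0 ≤ w ^ 2 + S.dh ^ 2 := by positivity
  rw [signalScale, pathLoss, Real.sqrt_eq_rpow, ← Real.rpow_mul h, Real.rpow_neg h]
  rw [show S.alpha κ * (1 / 2) = S.alpha κ / 2 by ring]
  ring

theorem signalScale_pos (κ : Link) (w : ℝ) : 0 < S.signalScale κ w := by
  rw [S.signalScale_eq]; exact mul_pos S.gainValue_zero_pos (S.pathLoss_pos κ w)

theorem approxTail_nonneg (κ : Link) (x : ℝ≥0∞) : 0 ≤ S.approxTail κ x := by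
  have h1 := expNeg_nonneg (ENNReal.ofReal (S.eta κ) * x)
  have h2 := expNeg_le_one (ENNReal.ofReal (S.eta κ) * x)
  exact sub_nonneg.2 (pow_le_one₀ (by linarith) (by linarith))

theorem approxTail_le_one (κ : Link) (x : ℝ≥0∞) : S.approxTail κ x ≤ 1 := by
  have h2 := expNeg_le_one (ENNReal.ofReal (S.eta κ) * x)
  exact sub_le_self _ (pow_nonneg (by linarith) _)

@[fun_prop]
theorem measurable_approxTail (κ : Link) : Measurable (S.approxTail κ) := by
  unfold approxTail; fun_prop

theorem approxTail_top (κ : Link) : S.approxTail κ ∞ = 0 := by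
  rw [approxTail, ENNReal.mul_top (ENNReal.ofReal_pos.2 (S.eta_pos κ)).ne', expNeg_top]
  simp

theorem approxTail_of_ne_top (κ : Link) {x : ℝ≥0∞} (hx : x ≠ ∞) :
    S.approxTail κ x = 1 - (1 - Real.exp (-(S.eta κ * x.toReal))) ^ S.Nak κ := by
  have h : ENNReal.ofReal (S.eta κ) * x = ENNReal.ofReal (S.eta κ * x.toReal) := by
    rw [ENNReal.ofReal_mul (S.eta_pos κ).le, ENNReal.ofReal_toReal hx]
  rw [approxTail, h, expNeg_ofReal (mul_nonneg (S.eta_pos κ).le ENNReal.toReal_nonneg)]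

/-- The probability that the fading power in state `κ` exceeds `x`. -/
def fadingTail (κ : Link) (x : ℝ≥0∞) : ℝ≥0∞ :=
  gammaMeasure (S.Nak κ) (S.Nak κ) {b | x < ENNReal.ofReal b}

@[fun_prop]
theorem measurable_fadingTail (κ : Link) : Measurable (S.fadingTail κ) := by
  refine Antitone.measurable fun x y h => measure_mono fun b hb => ?_
  exact lt_of_le_of_lt h hb

theorem fadingTail_le_one (κ : Link) (x : ℝ≥0∞) : S.fadingTail κ x ≤ 1 := prob_le_one

theorem fadingTail_top (κ : Link) : S.fadingTail κ ∞ = 0 := by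
  have : {b : ℝ | (∞ : ℝ≥0∞) < ENNReal.ofReal b} = ∅ := by ext; simp
  rw [fadingTail, this, measure_empty]

theorem fadingTail_of_ne_top (κ : Link) {x : ℝ≥0∞} (hx : x ≠ ∞) :
    (S.fadingTail κ x).toReal =
      (gammaMeasure (S.Nak κ) (S.Nak κ)).real (Set.Ioi x.toReal) := by
  have : {b : ℝ | x < ENNReal.ofReal b} = Set.Ioi x.toReal := by
    ext b; exact ENNReal.lt_ofReal_iff_toReal_lt hx
  rw [fadingTail, this]; rfl

theorem fadingTail_le_approxTail (κ : Link) (x : ℝ≥0∞) :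
    (S.fadingTail κ x).toReal ≤ S.approxTail κ x := by
  by_cases hx : x = ∞
  · simp [hx, S.fadingTail_top, S.approxTail_top]
  · rw [S.fadingTail_of_ne_top κ hx, S.approxTail_of_ne_top κ hx]
    exact gammaMeasure_real_Ioi_le (S.Nak_pos κ) ENNReal.toReal_nonneg

theorem fadingTail_eq_approxTail (κ : Link) (hκ : S.Nak κ = 1) (x : ℝ≥0∞) :
    (S.fadingTail κ x).toReal = S.approxTail κ x := by
  by_cases hx : x = ∞
  · simp [hx, S.fadingTail_top, S.approxTail_top]
  · rw [S.fadingTail_of_ne_top κ hx, S.approxTail_of_ne_top κ hx, S.eta_eq, hκ]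
    simp [gammaMeasure_one_real_Ioi ENNReal.toReal_nonneg, tailRate]

/-- The fading level that a desired link in state `κ` at distance `w` has to exceed, if the
interference is `y`. -/
def fadingLevel (T : ℝ) (κ : Link) (w : ℝ) (y : ℝ≥0∞) : ℝ≥0∞ :=
  ENNReal.ofReal (T / (S.gainValue 0 * S.pathLoss κ w)) * (y + ENNReal.ofReal (S.noise / S.Pu))

theorem measurable_fadingLevel (T : ℝ) (κ : Link) :
    Measurable fun p : ℝ × ℝ≥0∞ => S.fadingLevel T κ p.1 p.2 := by
  unfold fadingLevel; fun_prop

/-- Positive noise excludes a zero denominator. If the interference is infinite, the ratio is zero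
and the level is `∞`, so both sides are false. -/
theorem lt_div_iff_fadingLevel_lt {T : ℝ} (hT : 0 < T) (κ : Link) (w : ℝ) (y : ℝ≥0∞) (b : ℝ) :
    ENNReal.ofReal T < ENNReal.ofReal (S.pathLoss κ w * S.gainValue 0 * b) /
        (y + ENNReal.ofReal (S.noise / S.Pu)) ↔
      S.fadingLevel T κ w y < ENNReal.ofReal b := by
  have hc : 0 < S.gainValue 0 * S.pathLoss κ w := mul_pos S.gainValue_zero_pos (S.pathLoss_pos κ w)
  have hn : 0 < S.noise / S.Pu := div_pos S.noise_pos S.Pu_pos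
  unfold fadingLevel
  set z := y + ENNReal.ofReal (S.noise / S.Pu) with hz
  have hz0 : z ≠ 0 := by
    rw [hz]; simp [hn]
  by_cases hzt : z = ∞
  · rw [hzt, ENNReal.mul_top (ENNReal.ofReal_pos.2 (div_pos hT hc)).ne']
    simp
  · rw [ENNReal.lt_div_iff_mul_lt (Or.inl hz0) (Or.inl hzt), mul_comm (S.pathLoss κ w),
      ENNReal.ofReal_mul hc.le]
    have h1 : ENNReal.ofReal T * z = ENNReal.ofReal (S.gainValue 0 * S.pathLoss κ w) *
        (ENNReal.ofReal (T / (S.gainValue 0 * S.pathLoss κ w)) * z) := by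
      rw [← mul_assoc, ← ENNReal.ofReal_mul hc.le, mul_div_cancel₀ _ hc.ne']
    rw [h1, ENNReal.mul_lt_mul_iff_right (ENNReal.ofReal_pos.2 hc).ne' ENNReal.ofReal_ne_top]

end Setting

theorem one_sub_one_sub_pow (N : ℕ) (y : ℝ) :
    1 - (1 - y) ^ N = ∑ n ∈ Finset.Icc 1 N, (-1) ^ (n + 1) * (N.choose n : ℝ) * y ^ n := by
  have h : Finset.Icc 1 N = Finset.Ico 1 (N + 1) := by ext; simp
  have h2 : (1 - y) ^ N =
      ∑ m ∈ Finset.Ico 0 (N + 1), (-y) ^ m * 1 ^ (N - m) * (N.choose m : ℝ) := by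
    rw [← Finset.range_eq_Ico, ← add_pow]; ring
  rw [h2, Finset.sum_eq_sum_Ico_succ_bot (Nat.succ_pos N), h]
  simp only [zero_add, pow_zero, Nat.choose_zero_right, one_pow, mul_one, Nat.cast_one]
  rw [sub_add_cancel_left, ← Finset.sum_neg_distrib]
  refine Finset.sum_congr rfl fun n _ => ?_
  rw [neg_pow y n]; ring

/-! ### The coverage probability as a mean of gamma tails. -/

namespace Network

variable {S : Setting} {Ω : Type*} [MeasurableSpace Ω] {μ : Measure Ω} (net : Network S μ)

/-- The total interference. -/
def interference (ω : Ω) : ℝ≥0∞ := net.intra ω + net.inter ω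

theorem measurable_interference : Measurable net.interference :=
  net.measurable_intra.add net.measurable_inter

theorem measurable_mark₀ : Measurable net.mark₀ := by
  have h : Measurable fun z : (Option ℕ × ℕ → Mark) × ℕ => z.1 (none, z.2) :=
    measurable_from_prod_countable_left fun k => by
      simp only
      fun_prop
  have h' := h.comp (net.measurable_marks.prodMk net.selected_measurable)
  exact h'

theorem measurable_tail_level (T : ℝ) {β : Type*} [MeasurableSpace β] {A : Link → ℝ≥0∞ → β}
    (hA : ∀ κ, Measurable (A κ)) : Measurable fun ω => A (net.state₀ ω) (net.level T ω) := by
  have h0 := net.measurable_mark₀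
  refine S.measurable_linkState_apply (r := fun ω => ‖(net.mark₀ ω).offset‖) (m := net.mark₀)
    (Ψ := fun κ ω => A κ (S.fadingLevel T κ ‖(net.mark₀ ω).offset‖ (net.interference ω)))
    (by fun_prop) h0 fun κ => (hA κ).comp ?_
  have h2 : Measurable fun ω => (‖(net.mark₀ ω).offset‖, net.interference ω) :=
    Measurable.prodMk (by fun_prop) net.measurable_interference
  have h3 := (S.measurable_fadingLevel T κ).comp h2
  exact h3

/-- The desired mark is integrated out with the interference frozen. The statement is kept general
in `A` so that it serves both the exact and the approximate tail. -/
theorem lintegral_tail_level [IsProbabilityMeasure μ] (T : ℝ) {A : Link → ℝ≥0∞ → ℝ≥0∞}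
    (hA : ∀ κ, Measurable (A κ)) :
    ∫⁻ ω, A (net.state₀ ω) (net.level T ω) ∂μ =
      ∫⁻ ω, ∫⁻ u, ∑ κ, ENNReal.ofReal (S.linkProb κ (S.cellIndex ‖u‖)) *
        A κ (S.fadingLevel T κ ‖u‖ (net.interference ω)) ∂S.shape.law ∂μ := by
  have hAm : ∀ κ, Measurable fun p : Mark × ℝ≥0∞ => A κ (S.fadingLevel T κ ‖p.1.offset‖ p.2) := by
    intro κ
    have h2 : Measurable fun p : Mark × ℝ≥0∞ => (‖p.1.offset‖, p.2) := by fun_prop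
    have h3 := (hA κ).comp ((S.measurable_fadingLevel T κ).comp h2)
    exact h3
  have hG : Measurable fun p : Mark × ℝ≥0∞ => A (S.linkState ‖p.1.offset‖ p.1)
      (S.fadingLevel T (S.linkState ‖p.1.offset‖ p.1) ‖p.1.offset‖ p.2) :=
    S.measurable_linkState_apply (r := fun p : Mark × ℝ≥0∞ => ‖p.1.offset‖) (m := Prod.fst)
      (Ψ := fun κ p => A κ (S.fadingLevel T κ ‖p.1.offset‖ p.2)) (by fun_prop) measurable_fst hAm
  refine (net.lintegral_mark₀_interference hG).trans (lintegral_congr fun ω => ?_)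
  have hΨ : ∀ κ, Measurable fun p : Plane × ℝ × (Link → ℝ) =>
      A κ (S.fadingLevel T κ ‖p.1‖ (net.interference ω)) := by
    intro κ
    have h2 : Measurable fun p : Plane × ℝ × (Link → ℝ) => (‖p.1‖, net.interference ω) := by
      fun_prop
    have h3 := (hA κ).comp ((S.measurable_fadingLevel T κ).comp h2)
    exact h3
  have h := S.lintegral_markDist 0
    (Ψ := fun κ p => A κ (S.fadingLevel T κ ‖p.1‖ (net.interference ω))) hΨ
  simp only [zero_add, lintegral_const, measure_univ, mul_one] at h
  exact h

/-- Given interference, position and state, the only randomness left in the event is the fading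
power, whose conditional probability of exceeding the level is `fadingTail`. -/
theorem measure_lt_sinr [IsProbabilityMeasure μ] {T : ℝ} (hT : 0 < T) :
    μ {ω | ENNReal.ofReal T < net.sinr ω} =
      ∫⁻ ω, S.fadingTail (net.state₀ ω) (net.level T ω) ∂μ := by
  rw [net.lintegral_tail_level T S.measurable_fadingTail]
  have hdes : Measurable fun m : Mark => S.desiredGain m.offset m :=
    S.measurable_linkState_apply (r := fun m : Mark => ‖m.offset‖) (m := id)
      (Ψ := fun κ m => S.pathLoss κ ‖m.offset‖ * S.gainValue 0 * m.fading κ) (by fun_prop)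
      measurable_id fun κ => by fun_prop
  set E : Set (Mark × ℝ≥0∞) := {p | ENNReal.ofReal T < ENNReal.ofReal
    (S.desiredGain p.1.offset p.1) / (p.2 + ENNReal.ofReal (S.noise / S.Pu))} with hE
  have hEm : MeasurableSet E := measurableSet_lt measurable_const
    (((hdes.comp measurable_fst).ennreal_ofReal).div (measurable_snd.add_const _))
  have hG : Measurable (E.indicator fun _ => (1 : ℝ≥0∞)) := measurable_const.indicator hEm
  have hpair : Measurable fun ω => (net.mark₀ ω, net.intra ω + net.inter ω) :=
    net.measurable_mark₀.prodMk net.measurable_interference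
  have h1 : μ {ω | ENNReal.ofReal T < net.sinr ω} =
      ∫⁻ ω, E.indicator (fun _ => 1) (net.mark₀ ω, net.intra ω + net.inter ω) ∂μ := by
    rw [← lintegral_map hG hpair]
    exact ((lintegral_indicator_one hEm).trans (Measure.map_apply hpair hEm)).symm
  rw [h1, net.lintegral_mark₀_interference hG]
  refine lintegral_congr fun ω => ?_
  have hset : ∀ κ, MeasurableSet {p : Plane × ℝ × (Link → ℝ) | ENNReal.ofReal T <
      ENNReal.ofReal (S.pathLoss κ ‖p.1‖ * S.gainValue 0 * p.2.2 κ) /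
        (net.intra ω + net.inter ω + ENNReal.ofReal (S.noise / S.Pu))} := fun κ =>
    measurableSet_lt measurable_const (by fun_prop)
  have h2 := S.lintegral_markDist 0 (Ψ := fun κ => {p : Plane × ℝ × (Link → ℝ) |
    ENNReal.ofReal T < ENNReal.ofReal (S.pathLoss κ ‖p.1‖ * S.gainValue 0 * p.2.2 κ) /
      (net.intra ω + net.inter ω + ENNReal.ofReal (S.noise / S.Pu))}.indicator fun _ => 1)
    fun κ => measurable_const.indicator (hset κ)
  simp only [zero_add] at h2
  refine Eq.trans ?_ (h2.trans (lintegral_congr fun u => Finset.sum_congr rfl fun κ _ => ?_))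
  · rfl
  · congr 1
    have h3 : ∀ (a : ℝ) (b : Link → ℝ), {p : Plane × ℝ × (Link → ℝ) |
        ENNReal.ofReal T < ENNReal.ofReal (S.pathLoss κ ‖p.1‖ * S.gainValue 0 * p.2.2 κ) /
        (net.intra ω + net.inter ω + ENNReal.ofReal (S.noise / S.Pu))}.indicator
          (fun _ => (1 : ℝ≥0∞)) (u, a, b) =
        {x : ℝ | S.fadingLevel T κ ‖u‖ (net.interference ω) < ENNReal.ofReal x}.indicator
          (fun _ => 1) (b κ) := by
      intro a b
      have := S.lt_div_iff_fadingLevel_lt hT κ ‖u‖ (net.interference ω) (b κ)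
      simp only [Set.indicator, Set.mem_ofPred_eq]
      exact if_congr this rfl rfl
    simp_rw [h3]
    have hms : MeasurableSet {x : ℝ | S.fadingLevel T κ ‖u‖ (net.interference ω) <
        ENNReal.ofReal x} := measurableSet_lt measurable_const (by fun_prop)
    rw [S.lintegral_fadingLaw κ (measurable_const.indicator hms)]
    simp only [lintegral_const, measure_univ, mul_one]
    exact lintegral_indicator_one hms

theorem integrable_approxTail_level [IsProbabilityMeasure μ] (T : ℝ) :
    Integrable (fun ω => S.approxTail (net.state₀ ω) (net.level T ω)) μ := by
  refine Integrable.of_bound (net.measurable_tail_level T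
    S.measurable_approxTail).aestronglyMeasurable 1 (Filter.Eventually.of_forall fun ω => ?_)
  rw [Real.norm_of_nonneg (S.approxTail_nonneg _ _)]
  exact S.approxTail_le_one _ _

theorem integrable_fadingTail_level [IsProbabilityMeasure μ] (T : ℝ) :
    Integrable (fun ω => (S.fadingTail (net.state₀ ω) (net.level T ω)).toReal) μ := by
  refine Integrable.of_bound (net.measurable_tail_level T
    S.measurable_fadingTail).ennreal_toReal.aestronglyMeasurable 1
    (Filter.Eventually.of_forall fun ω => ?_)
  rw [Real.norm_of_nonneg ENNReal.toReal_nonneg]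
  exact ENNReal.toReal_le_of_le_ofReal zero_le_one (by simpa using S.fadingTail_le_one _ _)

theorem coverage_eq [IsProbabilityMeasure μ] {T : ℝ} (hT : 0 < T) :
    net.coverage T = ∫ ω, (S.fadingTail (net.state₀ ω) (net.level T ω)).toReal ∂μ := by
  rw [coverage, measureReal_def, net.measure_lt_sinr hT, integral_toReal]
  · exact (net.measurable_tail_level T S.measurable_fadingTail).aemeasurable
  · exact Filter.Eventually.of_forall fun ω => (S.fadingTail_le_one _ _).trans_lt
      ENNReal.one_lt_top

end Network

namespace Network

variable {S : Setting} {Ω : Type*} [MeasurableSpace Ω] {μ : Measure Ω} (net : Network S μ)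

/-! ### The analytical expression -/

/-- The joint transform at zero shows that the product of the two values is one, and both lie in
`[0, 1]`. The marginal transforms then follow by setting one argument of the joint transform to
zero. -/
theorem laplace_zero (net : Network S μ) [IsProbabilityMeasure μ] : S.La 0 = 1 ∧ S.Le 0 = 1 := by
  have h := net.lintegral_lexp_interference le_rfl le_rfl
  simp only [ENNReal.ofReal_zero, zero_mul, add_zero, lexp_zero, lintegral_one, measure_univ] at h
  have ha := S.La_nonneg le_rfl
  have ha1 := S.La_le_one le_rfl
  have he := S.Le_nonneg 0
  have he1 := S.Le_le_one 0
  rw [← ENNReal.ofReal_mul ha, eq_comm, ENNReal.ofReal_eq_one] at h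
  constructor <;> nlinarith

theorem integral_expNeg_intra [IsProbabilityMeasure μ] {s : ℝ} (hs : 0 ≤ s) :
    ∫ ω, expNeg (ENNReal.ofReal s * net.intra ω) ∂μ = S.La s := by
  rw [integral_expNeg (net.measurable_intra.const_mul _).aemeasurable]
  have h := net.lintegral_lexp_interference hs le_rfl
  simp only [ENNReal.ofReal_zero, zero_mul, add_zero, net.laplace_zero.2, ENNReal.ofReal_one,
    mul_one] at h
  rw [h, ENNReal.toReal_ofReal (S.La_nonneg hs)]

theorem integral_expNeg_inter [IsProbabilityMeasure μ] {s : ℝ} (hs : 0 ≤ s) :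
    ∫ ω, expNeg (ENNReal.ofReal s * net.inter ω) ∂μ = S.Le s := by
  rw [integral_expNeg (net.measurable_inter.const_mul _).aemeasurable]
  have h := net.lintegral_lexp_interference le_rfl hs
  simp only [ENNReal.ofReal_zero, zero_mul, zero_add, net.laplace_zero.1, ENNReal.ofReal_one,
    one_mul] at h
  rw [h, ENNReal.toReal_ofReal (S.Le_nonneg s)]

theorem integral_expNeg_interference [IsProbabilityMeasure μ] {s : ℝ} (hs : 0 ≤ s) :
    ∫ ω, expNeg (ENNReal.ofReal s * net.interference ω) ∂μ = S.La s * S.Le s := by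
  rw [integral_expNeg (net.measurable_interference.const_mul _).aemeasurable]
  simp_rw [interference, mul_add]
  rw [net.lintegral_lexp_interference hs hs, ← ENNReal.ofReal_mul (S.La_nonneg hs),
    ENNReal.toReal_ofReal (mul_nonneg (S.La_nonneg hs) (S.Le_nonneg s))]

/-- The mean of the approximate tail for a desired link in state `κ` at distance `w`. -/
def meanTail (T : ℝ) (κ : Link) (w : ℝ) : ℝ :=
  ∫ ω, S.approxTail κ (S.fadingLevel T κ w (net.interference ω)) ∂μ

theorem measurable_approxTail_fadingLevel (T : ℝ) (κ : Link) :
    Measurable fun p : ℝ × Ω => S.approxTail κ (S.fadingLevel T κ p.1 (net.interference p.2)) := by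
  have h1 := net.measurable_interference
  have h2 : Measurable fun p : ℝ × Ω => (p.1, net.interference p.2) := by fun_prop
  have h3 := (S.measurable_approxTail κ).comp ((S.measurable_fadingLevel T κ).comp h2)
  exact h3

theorem ofReal_meanTail [IsProbabilityMeasure μ] (T : ℝ) (κ : Link) (w : ℝ) :
    ENNReal.ofReal (net.meanTail T κ w) =
      ∫⁻ ω, ENNReal.ofReal (S.approxTail κ (S.fadingLevel T κ w (net.interference ω))) ∂μ := by
  refine ofReal_integral_eq_lintegral_ofReal (Integrable.of_bound
    ((net.measurable_approxTail_fadingLevel T κ).comp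
      measurable_prodMk_left).aestronglyMeasurable 1 (Filter.Eventually.of_forall fun ω => ?_))
    (Filter.Eventually.of_forall fun ω => S.approxTail_nonneg _ _)
  rw [Real.norm_of_nonneg (S.approxTail_nonneg _ _)]
  exact S.approxTail_le_one _ _

theorem meanTail_nonneg (T : ℝ) (κ : Link) (w : ℝ) : 0 ≤ net.meanTail T κ w :=
  integral_nonneg fun _ => S.approxTail_nonneg _ _

theorem meanTail_le_one [IsProbabilityMeasure μ] (T : ℝ) (κ : Link) (w : ℝ) :
    net.meanTail T κ w ≤ 1 := by
  rw [← ENNReal.ofReal_le_ofReal_iff zero_le_one, net.ofReal_meanTail]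
  calc _ ≤ ∫⁻ ω, 1 ∂μ := lintegral_mono fun ω => by
        simpa using ENNReal.ofReal_le_ofReal (S.approxTail_le_one κ _)
    _ = ENNReal.ofReal 1 := by simp

theorem measurable_meanTail [IsProbabilityMeasure μ] (T : ℝ) (κ : Link) :
    Measurable (net.meanTail T κ) :=
  (net.measurable_approxTail_fadingLevel T κ).stronglyMeasurable.integral_prod_right'.measurable

/-- In the binomial expansion of the approximate tail, the `n`-th power of the exponential splits
into a constant noise factor and the Laplace kernel of the interference at `n η T / a`. -/
theorem meanTail_mul_pdfIntra [IsProbabilityMeasure μ] {T : ℝ} (hT : 0 < T) (κ : Link) (w : ℝ) :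
    net.meanTail T κ w * S.shape.pdfIntra w = S.Psi T κ w := by
  have ha := S.signalScale_pos κ w
  have hη := S.eta_pos κ
  have hn := div_pos S.noise_pos S.Pu_pos
  have hPu := S.Pu_pos.ne'
  set a := S.signalScale κ w with ha'
  have hs : ∀ n : ℕ, 0 ≤ (n : ℝ) * S.eta κ * T / a := fun n => by positivity
  have hx : ∀ (n : ℕ) (ω : Ω), expNeg (ENNReal.ofReal (S.eta κ) *
      S.fadingLevel T κ w (net.interference ω)) ^ n =
      expNeg (ENNReal.ofReal ((n : ℝ) * S.eta κ * T / a) * net.interference ω) *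
        Real.exp (-((n : ℝ) * S.eta κ * T * S.noise / (S.Pu * a))) := by
    intro n ω
    have h1 : (n : ℝ) * S.eta κ * T * S.noise / (S.Pu * a) =
        (n : ℝ) * S.eta κ * T / a * (S.noise / S.Pu) := by field_simp
    have h2 : (n : ℝ≥0∞) * (ENNReal.ofReal (S.eta κ) * ENNReal.ofReal (T / a)) =
        ENNReal.ofReal ((n : ℝ) * S.eta κ * T / a) := by
      rw [← ENNReal.ofReal_natCast n, ← ENNReal.ofReal_mul hη.le,
        ← ENNReal.ofReal_mul (Nat.cast_nonneg n)]
      congr 1; ring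
    rw [expNeg_pow, Setting.fadingLevel, ← S.signalScale_eq, ← ha', h1,
      ← expNeg_ofReal (mul_nonneg (hs n) hn.le), ← expNeg_add, ENNReal.ofReal_mul (hs n), ← h2]
    congr 1; ring
  have hint : ∀ n : ℕ, Integrable (fun ω =>
      expNeg (ENNReal.ofReal ((n : ℝ) * S.eta κ * T / a) * net.interference ω)) μ := by
    intro n
    refine Integrable.of_bound (measurable_expNeg.comp
      (net.measurable_interference.const_mul _)).aestronglyMeasurable 1
      (Filter.Eventually.of_forall fun ω => ?_)
    rw [Real.norm_of_nonneg (expNeg_nonneg _)]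
    exact expNeg_le_one _
  have hmean : net.meanTail T κ w = ∑ n ∈ Finset.Icc 1 (S.Nak κ),
      (-1) ^ (n + 1) * ((S.Nak κ).choose n : ℝ) *
        (S.La ((n : ℝ) * S.eta κ * T / a) * S.Le ((n : ℝ) * S.eta κ * T / a) *
          Real.exp (-((n : ℝ) * S.eta κ * T * S.noise / (S.Pu * a)))) := by
    unfold meanTail Setting.approxTail
    simp_rw [one_sub_one_sub_pow, hx]
    rw [integral_finsetSum _ fun n _ => ((hint n).mul_const _).const_mul _]
    refine Finset.sum_congr rfl fun n _ => ?_
    rw [integral_const_mul, integral_mul_const, net.integral_expNeg_interference (hs n)]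
  rw [hmean, Setting.Psi, Finset.sum_mul]
  refine Finset.sum_congr rfl fun n _ => ?_
  rw [← ha']; ring

/-- The mean of the approximate tail for a desired link at distance `w`. -/
def meanTailCell (T w : ℝ) : ℝ := ∑ κ, S.linkProb κ (S.cellIndex w) * net.meanTail T κ w

theorem integrand_cellIndex [IsProbabilityMeasure μ] {T : ℝ} (hT : 0 < T) (w : ℝ) :
    S.integrand T (S.cellIndex w) w = net.meanTailCell T w * S.shape.pdfIntra w := by
  rw [Setting.integrand, ← net.meanTail_mul_pdfIntra hT, ← net.meanTail_mul_pdfIntra hT,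
    meanTailCell, sum_link]
  ring

theorem meanTailCell_nonneg (T w : ℝ) : 0 ≤ net.meanTailCell T w :=
  Finset.sum_nonneg fun κ _ => mul_nonneg (S.linkProb_nonneg κ _) (net.meanTail_nonneg T κ w)

theorem meanTailCell_le_one [IsProbabilityMeasure μ] (T w : ℝ) : net.meanTailCell T w ≤ 1 := by
  have h := S.linkProb_add (S.cellIndex w)
  rw [← sum_link fun κ => S.linkProb κ (S.cellIndex w)] at h
  rw [← h]
  exact Finset.sum_le_sum fun κ _ =>
    mul_le_of_le_one_right (S.linkProb_nonneg κ _) (net.meanTail_le_one T κ w)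

theorem measurable_meanTailCell [IsProbabilityMeasure μ] (T : ℝ) :
    Measurable (net.meanTailCell T) := by
  have := net.measurable_meanTail T
  unfold meanTailCell
  fun_prop

/-- The integrand is a probability-weighted mean with values in `[0, 1]` times the density of the
distance, although the alternating sum `Psi` does not show it. -/
theorem integrableOn_integrand (net : Network S μ) [IsProbabilityMeasure μ] {T : ℝ} (hT : 0 < T) :
    IntegrableOn (fun w => S.integrand T (S.cellIndex w) w) (Set.Ioi 0) := by
  simp_rw [net.integrand_cellIndex hT]
  refine Integrable.bdd_mul (c := 1) S.shape.integrableOn_pdfIntra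
    (net.measurable_meanTailCell T).aestronglyMeasurable (Filter.Eventually.of_forall fun w => ?_)
  rw [Real.norm_of_nonneg (net.meanTailCell_nonneg T w)]
  exact net.meanTailCell_le_one T w

/-- Tonelli exchanges the averages over the interference and over the position of the transmitting
user. The inner mean depends on the distance alone, so its density `pdfIntra` and the partition into
cells finish the identification. -/
theorem integral_approxTail_level [IsProbabilityMeasure μ] {T : ℝ} (hT : 0 < T) :
    ∫ ω, S.approxTail (net.state₀ ω) (net.level T ω) ∂μ = S.coverageFormula T := by
  have hint := net.integrableOn_integrand hT
  have hsum := (S.hasSum_cells (F := S.integrand T) hint).2.tsum_eq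
  rw [Setting.coverageFormula, hsum, integral_eq_lintegral_of_nonneg_ae
    (Filter.Eventually.of_forall fun ω => S.approxTail_nonneg _ _)
    (net.integrable_approxTail_level T).1]
  have hA : ∀ κ, Measurable fun x => ENNReal.ofReal (S.approxTail κ x) := fun κ => by fun_prop
  rw [net.lintegral_tail_level T hA, lintegral_lintegral_swap]
  · have h1 : ∀ u : Plane, ∫⁻ ω, ∑ κ, ENNReal.ofReal (S.linkProb κ (S.cellIndex ‖u‖)) *
        ENNReal.ofReal (S.approxTail κ (S.fadingLevel T κ ‖u‖ (net.interference ω))) ∂μ =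
        ENNReal.ofReal (net.meanTailCell T ‖u‖) := by
      intro u
      have hm : ∀ κ, Measurable fun ω => ENNReal.ofReal
          (S.approxTail κ (S.fadingLevel T κ ‖u‖ (net.interference ω))) := fun κ =>
        ((net.measurable_approxTail_fadingLevel T κ).comp measurable_prodMk_left).ennreal_ofReal
      rw [lintegral_finsetSum _ fun κ _ => (hm κ).const_mul _, meanTailCell,
        ENNReal.ofReal_sum_of_nonneg fun κ _ =>
          mul_nonneg (S.linkProb_nonneg κ _) (net.meanTail_nonneg T κ _)]
      refine Finset.sum_congr rfl fun κ _ => ?_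
      rw [lintegral_const_mul _ (hm κ), ENNReal.ofReal_mul (S.linkProb_nonneg κ _),
        net.ofReal_meanTail]
    simp_rw [h1]
    rw [S.shape.lintegral_law_norm (h := fun w => ENNReal.ofReal (net.meanTailCell T w))
      (net.measurable_meanTailCell T).ennreal_ofReal, integral_eq_lintegral_of_nonneg_ae]
    · congr 1
      refine lintegral_congr fun w => ?_
      rw [net.integrand_cellIndex hT, ENNReal.ofReal_mul (net.meanTailCell_nonneg T w)]
    · filter_upwards [ae_restrict_mem measurableSet_Ioi] with w (hw : 0 < w)
      rw [net.integrand_cellIndex hT]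
      exact mul_nonneg (net.meanTailCell_nonneg T w) (S.shape.pdfIntra_nonneg hw.le)
    · exact hint.1
  · refine Measurable.aemeasurable ?_
    refine Finset.measurable_fun_sum _ fun κ _ => ?_
    have h1 : Measurable fun p : Ω × Plane =>
        ENNReal.ofReal (S.linkProb κ (S.cellIndex ‖p.2‖)) := by fun_prop
    have h2 : Measurable fun p : Ω × Plane => (‖p.2‖, p.1) := by fun_prop
    have h3 := ((net.measurable_approxTail_fadingLevel T κ).comp h2).ennreal_ofReal
    exact h1.mul h3

end Network

end UAVUplink

end

theorem theorem2 {Ω : Type*} [MeasurableSpace Ω] (μ : Measure Ω) [IsProbabilityMeasure μ]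
    (S : UAVUplink.Setting) (net : UAVUplink.Network S μ) (T : ℝ) (hT : 0 < T) :
    -- the two factors are the Laplace transforms of the two kinds of interference
    (∀ s : ℝ, 0 ≤ s → ∫ ω, UAVUplink.expNeg (ENNReal.ofReal s * net.intra ω) ∂μ = S.La s) ∧
    (∀ s : ℝ, 0 ≤ s → ∫ ω, UAVUplink.expNeg (ENNReal.ofReal s * net.inter ω) ∂μ = S.Le s) ∧
    -- the analytical expression is well defined
    (∀ γ : ℕ, IntervalIntegrable (S.integrand T γ) volume (S.cell γ) (S.cell (γ + 1))) ∧
    Summable (fun γ : ℕ => ∫ w in S.cell γ..S.cell (γ + 1), S.integrand T γ w) ∧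
    -- it is the coverage probability with the tail of the desired fading power replaced
    ∫ ω, S.approxTail (net.state₀ ω) (net.level T ω) ∂μ = S.coverageFormula T ∧
    -- it is an upper bound,
    net.coverage T ≤ S.coverageFormula T ∧
    -- with an error of at most the uniform error of the tail approximation,
    (∀ δ : ℝ, (∀ (κ : UAVUplink.Link) (x : ℝ), 0 ≤ x →
        |(gammaMeasure (S.Nak κ) (S.Nak κ)).real (Set.Ioi x) -
          (1 - (1 - Real.exp (-(S.eta κ * x))) ^ S.Nak κ)| ≤ δ) →
      |net.coverage T - S.coverageFormula T| ≤ δ) ∧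
    -- and it is exact for Rayleigh fading
    ((∀ κ, S.Nak κ = 1) → net.coverage T = S.coverageFormula T) := by
  have hcells := S.hasSum_cells (F := S.integrand T) (net.integrableOn_integrand hT)
  have hA := net.integral_approxTail_level hT
  refine ⟨fun s hs => net.integral_expNeg_intra hs, fun s hs => net.integral_expNeg_inter hs,
    hcells.1, hcells.2.summable, hA, ?_, ?_, ?_⟩
  · rw [net.coverage_eq hT, ← hA]
    exact integral_mono (net.integrable_fadingTail_level T) (net.integrable_approxTail_level T)
      fun ω => S.fadingTail_le_approxTail _ _
  · intro δ hδ
    -- The supremum is encoded by its upper bounds `δ`. Nonnegativity is needed for outcomes with an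
    -- infinite level, where both tails vanish.
    have hδ0 : 0 ≤ δ := (abs_nonneg _).trans (hδ .los 0 le_rfl)
    rw [net.coverage_eq hT, ← hA, ← integral_sub (net.integrable_fadingTail_level T)
      (net.integrable_approxTail_level T), ← Real.norm_eq_abs]
    refine (norm_integral_le_of_norm_le_const (C := δ)
      (Filter.Eventually.of_forall fun ω => ?_)).trans_eq (by simp)
    rw [Real.norm_eq_abs]
    by_cases hx : net.level T ω = ∞
    · simpa [hx, S.fadingTail_top, S.approxTail_top] using hδ0
    · rw [S.fadingTail_of_ne_top _ hx, S.approxTail_of_ne_top _ hx]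
      exact hδ _ _ ENNReal.toReal_nonneg
  · intro hN
    rw [net.coverage_eq hT, ← hA]
    exact integral_congr_ae (Filter.Eventually.of_forall fun ω =>
      S.fadingTail_eq_approxTail _ (hN _) _)
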